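/- **Conventions.** $\mathbb T=\mathbb R/2\pi\mathbb Z$. For $\gamma>0$ and $\tau\ge N$, $DC(\gamma,\tau)$ is the set of $\xi\in\mathbb R^N$ with $|\langle\xi,k\rangle|\ge\gamma|k|_1^{-\tau}$ for all $k\in\mathbb Z^N\setminus\{0\}$; $\xi$ is Diophantine if it lies in some such class. Let $h_{\mathrm{mech}}(x,y)=\tfrac12|y|^2-V(|x|)$, $x,y\in\mathbb R^N$. **Property P1 at a torus.** Let $\mathcal T_i$ ($i\in\mathbb N$) be tori in the phase space of Hamiltonians $h_i$, and let $\xi_0^i\in\mathbb R^N$. The family $(h_i)$ satisfies P1 at $(\mathcal T_i)$ with frequencies $(\xi_0^i)$ if there are $\rho,\sigma,\gamma>0$, $\tau\ge N$ and a compact $K\subset\mathbb R^N$ such that for every $i$: $\xi_0^i\in K\cap DC(\gamma,\tau)$, and there is a real-analytic coordinate system $(\varphi,J)$, symplectic ($\sum dx_j\wedge dy_j=\sum d\varphi_j\wedge dJ_j$), holomorphic and injective on the complex domain $\{\varphi\in(\mathbb C/2\pi\mathbb Z)^N:|\mathrm{Im}\,\varphi|_\infty<\sigma\}\times\{J\in\mathbb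 C^N:|J|<\rho\}$, real on real points, with $\mathcal T_i=\{J=0,\ \varphi\in\mathbb T^N\}$, in which $$h_i=e_i+\langle\xi_0^i,J\rangle+\tfrac12\langle A_iJ,J\rangle+P_i(\varphi,J),$$ where $e_i\in\mathbb R$ is a constant, $A_i$ is an invertible symmetric matrix, $P_i$ is real-analytic (holomorphic on the same domain) with $\partial_J^nP_i|_{J=0}=0$ for $n\le2$; and moreover $\sup_i\|A_i^{-1}\|<\infty$. A single Hamiltonian $h$ satisfies P1 at $\mathcal T$ with frequency $\xi$ if the constant family $h_i=h$, $\mathcal T_i=\mathcal T$, $\xi_0^i=\xi$ does. **Proposition.** *(N=1)* Let $I\subset\mathbb R$ be an open interval (for instance $I=(0,\infty)$ or $I=\mathbb R$) on which $x\mapsto V(|x|)$ is real-analytic, and take $I\times\mathbb R$ as phase space. Assume A.1: there is a non-empty interval $(a,b)$ such that for all $h\in(a,b)$ the energy level $\{h_{\mathrm{mech}}=h\}\subset I\times\mathbb R$ is a smooth closed curve, and the action map $h\mapsto L(h)=\frac1{2\pi}\oint_{\{h_{\mathrm{mech}}=h\}}y\,dx$ has an inverse $L\mapsto h(L)$ with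 $\partial_L^2h\ne0$ at every $L(h)$, $h\in(a,b)$. Then for every $h_*\in(a,b)$ for which the frequency $\xi_*=\partial_Lh(L(h_*))$ is Diophantine, $h_{\mathrm{mech}}$ satisfies P1 at the invariant torus $\{h_{\mathrm{mech}}=h_*\}$ with frequency $\xi_*$. *(N=2)* Let $V:(0,\infty)\to\mathbb R$ be real-analytic, and take $(\mathbb R^2\setminus\{0\})\times\mathbb R^2$ as phase space. Put $\mathtt h(r,\mathcal R;\mathcal G)=\frac{\mathcal R^2}2+\frac{\mathcal G^2}{2r^2}-V(r)$ for $r>0$. Assume A.2: there are non-empty intervals $(a,b)$, $(g_1,g_2)$ such that for all $(h,\mathcal G)\in(a,b)\times(g_1,g_2)$ the level $\{(r,\mathcal R):\mathtt h(r,\mathcal R;\mathcal G)=h\}$ is a closed curve, and, with $L(h,\mathcal G)=\frac1{2\pi}\oint_{\{\mathtt h(\cdot;\mathcal G)=h\}}\mathcal R\,dr$, the map $(h,\mathcal G)\mapsto(L(h,\mathcal G),\mathcal G)$ has near that point a local inverse $(L,\mathcal G)\mapsto(\hat h(L,\mathcal G),\mathcal G)$ with $\hat h$ differentiable and $\nabla\hat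 h$ a local ($C^1$) diffeomorphism at the corresponding point $(L,\mathcal G)$. Then for every $(h_*,\mathcal G_*)\in(a,b)\times(g_1,g_2)$ for which the frequency $\xi_*=\nabla\hat h(L(h_*,\mathcal G_*),\mathcal G_*)$ is Diophantine, $h_{\mathrm{mech}}$ satisfies P1 at the invariant torus $\{h_{\mathrm{mech}}=h_*,\ x_1y_2-x_2y_1=\mathcal G_*\}$ with frequency $\xi_*$. -/

import Mathlib

open scoped ContDiff Manifold

/-- Real phase space `ℝᴺ × ℝᴺ` of pairs (position, momentum), or (angle, action). -/
abbrev Phase (N : ℕ) : Type :=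
  EuclideanSpace ℝ (Fin N) × EuclideanSpace ℝ (Fin N)

/-- Complex phase space `ℂᴺ × ℂᴺ`. -/
abbrev CPhase (N : ℕ) : Type :=
  EuclideanSpace ℂ (Fin N) × EuclideanSpace ℂ (Fin N)

noncomputable section

/-- The mechanical Hamiltonian `|y|²/2 - V(|x|)`, with `z = (x, y)`. -/
def mechHam (N : ℕ) (V : ℝ → ℝ) (z : Phase N) : ℝ :=
  ‖z.2‖ ^ 2 / 2 - V ‖z.1‖

/-! ### The non-degenerate Lagrangian torus property -/

/-- The Diophantine class `DC(γ, τ)`: `|⟨ξ, k⟩| ≥ γ |k|₁^(-τ)` for all nonzero integer vectors. -/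
def DiophantineClass (N : ℕ) (γ τ : ℝ) : Set (EuclideanSpace ℝ (Fin N)) :=
  {ξ | ∀ k : Fin N → ℤ, k ≠ 0 →
    γ / (∑ j, |(k j : ℝ)|) ^ τ ≤ |∑ j, ξ j * (k j : ℝ)|}

/-- A frequency vector is Diophantine if it lies in some class `DC(γ, τ)`, `γ > 0`, `τ ≥ N`. -/
def IsDiophantine {N : ℕ} (ξ : EuclideanSpace ℝ (Fin N)) : Prop :=
  ∃ γ τ : ℝ, 0 < γ ∧ (N : ℝ) ≤ τ ∧ ξ ∈ DiophantineClass N γ τ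

/-- The inclusion of real phase space in complex phase space. -/
def complexifyPhase {N : ℕ} (z : Phase N) : CPhase N :=
  (WithLp.toLp 2 fun j => (z.1 j : ℂ), WithLp.toLp 2 fun j => (z.2 j : ℂ))

/-- The (complex bilinear) canonical symplectic form `∑ⱼ dxⱼ ∧ dyⱼ`. -/
def symplForm {N : ℕ} (u v : CPhase N) : ℂ :=
  ∑ j, (u.1 j * v.2 j - u.2 j * v.1 j)

/-- The lift to `ℂᴺ × ℂᴺ` of the complex domain `𝕋ᴺ_σ × Bᴺ_ρ`, where `𝕋 = ℂ / 2πℤ`: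
angles with `|Im φ|_∞ < σ` and actions in the complex ball of radius `ρ`. -/
def torusBall (N : ℕ) (σ ρ : ℝ) : Set (CPhase N) :=
  {z | (∀ j, |(z.1 j).im| < σ) ∧ ‖z.2‖ < ρ}

/-- `Ψ` is (the inverse of) a symplectic real-analytic coordinate system `(φ, J)` on a set
`M ≃ 𝕋ᴺ_σ × Bᴺ_ρ` around the torus `T`, mapping real points into the real phase space `Ω`
by `ψ`. -/
structure IsSymplecticChart {N : ℕ} (Ω T : Set (Phase N)) (σ ρ : ℝ)
    (ψ : Phase N → Phase N) (Ψ : CPhase N → CPhase N) : Prop where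
  /-- `Ψ` is holomorphic on the complex domain. -/
  holomorphic : DifferentiableOn ℂ Ψ (torusBall N σ ρ)
  /-- `Ψ` is well defined and injective on `𝕋ᴺ_σ × Bᴺ_ρ`, the angles being taken mod `2π`. -/
  eq_iff : ∀ z ∈ torusBall N σ ρ, ∀ z' ∈ torusBall N σ ρ,
    (Ψ z = Ψ z' ↔
      z.2 = z'.2 ∧ ∃ k : Fin N → ℤ, ∀ j, z.1 j = z'.1 j + 2 * (Real.pi : ℂ) * (k j : ℂ))
  /-- `Ψ` pulls the canonical form `∑ dxⱼ ∧ dyⱼ` back to `∑ dφⱼ ∧ dJⱼ`. -/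
  symplectic : ∀ z ∈ torusBall N σ ρ, ∀ u v : CPhase N,
    symplForm (fderiv ℂ Ψ z u) (fderiv ℂ Ψ z v) = symplForm u v
  /-- `Ψ` is real on real points, where it coincides with `ψ`. -/
  real_on_real : ∀ z : Phase N, ‖z.2‖ < ρ → Ψ (complexifyPhase z) = complexifyPhase (ψ z)
  /-- Real points are mapped into the phase space. -/
  mem_phase : ∀ z : Phase N, ‖z.2‖ < ρ → ψ z ∈ Ω
  /-- The torus is `{J = 0}`. -/
  torus : Set.range (fun φ : EuclideanSpace ℝ (Fin N) => ψ (φ, 0)) = T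

/-- The Hamiltonian `h` on the phase space `Ω` has, in a symplectic real-analytic coordinate
system `(φ, J)` with domain `𝕋ᴺ_σ × Bᴺ_ρ` around the torus `T = {J = 0}`, the normal form
`e + ⟨ξ, J⟩ + ⟨A J, J⟩ / 2 + P(φ, J)` with `e` a constant (the energy of the torus) and `P` real
analytic, `∂ⁿP/∂Jⁿ = 0` on `{J = 0}` for `n ≤ 2`. -/
def HasNormalForm {N : ℕ} (Ω : Set (Phase N)) (h : Phase N → ℝ) (T : Set (Phase N))
    (σ ρ : ℝ) (ξ : EuclideanSpace ℝ (Fin N)) (A : Matrix (Fin N) (Fin N) ℝ) : Prop :=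
  ∃ (ψ : Phase N → Phase N) (Ψ : CPhase N → CPhase N) (P : CPhase N → ℂ) (e : ℝ),
    IsSymplecticChart Ω T σ ρ ψ Ψ ∧
    DifferentiableOn ℂ P (torusBall N σ ρ) ∧
    (∀ z ∈ torusBall N σ ρ, ∀ n : ℕ, n ≤ 2 →
      iteratedFDeriv ℂ n (fun J : EuclideanSpace ℂ (Fin N) => P (z.1, J)) 0 = 0) ∧
    ∀ z : Phase N, ‖z.2‖ < ρ →
      (h (ψ z) : ℂ) =
        ((e + ∑ j, ξ j * z.2 j + (1 / 2) * ∑ j, ∑ k, A j k * z.2 k * z.2 j : ℝ) : ℂ)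
          + P (complexifyPhase z)

/-- Property P1 (non-degenerate Lagrangian invariant torus) of the family `(h i)` of Hamiltonians
on the phase space `Ω`, realized at the tori `T i` with frequency vectors `ξ i`. -/
def PropertyP1 {N : ℕ} (Ω : Set (Phase N)) (h : ℕ → Phase N → ℝ)
    (T : ℕ → Set (Phase N)) (ξ : ℕ → EuclideanSpace ℝ (Fin N)) : Prop :=
  ∃ ρ σ γ τ : ℝ, 0 < ρ ∧ 0 < σ ∧ 0 < γ ∧ (N : ℝ) ≤ τ ∧
    ∃ K : Set (EuclideanSpace ℝ (Fin N)), IsCompact K ∧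
    ∃ A : ℕ → Matrix (Fin N) (Fin N) ℝ,
      (∀ i, ξ i ∈ K ∧ ξ i ∈ DiophantineClass N γ τ ∧ (A i).IsSymm ∧ IsUnit (A i).det ∧
        HasNormalForm Ω (h i) (T i) σ ρ (ξ i) (A i)) ∧
      ∃ C : ℝ, ∀ i, ‖Matrix.toEuclideanCLM (𝕜 := ℝ) ((A i)⁻¹)‖ ≤ C

/-! ### Levels and actions of one degree-of-freedom Hamiltonians `p²/2 + W(r)` -/

/-- The level curve `{(r, p) : r ∈ I, p²/2 + W(r) = h}`. -/
def levelCurve (I : Set ℝ) (W : ℝ → ℝ) (h : ℝ) : Set (ℝ × ℝ) :=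
  {q | q.1 ∈ I ∧ q.2 ^ 2 / 2 + W q.1 = h}

/-- The action `(1/2π) ∮ p dr` over the level curve, followed in the direction of the flow:
`r` increases on the upper branch `p = √(2(h - W))` and decreases on the lower branch
`p = -√(2(h - W))`, so each of the two branches contributes `∫ √(2(h - W)) dr`. -/
def loopAction (I : Set ℝ) (W : ℝ → ℝ) (h : ℝ) : ℝ :=
  1 / (2 * Real.pi) * (2 * ∫ r in {r | r ∈ I ∧ W r ≤ h}, Real.sqrt (2 * (h - W r)))

/-- A smooth (simple, regular) closed curve in the plane. -/
def IsSmoothClosedCurve (S : Set (ℝ × ℝ)) : Prop :=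
  ∃ c : ℝ → ℝ × ℝ, ContDiff ℝ ∞ c ∧ Function.Periodic c 1 ∧ (∀ t, deriv c t ≠ 0) ∧
    Set.InjOn c (Set.Ico 0 1) ∧ Set.range c = S

/-- A (simple) closed curve in the plane: a homeomorphic image of the circle. -/
def IsClosedCurve (S : Set (ℝ × ℝ)) : Prop :=
  Nonempty (Circle ≃ₜ S)

/-! ### Motion on a line, `N = 1` -/

/-- The potential energy `-V(|x|)` on the line. -/
def linePot (V : ℝ → ℝ) (x : ℝ) : ℝ := -V |x|

/-- Assumption A.1 for positions in `I` and energies in `(a, b)`, where `H` is the inverse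
`L ↦ h(L)` of the action map `h ↦ L(h)`. -/
structure AssumptionA1 (V : ℝ → ℝ) (I : Set ℝ) (a b : ℝ) (H : ℝ → ℝ) : Prop where
  nonempty : a < b
  compactness : ∀ h ∈ Set.Ioo a b, IsSmoothClosedCurve (levelCurve I (linePot V) h)
  inverse : ∀ h ∈ Set.Ioo a b, H (loopAction I (linePot V) h) = h
  nondegenerate : ∀ h ∈ Set.Ioo a b, deriv (deriv H) (loopAction I (linePot V) h) ≠ 0

/-- The phase space `I × ℝ`. -/
def linePhase (I : Set ℝ) : Set (Phase 1) := {z | z.1 0 ∈ I}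

/-- The invariant torus of energy `h` in `I × ℝ`. -/
def lineTorus (V : ℝ → ℝ) (I : Set ℝ) (h : ℝ) : Set (Phase 1) :=
  {z | z ∈ linePhase I ∧ mechHam 1 V z = h}

/-! ### Motion on the plane, `N = 2` -/

/-- The effective potential `G²/(2r²) - V(r)`. -/
def effPot (V : ℝ → ℝ) (G r : ℝ) : ℝ := G ^ 2 / (2 * r ^ 2) - V r

/-- The radial action `L(h, G)`. -/
def radialAction (V : ℝ → ℝ) (h G : ℝ) : ℝ := loopAction (Set.Ioi 0) (effPot V G) h

/-- `Hhat` is the energy component of a local inverse `(L, G) ↦ (h, G)` of the action map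
`(h, G) ↦ (L(h, G), G)` at the point `(h₀, G₀)`. -/
structure IsLocalEnergyMap (V : ℝ → ℝ) (h₀ G₀ : ℝ) (Hhat : EuclideanSpace ℝ (Fin 2) → ℝ) :
    Prop where
  left_inv : ∀ᶠ p : ℝ × ℝ in nhds (h₀, G₀), Hhat !₂[radialAction V p.1 p.2, p.2] = p.1
  right_inv : ∀ᶠ q in nhds (!₂[radialAction V h₀ G₀, G₀] : EuclideanSpace ℝ (Fin 2)),
    radialAction V (Hhat q) (q 1) = q 0

/-- Assumption A.2 for energies in `(a, b)` and angular momenta in `(g₁, g₂)`. -/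
structure AssumptionA2 (V : ℝ → ℝ) (a b g₁ g₂ : ℝ) : Prop where
  nonempty_energy : a < b
  nonempty_momentum : g₁ < g₂
  compactness : ∀ h ∈ Set.Ioo a b, ∀ G ∈ Set.Ioo g₁ g₂,
    IsClosedCurve (levelCurve (Set.Ioi 0) (effPot V G) h)
  nondegenerate : ∀ h ∈ Set.Ioo a b, ∀ G ∈ Set.Ioo g₁ g₂,
    ∃ Hhat : EuclideanSpace ℝ (Fin 2) → ℝ, IsLocalEnergyMap V h G Hhat ∧
      (∀ᶠ q in nhds (!₂[radialAction V h G, G] : EuclideanSpace ℝ (Fin 2)),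
        DifferentiableAt ℝ Hhat q) ∧
      IsLocalDiffeomorphAt 𝓘(ℝ, EuclideanSpace ℝ (Fin 2)) 𝓘(ℝ, EuclideanSpace ℝ (Fin 2)) 1
        (gradient Hhat) !₂[radialAction V h G, G]

/-- The phase space `(ℝ² ∖ {0}) × ℝ²`. -/
def planePhase : Set (Phase 2) := {z | z.1 ≠ 0}

/-- The invariant torus of energy `h` and angular momentum `G`. -/
def planeTorus (V : ℝ → ℝ) (h G : ℝ) : Set (Phase 2) :=
  {z | z ∈ planePhase ∧ mechHam 2 V z = h ∧ z.1 0 * z.2 1 - z.1 1 * z.2 0 = G}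

end

set_option linter.unusedSectionVars false

noncomputable section

/-! ### Holomorphic functions of several variables -/

section Holomorphic

open Metric Set Filter Topology

variable {E F : Type*} [NormedAddCommGroup E] [NormedSpace ℂ E]
  [NormedAddCommGroup F] [NormedSpace ℂ F]

/-! The proof rests on a holomorphic parametrization of the closed orbits of y²/2 + G² u(x) + w(x) =
E. On the line u = 0 and G = 0; for the radial motion in the plane u = 1/(2x²) and w = -V. A level
that is a simple closed curve projects onto an interval [a, b], with potential equal to E exactly at
the ends and smaller inside (`exists_isPotentialWell`). If neither end is critical, both continue
holomorphically in (E, G). In the affine coordinate x = m + d Y that sends them to Y = ±1, division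
gives E - G² u - w = (1 - Y²) q with q > 0 on the segment (`exists_factorization`). Then Y = cos s,
y = -√(2q) sin s uniformizes all nearby orbits, turning points included (`exists_orbitFamily`).

Along this family let t be the time, S the integral of 2Gu dt and 𝒜 that of y dx. Then d𝒜 = y dx + t
dE - S dG, hence dx ∧ dy = dt ∧ dE - dS ∧ dG, and one full turn gives 2π dL = T dE - Σ dG. With the
angle 2πt/T and the periodic correction ν = Σt/T - S this becomes d(angle) ∧ dL + dν ∧ dG
(`twoForm_eq`). In the plane, polar coordinates add dθ ∧ dG, so (angle, θ + ν; L - L₀, G - G₀) are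
symplectic coordinates. The map A from orbit parameters to these coordinates and the map B to
Cartesian ones pull the symplectic form back to the same form; the chart is B ∘ A⁻¹, and its reality
follows from Schwarz reflection.

In the chart the energy is a holomorphic function of J alone. On real points L is the loop action,
so this function is the prescribed h(L) or ĥ(L, G), translated to the base point. Its Taylor
expansion of order two is the normal form: ξ is the gradient, the matrix is the Hessian, invertible
by non-degeneracy, and P is the remainder (`IsAngleActionPair.propertyP1`).

It remains to exclude critical turning points. For N = 1, differentiating the energy twice along a
regular curve does it. For N = 2 the level is only a topological circle. There ĥ is even in G, so at
G = 0 one frequency vanishes, which a Diophantine vector forbids. For G ≠ 0, a small change of G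
would give a critical turning point a slope of the wrong sign, although the nearby levels are still
wells (`deriv_effPot_ne_zero`). -/

theorem norm_fderiv_le_of_norm_le_on_ball {f : E → F} {c : E} {r M : ℝ} (hr : 0 < r)
    (hd : DifferentiableOn ℂ f (ball c r)) (hM : ∀ z ∈ ball c r, ‖f z‖ ≤ M) :
    ‖fderiv ℂ f c‖ ≤ 2 * M / r := by
  refine Complex.norm_fderiv_le_div_of_mapsTo_ball hd (fun z hz => ?_) hr
  rw [mem_closedBall, dist_eq_norm]
  linarith [norm_sub_le (f z) (f c), hM z hz, hM c (mem_ball_self hr)]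

/-- Parametric integrals of holomorphic functions are holomorphic. -/
theorem differentiableOn_intervalIntegral [FiniteDimensional ℂ E] [CompleteSpace F]
    {Φ : E → ℝ → F} {Ω : Set E} (hΩ : IsOpen Ω) {a b : ℝ} (hab : a ≤ b)
    (hc : ContinuousOn (Function.uncurry Φ) (Ω ×ˢ Icc a b))
    (hd : ∀ t ∈ Icc a b, DifferentiableOn ℂ (fun z => Φ z t) Ω) :
    DifferentiableOn ℂ (fun z => ∫ t in a..b, Φ z t) Ω := by
  intro z₀ hz₀
  have : ProperSpace E := FiniteDimensional.proper ℂ E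
  obtain ⟨r, hr, hrΩ⟩ := nhds_basis_closedBall.mem_iff.1 (hΩ.mem_nhds hz₀)
  have hK : IsCompact (closedBall z₀ r ×ˢ Icc a b) := (isCompact_closedBall _ _).prod isCompact_Icc
  have hcK : ContinuousOn (Function.uncurry Φ) (closedBall z₀ r ×ˢ Icc a b) :=
    hc.mono (prod_mono_left hrΩ)
  obtain ⟨M, hM⟩ := hK.exists_bound_of_continuousOn hcK
  have hcz : ∀ z ∈ closedBall z₀ r, ContinuousOn (Φ z) (Icc a b) := fun z hz =>
    hcK.comp (f := fun t => (z, t)) (by fun_prop) (fun t ht => ⟨hz, ht⟩)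
  -- Cauchy's estimate applied to differences turns uniform continuity of `Φ` into continuity in t
  -- of its derivative; this supplies measurability. The tolerance εr/4 becomes ε/2 after the
  -- estimate.
  have hderiv : ContinuousOn (fun t => fderiv ℂ (fun z => Φ z t) z₀) (Icc a b) := by
    have huc := hK.uniformContinuousOn_of_continuous hcK
    rw [Metric.uniformContinuousOn_iff] at huc
    rw [Metric.continuousOn_iff]
    intro t₀ ht₀ ε hε
    obtain ⟨δ, hδ, h⟩ := huc (ε * r / 4) (by positivity)
    refine ⟨δ, hδ, fun t ht htt => ?_⟩
    have hdt := fun t ht => (hd t ht).mono (ball_subset_closedBall.trans hrΩ)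
    have hda := fun t ht => (hdt t ht).differentiableAt (ball_mem_nhds z₀ hr)
    rw [dist_eq_norm, ← fderiv_fun_sub (hda t ht) (hda t₀ ht₀)]
    refine (norm_fderiv_le_of_norm_le_on_ball (M := ε * r / 4) hr
      ((hdt t ht).sub (hdt t₀ ht₀)) fun z hz => ?_).trans_lt ?_
    · change ‖Φ z t - Φ z t₀‖ ≤ _
      rw [← dist_eq_norm]
      refine (h (z, t) ⟨ball_subset_closedBall hz, ht⟩ (z, t₀) ⟨ball_subset_closedBall hz, ht₀⟩
        ?_).le
      simpa [Prod.dist_eq] using htt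
    · rw [show 2 * (ε * r / 4) / r = ε / 2 by field_simp; ring]
      linarith
  refine ((intervalIntegral.hasFDerivAt_integral_of_dominated_of_fderiv_le
    (F' := fun z t => fderiv ℂ (fun z => Φ z t) z) (bound := fun _ => 2 * M / (r / 2))
    (ball_mem_nhds z₀ (half_pos hr)) ?_ ?_ ?_ ?_ ?_ ?_).differentiableAt).differentiableWithinAt
  · filter_upwards [closedBall_mem_nhds z₀ hr] with z hz
    rw [uIoc_of_le hab]
    exact ((hcz z hz).mono Ioc_subset_Icc_self).aestronglyMeasurable measurableSet_Ioc
  · exact (hcz z₀ (mem_closedBall_self hr.le)).intervalIntegrable_of_Icc hab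
  · rw [uIoc_of_le hab]
    exact (hderiv.mono Ioc_subset_Icc_self).aestronglyMeasurable measurableSet_Ioc
  · refine MeasureTheory.ae_of_all _ fun t ht z hz => ?_
    rw [uIoc_of_le hab] at ht
    have hsub : ball z (r / 2) ⊆ closedBall z₀ r := by
      refine (ball_subset_ball' (ε₂ := r) ?_).trans ball_subset_closedBall
      linarith [mem_ball.1 hz]
    exact norm_fderiv_le_of_norm_le_on_ball (half_pos hr)
      ((hd t (Ioc_subset_Icc_self ht)).mono (hsub.trans hrΩ))
      fun y hy => hM (y, t) ⟨hsub hy, Ioc_subset_Icc_self ht⟩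
  · exact intervalIntegrable_const
  · refine MeasureTheory.ae_of_all _ fun t ht z hz => ?_
    rw [uIoc_of_le hab] at ht
    refine ((hd t (Ioc_subset_Icc_self ht)).differentiableAt (hΩ.mem_nhds (hrΩ ?_))).hasFDerivAt
    exact ball_subset_closedBall (ball_subset_ball (half_le_self hr.le) hz)

/-- Cauchy's formula on the circle w ↦ z + w v writes the directional derivative as a parametric
integral of `f`, so it is again holomorphic. -/
theorem DifferentiableOn.fderiv_apply_complex [FiniteDimensional ℂ E] [CompleteSpace F]
    {f : E → F} {Ω : Set E} (hf : DifferentiableOn ℂ f Ω) (hΩ : IsOpen Ω) (v : E) :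
    DifferentiableOn ℂ (fun z => fderiv ℂ f z v) Ω := by
  intro z₀ hz₀
  obtain ⟨r, hr, hrΩ⟩ := nhds_basis_closedBall.mem_iff.1 (hΩ.mem_nhds hz₀)
  obtain ⟨δ, hδ, hδv⟩ : ∃ δ : ℝ, 0 < δ ∧ δ * ‖v‖ < r / 2 :=
    ⟨r / 2 / (‖v‖ + 1), by positivity, by
      rw [div_mul_eq_mul_div, div_lt_iff₀ (by positivity)]; nlinarith [norm_nonneg v]⟩
  have hmem : ∀ z ∈ ball z₀ (r / 2), ∀ w : ℂ, ‖w‖ ≤ δ → z + w • v ∈ Ω := by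
    intro z hz w hw
    apply hrΩ
    rw [mem_closedBall, dist_eq_norm]
    rw [mem_ball, dist_eq_norm] at hz
    have : ‖w • v‖ ≤ δ * ‖v‖ := by rw [norm_smul]; gcongr
    calc ‖z + w • v - z₀‖ = ‖(z - z₀) + w • v‖ := by congr 1; abel
      _ ≤ _ := norm_add_le _ _
      _ ≤ r := by linarith
  have hkey : ∀ z ∈ ball z₀ (r / 2), fderiv ℂ f z v =
      (2 * Real.pi * Complex.I : ℂ)⁻¹ • ∮ w in C(0, δ), ((w - 0) ^ 2)⁻¹ • f (z + w • v) := by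
    intro z hz
    set U : Set ℂ := (fun w : ℂ => z + w • v) ⁻¹' Ω
    have hU : IsOpen U := hΩ.preimage (by fun_prop)
    have hg : DifferentiableOn ℂ (fun w : ℂ => f (z + w • v)) U :=
      hf.comp (by fun_prop) (fun w hw => hw)
    rw [Complex.two_pi_I_inv_smul_circleIntegral_sub_sq_inv_smul_of_differentiable hU
      (fun w hw => hmem z hz w (by simpa using hw)) hg (mem_ball_self hδ)]
    have h1 : HasFDerivAt f (fderiv ℂ f z) (z + (0 : ℂ) • v) := by
      simpa using (hf.differentiableAt
        (hΩ.mem_nhds (by simpa using hmem z hz 0 (by simpa using hδ.le)))).hasFDerivAt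
    have h2 : HasDerivAt (fun w : ℂ => z + w • v) v 0 := by
      simpa using ((hasDerivAt_id (0 : ℂ)).smul_const v).const_add z
    exact (h1.comp_hasDerivAt (0 : ℂ) h2).deriv.symm
  have hdiff : DifferentiableOn ℂ (fun z => (2 * Real.pi * Complex.I : ℂ)⁻¹ •
      ∮ w in C(0, δ), ((w - 0) ^ 2)⁻¹ • f (z + w • v)) (ball z₀ (r / 2)) := by
    refine DifferentiableOn.const_smul ?_ _
    have hcm : ∀ θ, ‖circleMap 0 δ θ‖ ≤ δ := fun θ => by simp [abs_of_pos hδ]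
    refine differentiableOn_intervalIntegral isOpen_ball Real.two_pi_pos.le ?_ ?_
    · have h1 : ContinuousOn (fun q : E × ℝ => f (q.1 + circleMap 0 δ q.2 • v))
          (ball z₀ (r / 2) ×ˢ Icc 0 (2 * Real.pi)) := by
        refine hf.continuousOn.comp (Continuous.continuousOn ?_)
          fun q hq => hmem _ hq.1 _ (hcm _)
        have := continuous_circleMap 0 δ
        fun_prop
      have h2 : Continuous fun q : E × ℝ => ((circleMap 0 δ q.2 - 0) ^ 2)⁻¹ := by
        refine Continuous.inv₀ ?_ fun q => ?_
        · have := continuous_circleMap 0 δ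
          fun_prop
        · simpa [circleMap] using hδ.ne'
      have h3 : Continuous fun q : E × ℝ => _root_.deriv (circleMap 0 δ) q.2 := by
        simp only [deriv_circleMap]
        have := continuous_circleMap 0 δ
        fun_prop
      exact h3.continuousOn.smul (h2.continuousOn.smul h1)
    · intro θ _
      refine DifferentiableOn.const_smul (DifferentiableOn.const_smul ?_ _) _
      exact hf.comp (by fun_prop) fun z hz => hmem z hz _ (hcm θ)
  have := (hdiff z₀ (mem_ball_self (half_pos hr))).differentiableAt (ball_mem_nhds z₀ (half_pos hr))
  refine (this.congr_of_eventuallyEq ?_).differentiableWithinAt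
  filter_upwards [ball_mem_nhds z₀ (half_pos hr)] with z hz using hkey z hz

/-- Holomorphic functions of finitely many variables are smooth. -/
theorem DifferentiableOn.contDiffOn_complex [FiniteDimensional ℂ E] [CompleteSpace F]
    {f : E → F} {Ω : Set E} (hf : DifferentiableOn ℂ f Ω) (hΩ : IsOpen Ω) :
    ContDiffOn ℂ ∞ f Ω := by
  rw [contDiffOn_infty]
  intro n
  induction n generalizing f with
  | zero => exact contDiffOn_zero.2 hf.continuousOn
  | succ n ih =>
    push_cast
    rw [contDiffOn_succ_iff_fderiv_of_isOpen hΩ]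
    exact ⟨hf, by simp, contDiffOn_clm_apply.2 fun v => ih (hf.fderiv_apply_complex hΩ v)⟩

end Holomorphic

/-! ### Primitives and division in one complex variable, with parameters. -/

section Segments

open Metric Set Filter Topology

variable {P : Type*} [NormedAddCommGroup P] [NormedSpace ℂ P]

/-- The average of `g` over the segment from `(c, p)` to `(s, p)`. -/
def segmentAverage (c : ℂ) (g : ℂ × P → ℂ) (z : ℂ × P) : ℂ :=
  ∫ τ in (0 : ℝ)..1, g (c + τ * (z.1 - c), z.2)

/-- Every slice of `Ω` in the first variable is star-shaped with centre `c`. -/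
def StarSlices (c : ℂ) (Ω : Set (ℂ × P)) : Prop :=
  ∀ z ∈ Ω, ∀ τ ∈ Icc (0 : ℝ) 1, (c + τ * (z.1 - c), z.2) ∈ Ω

variable {c : ℂ} {Ω : Set (ℂ × P)} {g : ℂ × P → ℂ}

theorem continuousOn_segment (hg : ContinuousOn g Ω) (hs : StarSlices c Ω) {z : ℂ × P}
    (hz : z ∈ Ω) : ContinuousOn (fun τ : ℝ => g (c + τ * (z.1 - c), z.2)) (Icc 0 1) :=
  hg.comp (by fun_prop) fun τ hτ => hs z hz τ hτ

theorem differentiableOn_segmentAverage [FiniteDimensional ℂ P] (hΩ : IsOpen Ω)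
    (hs : StarSlices c Ω) (hg : DifferentiableOn ℂ g Ω) :
    DifferentiableOn ℂ (segmentAverage c g) Ω := by
  refine differentiableOn_intervalIntegral hΩ zero_le_one ?_ fun τ hτ => ?_
  · exact hg.continuousOn.comp
      (f := fun q : (ℂ × P) × ℝ => (c + (q.2 : ℂ) * (q.1.1 - c), q.1.2)) (by fun_prop)
      fun q hq => hs q.1 hq.1 q.2 hq.2
  · exact hg.comp (f := fun z : ℂ × P => (c + (τ : ℂ) * (z.1 - c), z.2)) (by fun_prop)
      fun z hz => hs z hz τ hτ

/-- The primitive of `g` in the first variable which vanishes at `c`. -/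
def primitiveFst (c : ℂ) (g : ℂ × P → ℂ) (z : ℂ × P) : ℂ := (z.1 - c) * segmentAverage c g z

theorem differentiableOn_primitiveFst [FiniteDimensional ℂ P] (hΩ : IsOpen Ω)
    (hs : StarSlices c Ω) (hg : DifferentiableOn ℂ g Ω) :
    DifferentiableOn ℂ (primitiveFst c g) Ω :=
  DifferentiableOn.mul (by fun_prop) (differentiableOn_segmentAverage hΩ hs hg)

@[simp]
theorem primitiveFst_self (p : P) : primitiveFst c g (c, p) = 0 := by simp [primitiveFst]

theorem hasDerivAt_slice {f : ℂ × P → ℂ} (hΩ : IsOpen Ω) (hf : DifferentiableOn ℂ f Ω) {s : ℂ}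
    {p : P} (hz : (s, p) ∈ Ω) :
    HasDerivAt (fun s => f (s, p)) (fderiv ℂ f (s, p) (1, 0)) s := by
  have h1 := (hf.differentiableAt (hΩ.mem_nhds hz)).hasFDerivAt
  exact h1.comp_hasDerivAt s ((hasDerivAt_id s).prodMk (hasDerivAt_const s p))

/-- On the ray u ↦ c + u (s - c) the primitive is (s - c) times a real integral from 0 to u, so the
real fundamental theorem gives the derivative along the ray; as the complex derivative exists, this
determines it. The ray degenerates at s = c, where the product rule suffices. -/
theorem fderiv_primitiveFst [FiniteDimensional ℂ P] (hΩ : IsOpen Ω)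
    (hs : StarSlices c Ω) (hg : DifferentiableOn ℂ g Ω) {z : ℂ × P} (hz : z ∈ Ω) :
    fderiv ℂ (primitiveFst c g) z (1, 0) = g z := by
  obtain ⟨s, p⟩ := z
  have hG := hasDerivAt_slice hΩ (differentiableOn_primitiveFst hΩ hs hg) hz
  rcases eq_or_ne s c with rfl | hne
  · have hA := (hasDerivAt_slice hΩ (differentiableOn_segmentAverage hΩ hs hg) hz)
    have h := ((hasDerivAt_id s).sub_const s).mul hA
    have h2 : HasDerivAt (fun x => primitiveFst s g (x, p)) (g (s, p)) s := by
      refine h.congr_deriv ?_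
      simp [segmentAverage]
    exact hG.unique h2
  · set φ : ℝ → ℂ := fun τ => g (c + τ * (s - c), p)
    set O : Set ℝ := {τ : ℝ | (c + (τ : ℂ) * (s - c), p) ∈ Ω}
    have hO : IsOpen O := hΩ.preimage (by fun_prop)
    have hφ : ContinuousOn φ O := hg.continuousOn.comp (by fun_prop) fun τ hτ => hτ
    have h01 : Icc (0 : ℝ) 1 ⊆ O := fun τ hτ => hs _ hz τ hτ
    have h1 : (1 : ℝ) ∈ O := h01 (by simp)
    have hFTC : HasDerivAt (fun u : ℝ => ∫ τ in (0 : ℝ)..u, φ τ) (φ 1) 1 :=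
      intervalIntegral.integral_hasDerivAt_right
        ((hφ.mono h01).intervalIntegrable_of_Icc zero_le_one)
        (hφ.stronglyMeasurableAtFilter hO 1 h1) (hφ.continuousAt (hO.mem_nhds h1))
    have hscale : ∀ u : ℝ, primitiveFst c g (c + u * (s - c), p) =
        (s - c) * ∫ τ in (0 : ℝ)..u, φ τ := by
      intro u
      have := intervalIntegral.smul_integral_comp_mul_left (a := 0) (b := 1) φ u
      simp only [mul_zero, mul_one] at this
      rw [← this]
      simp only [primitiveFst, segmentAverage, φ, Complex.real_smul]
      push_cast
      simp only [add_sub_cancel_left]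
      rw [← mul_assoc, mul_comm (u : ℂ)]
      congr 2
      funext τ
      congr 3
      ring
    have hline : HasDerivAt (fun u : ℝ => c + (u : ℂ) * (s - c)) (s - c) 1 := by
      simpa using ((hasDerivAt_id (1 : ℝ)).ofReal_comp.mul_const (s - c)).const_add c
    have hG' : HasDerivAt (fun s => primitiveFst c g (s, p))
        (fderiv ℂ (primitiveFst c g) (s, p) (1, 0)) (c + ((1 : ℝ) : ℂ) * (s - c)) := by
      simpa using hG
    have hcomp := hG'.comp_of_eq (1 : ℝ) hline rfl
    have hcomp2 : HasDerivAt (fun u : ℝ => primitiveFst c g (c + u * (s - c), p))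
        ((s - c) * φ 1) 1 := by
      simp only [hscale]
      exact hFTC.const_mul _
    have := hcomp.unique hcomp2
    have hφ1 : φ 1 = g (s, p) := by simp [φ]
    rw [hφ1, mul_comm] at this
    exact mul_left_cancel₀ (sub_ne_zero.2 hne) this

/-- Division: a holomorphic function vanishing on `{c} × P` is divisible by `s - c`. -/
theorem eq_sub_mul_segmentAverage {k : ℂ × P → ℂ} (hΩ : IsOpen Ω) (hs : StarSlices c Ω)
    (hk : DifferentiableOn ℂ k Ω) (hg : ∀ z ∈ Ω, fderiv ℂ k z (1, 0) = g z)
    (hgc : ContinuousOn g Ω) {z : ℂ × P} (hz : z ∈ Ω) (h0 : k (c, z.2) = 0) :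
    k z = primitiveFst c g z := by
  obtain ⟨s, p⟩ := z
  have hd : ∀ τ ∈ uIcc (0 : ℝ) 1, HasDerivAt (fun τ : ℝ => k (c + τ * (s - c), p))
      ((s - c) * g (c + τ * (s - c), p)) τ := by
    intro τ hτ
    rw [uIcc_of_le zero_le_one] at hτ
    have hm := hs _ hz τ hτ
    have hline : HasDerivAt (fun u : ℝ => c + (u : ℂ) * (s - c)) (s - c) τ := by
      simpa using ((hasDerivAt_id τ).ofReal_comp.mul_const (s - c)).const_add c
    have := (hasDerivAt_slice hΩ hk hm).comp τ hline
    rw [hg _ hm, mul_comm] at this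
    exact this
  have := intervalIntegral.integral_eq_sub_of_hasDerivAt hd
    ((continuousOn_const.mul (continuousOn_segment hgc hs hz)).intervalIntegrable_of_Icc
      zero_le_one)
  rw [intervalIntegral.integral_const_mul] at this
  simp only [Complex.ofReal_one, Complex.ofReal_zero, one_mul, zero_mul, add_zero,
    add_sub_cancel] at this h0
  rw [primitiveFst, segmentAverage, this, h0, sub_zero]

theorem segmentAverage_ofReal {f : ℝ → ℝ} {c s : ℝ} {p : P}
    (hg : ∀ τ ∈ Icc (0 : ℝ) 1, g (c + τ * (s - c), p) = f (c + τ * (s - c))) :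
    segmentAverage c g (s, p) = ((∫ τ in (0 : ℝ)..1, f (c + τ * (s - c)) : ℝ) : ℂ) := by
  rw [segmentAverage, ← intervalIntegral.integral_ofReal]
  refine intervalIntegral.integral_congr fun τ hτ => ?_
  rw [uIcc_of_le zero_le_one] at hτ
  exact hg τ hτ

end Segments

/-! ### Injectivity criteria and holomorphic inverses. -/

section Injectivity

open Metric Set Filter Topology ComplexConjugate

/-- Noshiro–Warschawski: along the segment from w to z, the real part of f times the conjugate of z
- w has derivative |z - w|² Re f' > 0, so the end values differ. -/
theorem Convex.injOn_of_re_deriv_pos {S : Set ℂ} (hS : Convex ℝ S) {f f' : ℂ → ℂ}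
    (hf : ∀ z ∈ S, HasDerivAt f (f' z) z) (hpos : ∀ z ∈ S, 0 < (f' z).re) : InjOn f S := by
  intro w hw z hz hwz
  by_contra hne
  have hzw : z - w ≠ 0 := sub_ne_zero.2 (Ne.symm hne)
  set h : ℝ → ℝ := fun τ => (f (w + τ * (z - w)) * conj (z - w)).re
  have hmem : ∀ τ ∈ Icc (0 : ℝ) 1, w + (τ : ℂ) * (z - w) ∈ S := by
    intro τ hτ
    have := hS.add_smul_sub_mem hw hz hτ
    simpa using this
  have hd : ∀ τ ∈ Icc (0 : ℝ) 1,
      HasDerivAt h ((f' (w + τ * (z - w)) * (z - w) * conj (z - w)).re) τ := by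
    intro τ hτ
    have hline : HasDerivAt (fun u : ℝ => w + (u : ℂ) * (z - w)) (z - w) τ := by
      simpa using ((hasDerivAt_id τ).ofReal_comp.mul_const (z - w)).const_add w
    have := (((hf _ (hmem τ hτ)).comp τ hline).mul_const (conj (z - w)))
    exact (Complex.reCLM.hasFDerivAt.comp_hasDerivAt τ this)
  have hmono : StrictMonoOn h (Icc 0 1) := by
    refine strictMonoOn_of_deriv_pos (convex_Icc 0 1)
      (fun τ hτ => (hd τ hτ).continuousAt.continuousWithinAt) fun τ hτ => ?_
    have hτ' := interior_subset hτ
    rw [(hd τ hτ').deriv, mul_assoc, Complex.mul_conj, Complex.re_mul_ofReal]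
    exact mul_pos (hpos _ (hmem τ hτ')) (Complex.normSq_pos.2 hzw)
  have := hmono (left_mem_Icc.2 zero_le_one) (right_mem_Icc.2 zero_le_one) zero_lt_one
  simp [h, hwz] at this

variable {E : Type*} [NormedAddCommGroup E] [NormedSpace ℂ E] [FiniteDimensional ℂ E]

/-- An injective holomorphic map with injective derivatives is open with holomorphic inverse. -/
theorem Set.InjOn.exists_holomorphic_inverse {f : E → E} {Ω : Set E} (hΩ : IsOpen Ω)
    (hinj : InjOn f Ω) (hf : DifferentiableOn ℂ f Ω)
    (hd : ∀ z ∈ Ω, ∀ v, fderiv ℂ f z v = 0 → v = 0) :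
    IsOpen (f '' Ω) ∧ ∃ g : E → E, DifferentiableOn ℂ g (f '' Ω) ∧ (∀ z ∈ Ω, g (f z) = z) ∧
      ∀ z ∈ Ω, ∀ v, fderiv ℂ g (f z) (fderiv ℂ f z v) = v := by
  have : CompleteSpace E := FiniteDimensional.complete ℂ E
  have : Nonempty E := ⟨0⟩
  have hstrict : ∀ z ∈ Ω, HasStrictFDerivAt f (fderiv ℂ f z) z := fun z hz =>
    ((hf.contDiffOn_complex hΩ).contDiffAt (hΩ.mem_nhds hz)).hasStrictFDerivAt (by simp)
  have hequiv : ∀ z ∈ Ω, ∃ e : E ≃L[ℂ] E, (e : E →L[ℂ] E) = fderiv ℂ f z := by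
    intro z hz
    refine ⟨(LinearEquiv.ofInjectiveEndo (fderiv ℂ f z : E →ₗ[ℂ] E)
      ((injective_iff_map_eq_zero _).2 (hd z hz))).toContinuousLinearEquiv, ?_⟩
    ext v
    rfl
  have hnhds : ∀ z ∈ Ω, map f (𝓝 z) = 𝓝 (f z) := by
    intro z hz
    obtain ⟨e, he⟩ := hequiv z hz
    exact HasStrictFDerivAt.map_nhds_eq_of_equiv (f' := e) (by rw [he]; exact hstrict z hz)
  have hopen : ∀ z ∈ Ω, ∀ O ∈ 𝓝 z, f '' O ∈ 𝓝 (f z) := fun z hz O hO => by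
    rw [← hnhds z hz]; exact image_mem_map hO
  have hleft : ∀ z ∈ Ω, Function.invFunOn f Ω (f z) = z := fun z hz =>
    hinj.leftInvOn_invFunOn hz
  have key : ∀ z ∈ Ω, ∀ e : E ≃L[ℂ] E, (e : E →L[ℂ] E) = fderiv ℂ f z →
      HasFDerivAt (Function.invFunOn f Ω) (e.symm : E →L[ℂ] E) (f z) := by
    intro z hz e he
    refine HasFDerivAt.of_local_left_inverse (f := f) ?_ ?_ ?_
    · rw [ContinuousAt, hleft z hz]
      intro O hO
      refine mem_map.2 (mem_of_superset (hopen z hz _ (inter_mem hO (hΩ.mem_nhds hz))) ?_)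
      rintro _ ⟨y, ⟨hyO, hyΩ⟩, rfl⟩
      rw [mem_preimage, hleft y hyΩ]
      exact hyO
    · rw [hleft z hz, he]
      exact (hstrict z hz).hasFDerivAt
    · filter_upwards [hopen z hz Ω (hΩ.mem_nhds hz)]
      rintro _ ⟨y, hy, rfl⟩
      rw [hleft y hy]
  refine ⟨isOpen_iff_mem_nhds.2 ?_, Function.invFunOn f Ω, ?_, hleft, ?_⟩
  · rintro _ ⟨z, hz, rfl⟩
    exact hopen z hz Ω (hΩ.mem_nhds hz)
  · rintro _ ⟨z, hz, rfl⟩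
    obtain ⟨e, he⟩ := hequiv z hz
    exact (key z hz e he).differentiableAt.differentiableWithinAt
  · intro z hz v
    obtain ⟨e, he⟩ := hequiv z hz
    rw [(key z hz e he).fderiv, ← he]
    simp

end Injectivity

/-! ### Reflection, and holomorphic extension of real-analytic functions. -/

section RealStructure

open Metric Set Filter Topology ComplexConjugate

/-- Schwarz reflection along a complex line. -/
theorem eq_conj_of_real_on_line {O : Set ℂ} (hO : IsOpen O) (hc : Convex ℝ O)
    (hconj : ∀ w ∈ O, conj w ∈ O) (hI : Complex.I ∈ O) {g : ℂ → ℂ} (hg : DifferentiableOn ℂ g O)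
    (hreal : ∀ x : ℝ, (x : ℂ) ∈ O → (g x).im = 0) : g (-Complex.I) = conj (g Complex.I) := by
  -- 0 is the midpoint of ±i, so real points accumulate inside `O`. There `g` and its reflection
  -- agree, and the identity theorem applies.
  have h0 : (0 : ℂ) ∈ O := by
    have := hc hI (hconj _ hI) (a := 1 / 2) (b := 1 / 2) (by norm_num) (by norm_num) (by norm_num)
    simpa using this
  have hg' : DifferentiableOn ℂ (fun w => conj (g (conj w))) O := by
    intro w hw
    have := (hg.differentiableAt (hO.mem_nhds (hconj w hw)))
    have h2 := this.conj_conj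
    rw [Complex.conj_conj] at h2
    exact h2.differentiableWithinAt
  have hEq := (hg.analyticOnNhd hO).eqOn_of_preconnected_of_frequently_eq
    (hg'.analyticOnNhd hO) hc.isPreconnected h0 ?_
  · have := hEq (hconj _ hI)
    simpa using this
  · have hT : Tendsto (fun x : ℝ => (x : ℂ)) (𝓝[≠] 0) (𝓝[≠] 0) := by
      refine tendsto_nhdsWithin_iff.2 ⟨?_, ?_⟩
      · exact (Complex.continuous_ofReal.tendsto' 0 0 (by simp)).mono_left nhdsWithin_le_nhds
      · filter_upwards [self_mem_nhdsWithin] with x hx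
        simpa using hx
    refine hT.frequently (Eventually.frequently ?_)
    filter_upwards [(hT.mono_right nhdsWithin_le_nhds).eventually (hO.mem_nhds h0)] with x hx
    rw [Complex.conj_ofReal, Complex.conj_eq_iff_im.2 (hreal x hx)]

/-- Local holomorphic extension of a real-analytic function of one variable. -/
theorem AnalyticAt.exists_ball_extension {f : ℝ → ℝ} {x : ℝ} (hf : AnalyticAt ℝ f x) :
    ∃ r > 0, ∃ F : ℂ → ℂ, DifferentiableOn ℂ F (ball (x : ℂ) r) ∧
      ∀ y : ℝ, (y : ℂ) ∈ ball (x : ℂ) r → F y = f y := by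
  obtain ⟨p, R, hp⟩ := hf
  -- The same Taylor coefficients read as complex numbers have the same norms, so the radius of
  -- convergence is unchanged.
  set q : FormalMultilinearSeries ℂ ℂ ℂ :=
    FormalMultilinearSeries.ofScalars ℂ (fun n => (p.coeff n : ℂ))
  have hnorm : ∀ n, ‖q n‖ = ‖p n‖ := fun n => by
    rw [FormalMultilinearSeries.ofScalars_norm, FormalMultilinearSeries.norm_apply_eq_norm_coef]
    simp
  have hrad : R ≤ q.radius := by
    refine hp.r_le.trans (le_of_eq ?_)
    simp only [FormalMultilinearSeries.radius, hnorm]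
  have hRpos := hp.r_pos
  obtain ⟨r, hr0, hrR⟩ := ENNReal.lt_iff_exists_nnreal_btwn.1 hRpos
  have hq := (q.hasFPowerSeriesOnBall (hRpos.trans_le hrad)).comp_sub (x : ℂ)
  rw [zero_add] at hq
  refine ⟨r, by exact_mod_cast hr0, fun z => q.sum (z - x), ?_, fun y hy => ?_⟩
  · refine hq.differentiableOn.mono ?_
    rw [← Metric.eball_coe]
    exact Metric.eball_subset_eball (hrR.le.trans hrad)
  · have hy' : y - x ∈ Metric.eball (0 : ℝ) R := by
      refine Metric.eball_subset_eball hrR.le ?_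
      rw [Metric.eball_coe]
      rw [mem_ball, Complex.dist_eq, ← Complex.ofReal_sub, Complex.norm_real] at hy
      simpa using hy
    have h1 := hp.hasSum hy'
    rw [add_sub_cancel] at h1
    have h2 := Complex.hasSum_ofReal.2 h1
    have h3 : q.sum ((y : ℂ) - x) = ∑' n, (((p n) fun _ => y - x : ℝ) : ℂ) := by
      simp only [FormalMultilinearSeries.sum]
      refine tsum_congr fun n => ?_
      simp only [q, FormalMultilinearSeries.apply_eq_prod_smul_coeff]
      simp [mul_comm]
    exact h3.trans h2.tsum_eq

/-- A real-analytic function on an open set of the line extends holomorphically to an open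
neighbourhood in the complex plane. -/
theorem AnalyticOnNhd.exists_holomorphic_extension {f : ℝ → ℝ} {I : Set ℝ} (hI : IsOpen I)
    (hf : AnalyticOnNhd ℝ f I) :
    ∃ (U : Set ℂ) (F : ℂ → ℂ), IsOpen U ∧ DifferentiableOn ℂ F U ∧ (∀ x : ℝ, x ∈ I ↔ (x : ℂ) ∈ U) ∧
      ∀ x ∈ I, F x = f x := by
  have hloc : ∀ x : I, ∃ r > 0, ∃ F : ℂ → ℂ, DifferentiableOn ℂ F (ball ((x : ℝ) : ℂ) r) ∧
      ∀ y : ℝ, (y : ℂ) ∈ ball ((x : ℝ) : ℂ) r → y ∈ I ∧ F y = f y := by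
    intro x
    obtain ⟨r, hr, F, hF, hFf⟩ := (hf x x.2).exists_ball_extension
    obtain ⟨r', hr', hI'⟩ := Metric.isOpen_iff.1 hI x x.2
    refine ⟨min r r', lt_min hr hr', F, hF.mono (ball_subset_ball (min_le_left _ _)),
      fun y hy => ⟨hI' ?_, hFf y (ball_subset_ball (min_le_left _ _) hy)⟩⟩
    have := ball_subset_ball (min_le_right _ _) hy
    rwa [mem_ball, Complex.dist_eq, ← Complex.ofReal_sub, Complex.norm_real] at this
  choose r hr F hF hFf using hloc
  -- Discs centred on the real axis contain the real part of each of their points. A nonempty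
  -- overlap is therefore convex and meets the axis, where both extensions equal `f`.
  have hcons : ∀ x y : I, EqOn (F x) (F y) (ball ((x : ℝ) : ℂ) (r x) ∩ ball ((y : ℝ) : ℂ) (r y)) := by
    intro x y z hz
    set O := ball ((x : ℝ) : ℂ) (r x) ∩ ball ((y : ℝ) : ℂ) (r y)
    have hO : IsOpen O := isOpen_ball.inter isOpen_ball
    have hre : ∀ (u : ℝ) (ρ : ℝ), z ∈ ball (u : ℂ) ρ → (z.re : ℂ) ∈ ball (u : ℂ) ρ := by
      intro u ρ h
      rw [mem_ball, Complex.dist_eq] at h ⊢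
      refine lt_of_le_of_lt ?_ h
      rw [← Complex.ofReal_sub, Complex.norm_real]
      simpa using Complex.abs_re_le_norm (z - u)
    have hmem : (z.re : ℂ) ∈ O := ⟨hre _ _ hz.1, hre _ _ hz.2⟩
    refine (((hF x).mono inter_subset_left).analyticOnNhd hO).eqOn_of_preconnected_of_frequently_eq
      (((hF y).mono inter_subset_right).analyticOnNhd hO)
      ((convex_ball _ _).inter (convex_ball _ _)).isPreconnected hmem ?_ hz
    have hT : Tendsto (fun t : ℝ => (t : ℂ)) (𝓝[≠] z.re) (𝓝[≠] (z.re : ℂ)) := by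
      refine tendsto_nhdsWithin_iff.2 ⟨?_, ?_⟩
      · exact Complex.continuous_ofReal.continuousAt.tendsto.mono_left nhdsWithin_le_nhds
      · filter_upwards [self_mem_nhdsWithin] with t ht
        simpa using ht
    refine hT.frequently (Eventually.frequently ?_)
    have : ∀ᶠ t : ℝ in 𝓝[≠] z.re, (t : ℂ) ∈ O :=
      (hT.mono_right nhdsWithin_le_nhds).eventually (hO.mem_nhds hmem)
    filter_upwards [this] with t ht
    rw [(hFf x t ht.1).2, (hFf y t ht.2).2]
  classical
  refine ⟨⋃ x : I, ball ((x : ℝ) : ℂ) (r x),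
    fun z => if h : ∃ x : I, z ∈ ball ((x : ℝ) : ℂ) (r x) then F h.choose z else 0,
    isOpen_iUnion fun _ => isOpen_ball, ?_, ?_, ?_⟩
  · intro z hz
    obtain ⟨x, hx⟩ := mem_iUnion.1 hz
    refine (((hF x).differentiableAt (isOpen_ball.mem_nhds hx)).congr_of_eventuallyEq
      ?_).differentiableWithinAt
    filter_upwards [isOpen_ball.mem_nhds hx] with w hw
    have h : ∃ x : I, w ∈ ball ((x : ℝ) : ℂ) (r x) := ⟨x, hw⟩
    rw [dif_pos h]
    exact hcons _ _ ⟨h.choose_spec, hw⟩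
  · refine fun x => ⟨fun hx => mem_iUnion.2 ⟨⟨x, hx⟩, mem_ball_self (hr _)⟩, fun hx => ?_⟩
    obtain ⟨y, hy⟩ := mem_iUnion.1 hx
    exact (hFf y x hy).1
  · intro x hx
    have h : ∃ y : I, (x : ℂ) ∈ ball ((y : ℝ) : ℂ) (r y) := ⟨⟨x, hx⟩, mem_ball_self (hr _)⟩
    simp only [dif_pos h]
    exact (hFf _ x h.choose_spec).2

end RealStructure

/-! ### Families of closed orbits: time, abbreviated action and their differentials. -/

section OrbitFamilies

open Metric Set Filter Topology ComplexConjugate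

/-- This is d ∘ d = 0 in coordinates; it produces the two-form identity and the closedness of T dE -
Σ dG, and makes the Hessian symmetric. -/
theorem DifferentiableOn.fderiv_fderiv_symm {E : Type*} [NormedAddCommGroup E] [NormedSpace ℂ E]
    [FiniteDimensional ℂ E] {f : E → ℂ} {Ω : Set E} (hf : DifferentiableOn ℂ f Ω) (hΩ : IsOpen Ω)
    {z : E} (hz : z ∈ Ω) (a b : E) :
    fderiv ℂ (fun y => fderiv ℂ f y b) z a = fderiv ℂ (fun y => fderiv ℂ f y a) z b := by
  have hc : ContDiffAt ℂ ∞ f z := (hf.contDiffOn_complex hΩ).contDiffAt (hΩ.mem_nhds hz)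
  have hsym : IsSymmSndFDerivAt ℂ f z := hc.isSymmSndFDerivAt (by simp; exact WithTop.coe_le_coe.2 le_top)
  have hd : DifferentiableAt ℂ (fderiv ℂ f) z :=
    (hc.fderiv_right (m := 1) (by norm_cast)).differentiableAt (by simp)
  have key : ∀ a b, fderiv ℂ (fun y => fderiv ℂ f y b) z a = fderiv ℂ (fderiv ℂ f) z a b := by
    intro a b
    rw [fderiv_clm_apply hd (differentiableAt_const b)]
    simp
  rw [key, key]
  exact hsym a b

/-- The complex strip of angles `|Im s| < ε` times the ball of parameters of radius `ε`. -/
def strip (ε : ℝ) (p₀ : ℂ × ℂ) : Set (ℂ × ℂ × ℂ) := {z | |z.1.im| < ε ∧ z.2 ∈ ball p₀ ε}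

theorem isOpen_strip (ε : ℝ) (p₀ : ℂ × ℂ) : IsOpen (strip ε p₀) :=
  (isOpen_lt (f := fun z : ℂ × ℂ × ℂ => |z.1.im|) (by fun_prop) continuous_const).inter
    (isOpen_ball.preimage continuous_snd)

theorem strip_mono {ε ε' : ℝ} (h : ε' ≤ ε) (p₀ : ℂ × ℂ) : strip ε' p₀ ⊆ strip ε p₀ :=
  fun _ hz => ⟨hz.1.trans_le h, ball_subset_ball h hz.2⟩

theorem starSlices_strip (ε : ℝ) (p₀ : ℂ × ℂ) : StarSlices 0 (strip ε p₀) := by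
  intro z hz τ hτ
  refine ⟨?_, hz.2⟩
  have : ((0 : ℂ) + τ * (z.1 - 0)).im = τ * z.1.im := by simp
  rw [this, abs_mul, abs_of_nonneg hτ.1]
  exact (mul_le_of_le_one_left (abs_nonneg _) hτ.2).trans_lt hz.1

theorem add_two_pi_mem_strip {ε : ℝ} {p₀ : ℂ × ℂ} {s : ℂ} {p : ℂ × ℂ}
    (h : (s, p) ∈ strip ε p₀) : (s + 2 * Real.pi, p) ∈ strip ε p₀ := by
  refine ⟨?_, h.2⟩
  have : (s + 2 * Real.pi : ℂ).im = s.im := by simp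
  rw [this]; exact h.1

theorem convex_strip_slice (ε : ℝ) : Convex ℝ {s : ℂ | |s.im| < ε} := by
  have : {s : ℂ | |s.im| < ε} = Complex.imCLM ⁻¹' (ball 0 ε) := by
    ext s; simp
  rw [this]
  exact (convex_ball _ _).linear_preimage Complex.imCLM.toLinearMap

theorem ofReal_mem_strip {ε : ℝ} {p₀ : ℂ × ℂ} (s : ℝ) {p : ℂ × ℂ} (hp : p ∈ ball p₀ ε) :
    ((s : ℂ), p) ∈ strip ε p₀ :=
  ⟨by simpa using pos_of_mem_ball hp, hp⟩

/-- Holomorphic functions on a strip with the same derivative in `s` and the same values at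
`s = 0` coincide. -/
theorem eq_of_fderiv_fst_eq {ε : ℝ} {p₀ : ℂ × ℂ} {f g : ℂ × ℂ × ℂ → ℂ}
    (hf : DifferentiableOn ℂ f (strip ε p₀)) (hg : DifferentiableOn ℂ g (strip ε p₀))
    (h : ∀ z ∈ strip ε p₀, fderiv ℂ f z (1, 0) = fderiv ℂ g z (1, 0))
    (h0 : ∀ p ∈ ball p₀ ε, f (0, p) = g (0, p)) {z : ℂ × ℂ × ℂ} (hz : z ∈ strip ε p₀) :
    f z = g z := by
  obtain ⟨s, p⟩ := z
  have hopen := isOpen_strip ε p₀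
  have hd : ∀ s ∈ {s : ℂ | |s.im| < ε}, HasDerivAt (fun s => f (s, p) - g (s, p)) 0 s := by
    intro s hs
    have hm : (s, p) ∈ strip ε p₀ := ⟨hs, hz.2⟩
    have := (hasDerivAt_slice hopen hf hm).sub (hasDerivAt_slice hopen hg hm)
    rwa [h _ hm, sub_self] at this
  have hε : 0 < ε := pos_of_mem_ball hz.2
  have hs0 : (0 : ℂ) ∈ {s : ℂ | |s.im| < ε} := by simpa using hε
  have hOpen : IsOpen {s : ℂ | |s.im| < ε} := isOpen_lt (by fun_prop) continuous_const
  have := hOpen.is_const_of_deriv_eq_zero (convex_strip_slice ε).isPreconnected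
    (fun s hs => (hd s hs).differentiableAt.differentiableWithinAt)
    (fun s hs => (hd s hs).deriv) hs0 (show s ∈ {s : ℂ | |s.im| < ε} from hz.1)
  simp only [h0 p hz.2, sub_self] at this
  exact (sub_eq_zero.1 this.symm)

/-- A holomorphic family of closed orbits of `y²/2 + G² u(x) + w(x) = E` near `(E₀, G₀)`,
parametrized by an angle `s` for which `dx/ds = κ y`, `dy/ds = - κ (G² u' + w')`. -/
structure OrbitFamily (U : Set ℂ) (u w : ℂ → ℂ) (E₀ G₀ : ℝ) where
  ε : ℝ
  X : ℂ × ℂ × ℂ → ℂ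
  R : ℂ × ℂ × ℂ → ℂ
  κ : ℂ × ℂ × ℂ → ℂ
  ε_pos : 0 < ε
  diff_X : DifferentiableOn ℂ X (strip ε (E₀, G₀))
  diff_R : DifferentiableOn ℂ R (strip ε (E₀, G₀))
  diff_κ : DifferentiableOn ℂ κ (strip ε (E₀, G₀))
  real_X : ∀ s E G : ℝ, ((E : ℂ), (G : ℂ)) ∈ ball ((E₀ : ℂ), (G₀ : ℂ)) ε → (X (s, E, G)).im = 0
  real_R : ∀ s E G : ℝ, ((E : ℂ), (G : ℂ)) ∈ ball ((E₀ : ℂ), (G₀ : ℂ)) ε → (R (s, E, G)).im = 0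
  real_κ : ∀ s E G : ℝ, ((E : ℂ), (G : ℂ)) ∈ ball ((E₀ : ℂ), (G₀ : ℂ)) ε → (κ (s, E, G)).im = 0
  pos_κ : ∀ s E G : ℝ, ((E : ℂ), (G : ℂ)) ∈ ball ((E₀ : ℂ), (G₀ : ℂ)) ε → 0 < (κ (s, E, G)).re
  neg_R : ∀ s E G : ℝ, ((E : ℂ), (G : ℂ)) ∈ ball ((E₀ : ℂ), (G₀ : ℂ)) ε → s ∈ Ioo 0 Real.pi →
    (R (s, E, G)).re < 0
  mem_X : ∀ z ∈ strip ε (E₀, G₀), X z ∈ U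
  energy : ∀ z ∈ strip ε (E₀, G₀), R z ^ 2 / 2 + z.2.2 ^ 2 * u (X z) + w (X z) = z.2.1
  fderiv_X : ∀ z ∈ strip ε (E₀, G₀), fderiv ℂ X z (1, 0) = κ z * R z
  fderiv_R : ∀ z ∈ strip ε (E₀, G₀),
    fderiv ℂ R z (1, 0) = -(κ z * (z.2.2 ^ 2 * deriv u (X z) + deriv w (X z)))
  periodic_X : ∀ s p, X (s + 2 * Real.pi, p) = X (s, p)
  periodic_R : ∀ s p, R (s + 2 * Real.pi, p) = R (s, p)
  periodic_κ : ∀ s p, κ (s + 2 * Real.pi, p) = κ (s, p)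
  even_X : ∀ s p, X (-s, p) = X (s, p)
  odd_R : ∀ s p, R (-s, p) = -R (s, p)
  even_κ : ∀ s p, κ (-s, p) = κ (s, p)
  injective : ∀ s s' p, (s, p) ∈ strip ε (E₀, G₀) → (s', p) ∈ strip ε (E₀, G₀) →
    X (s, p) = X (s', p) → R (s, p) = R (s', p) → ∃ k : ℤ, s = s' + 2 * Real.pi * k

namespace OrbitFamily

variable {U : Set ℂ} {u w : ℂ → ℂ} {E₀ G₀ : ℝ} (O : OrbitFamily U u w E₀ G₀)

/-- The domain of an orbit family. -/
def dom : Set (ℂ × ℂ × ℂ) := strip O.ε (E₀, G₀)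

theorem isOpen_dom : IsOpen O.dom := isOpen_strip _ _

theorem starSlices_dom : StarSlices 0 O.dom := starSlices_strip _ _

/-- The time along the orbits, measured from `s = 0`. -/
def time : ℂ × ℂ × ℂ → ℂ := primitiveFst 0 O.κ

/-- The derivative of `G` times the potential, integrated along the orbits. -/
def shift : ℂ × ℂ × ℂ → ℂ := primitiveFst 0 fun z => O.κ z * (2 * z.2.2 * u (O.X z))

/-- The abbreviated action `∫ y dx` along the orbits. -/
def action : ℂ × ℂ × ℂ → ℂ := primitiveFst 0 fun z => O.κ z * O.R z ^ 2

section

variable (hU : IsOpen U) (hu : DifferentiableOn ℂ u U) (hw : DifferentiableOn ℂ w U)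

include hu in
theorem diff_shiftIntegrand :
    DifferentiableOn ℂ (fun z : ℂ × ℂ × ℂ => O.κ z * (2 * z.2.2 * u (O.X z))) O.dom :=
  O.diff_κ.mul (DifferentiableOn.mul (by fun_prop) (hu.comp O.diff_X O.mem_X))

theorem diff_actionIntegrand :
    DifferentiableOn ℂ (fun z : ℂ × ℂ × ℂ => O.κ z * O.R z ^ 2) O.dom :=
  O.diff_κ.mul (O.diff_R.pow 2)

theorem diff_time : DifferentiableOn ℂ O.time O.dom :=
  differentiableOn_primitiveFst O.isOpen_dom O.starSlices_dom O.diff_κ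

include hu in
theorem diff_shift : DifferentiableOn ℂ O.shift O.dom :=
  differentiableOn_primitiveFst O.isOpen_dom O.starSlices_dom (O.diff_shiftIntegrand hu)

theorem diff_action : DifferentiableOn ℂ O.action O.dom :=
  differentiableOn_primitiveFst O.isOpen_dom O.starSlices_dom O.diff_actionIntegrand

theorem fderiv_time {z : ℂ × ℂ × ℂ} (hz : z ∈ O.dom) : fderiv ℂ O.time z (1, 0) = O.κ z :=
  fderiv_primitiveFst O.isOpen_dom O.starSlices_dom O.diff_κ hz

include hu in
theorem fderiv_shift {z : ℂ × ℂ × ℂ} (hz : z ∈ O.dom) :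
    fderiv ℂ O.shift z (1, 0) = O.κ z * (2 * z.2.2 * u (O.X z)) :=
  fderiv_primitiveFst O.isOpen_dom O.starSlices_dom (O.diff_shiftIntegrand hu) hz

theorem fderiv_action_fst {z : ℂ × ℂ × ℂ} (hz : z ∈ O.dom) :
    fderiv ℂ O.action z (1, 0) = O.κ z * O.R z ^ 2 :=
  fderiv_primitiveFst O.isOpen_dom O.starSlices_dom O.diff_actionIntegrand hz

theorem R_zero (p : ℂ × ℂ) : O.R (0, p) = 0 := by
  have := O.odd_R 0 p
  rw [neg_zero] at this
  linear_combination this / 2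

theorem R_two_pi (p : ℂ × ℂ) : O.R (2 * Real.pi, p) = 0 := by
  have := O.periodic_R 0 p
  rwa [zero_add, R_zero] at this

theorem R_pi (p : ℂ × ℂ) : O.R (Real.pi, p) = 0 := by
  have h1 := O.periodic_R (-Real.pi) p
  rw [O.odd_R, show (-Real.pi + 2 * Real.pi : ℂ) = Real.pi by ring] at h1
  linear_combination h1 / 2

include hU hu hw in
/-- The derivative of the energy relation. -/
theorem fderiv_energy {z : ℂ × ℂ × ℂ} (hz : z ∈ O.dom) (v : ℂ × ℂ × ℂ) :
    O.R z * fderiv ℂ O.R z v +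
      (z.2.2 ^ 2 * deriv u (O.X z) + deriv w (O.X z)) * fderiv ℂ O.X z v
      + 2 * z.2.2 * u (O.X z) * v.2.2 = v.2.1 := by
  have hn := O.isOpen_dom.mem_nhds hz
  have hX := (O.diff_X.differentiableAt hn).hasFDerivAt
  have hR := (O.diff_R.differentiableAt hn).hasFDerivAt
  have hXU := O.mem_X z hz
  have hu' := (hu.differentiableAt (hU.mem_nhds hXU)).hasDerivAt.comp_hasFDerivAt z hX
  have hw' := (hw.differentiableAt (hU.mem_nhds hXU)).hasDerivAt.comp_hasFDerivAt z hX
  have hG : HasFDerivAt (fun z : ℂ × ℂ × ℂ => z.2.2)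
    ((ContinuousLinearMap.snd ℂ ℂ ℂ).comp (ContinuousLinearMap.snd ℂ ℂ (ℂ × ℂ))) z :=
    ((ContinuousLinearMap.snd ℂ ℂ ℂ).comp (ContinuousLinearMap.snd ℂ ℂ (ℂ × ℂ))).hasFDerivAt
  have hE : HasFDerivAt (fun z : ℂ × ℂ × ℂ => z.2.1)
    ((ContinuousLinearMap.fst ℂ ℂ ℂ).comp (ContinuousLinearMap.snd ℂ ℂ (ℂ × ℂ))) z :=
    ((ContinuousLinearMap.fst ℂ ℂ ℂ).comp (ContinuousLinearMap.snd ℂ ℂ (ℂ × ℂ))).hasFDerivAt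
  have h1 := (((hR.pow 2).mul_const (2⁻¹ : ℂ)).add ((hG.pow 2).mul hu')).add hw'
  have h2 : HasFDerivAt (fun z : ℂ × ℂ × ℂ => z.2.1) _ z := h1.congr_of_eventuallyEq (by
    filter_upwards [hn] with y hy
    have := O.energy y hy
    simp only [Pi.add_apply, Pi.mul_apply, Function.comp]
    rw [← this]; ring)
  have := DFunLike.congr_fun (h2.unique hE) v
  simp at this
  linear_combination this

include hU hu hw in
/-- The differential of the abbreviated action is `y dx + t dE - S dG`. -/
theorem fderiv_action {z : ℂ × ℂ × ℂ} (hz : z ∈ O.dom) (v : ℂ × ℂ × ℂ) :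
    fderiv ℂ O.action z v =
      O.R z * fderiv ℂ O.X z v + O.time z * v.2.1 - O.shift z * v.2.2 := by
  -- The direction of s follows from the definition of the action and dX/ds = κR; only parameter
  -- directions need an argument.
  suffices h : ∀ v₂ : ℂ × ℂ, fderiv ℂ O.action z (0, v₂) =
      O.R z * fderiv ℂ O.X z (0, v₂) + O.time z * v₂.1 - O.shift z * v₂.2 by
    obtain ⟨a, v₂⟩ := v
    have hv : ((a, v₂) : ℂ × ℂ × ℂ) = a • (1, 0) + (0, v₂) := by simp
    rw [hv, map_add, map_add, map_smul, map_smul, h, O.fderiv_action_fst hz, O.fderiv_X z hz]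
    simp
    ring
  intro v₂
  have hopen := O.isOpen_dom
  have hdA := O.diff_action.fderiv_apply_complex hopen (0, v₂)
  have hdX := O.diff_X.fderiv_apply_complex hopen (0, v₂)
  -- Both sides are compared as functions of s. Once mixed derivatives are exchanged, their
  -- s-derivatives differ by κ times the differentiated energy relation.
  refine eq_of_fderiv_fst_eq (f := fun z => fderiv ℂ O.action z (0, v₂))
    (g := fun z => O.R z * fderiv ℂ O.X z (0, v₂) + O.time z * v₂.1 - O.shift z * v₂.2)
    hdA ?_ ?_ ?_ hz
  · exact ((O.diff_R.mul hdX).add (O.diff_time.mul_const _)).sub ((O.diff_shift hu).mul_const _)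
  · intro z hz
    have hn := hopen.mem_nhds hz
    have hat : ∀ {f : ℂ × ℂ × ℂ → ℂ}, DifferentiableOn ℂ f O.dom → HasFDerivAt f (fderiv ℂ f z) z :=
      fun hf => (hf.differentiableAt hn).hasFDerivAt
    rw [O.diff_action.fderiv_fderiv_symm O.isOpen_dom hz]
    have h1 : HasFDerivAt (fun y => fderiv ℂ O.action y (1, 0)) _ z :=
      ((hat O.diff_R).mul (hat (O.diff_X.fderiv_apply_complex hopen (1, 0)))).congr_of_eventuallyEq
        (by
          filter_upwards [hn] with y hy
          rw [O.fderiv_action_fst hy, Pi.mul_apply, O.fderiv_X y hy]; ring)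
    have h2 := (((hat O.diff_R).mul (hat hdX)).add ((hat O.diff_time).mul_const v₂.1)).sub
      ((hat (O.diff_shift hu)).mul_const v₂.2)
    rw [h1.fderiv]
    refine Eq.trans ?_ (DFunLike.congr_fun h2.fderiv _).symm
    have hE := O.fderiv_energy hU hu hw hz (0, v₂)
    simp only [add_apply, sub_apply, smul_apply, smul_eq_mul, O.fderiv_R z hz, O.fderiv_time hz,
      O.fderiv_shift hu hz, O.fderiv_X z hz]
    rw [O.diff_X.fderiv_fderiv_symm O.isOpen_dom hz (1, 0) (0, v₂)]
    simp only at hE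
    linear_combination O.κ z * hE
  -- At s = 0 the action vanishes for every parameter, hence so do its parameter derivatives; on the
  -- right R, the time and the shift are zero.
  · intro p hp
    have h00 : ((0 : ℂ), p) ∈ O.dom := ofReal_mem_strip 0 hp
    have h1 : fderiv ℂ O.action (0, p) (0, v₂) = 0 := by
      have hd := (O.diff_action.differentiableAt (hopen.mem_nhds h00)).hasFDerivAt
      have hline : HasDerivAt (fun t : ℂ => ((0 : ℂ), p + t • v₂)) ((0 : ℂ), v₂) 0 := by
        refine (hasDerivAt_const _ _).prodMk ?_
        simpa using ((hasDerivAt_id (0 : ℂ)).smul_const v₂).const_add p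
      have hc := hd.comp_hasDerivAt_of_eq (0 : ℂ) hline (by simp)
      have hz : (O.action ∘ fun t : ℂ => ((0 : ℂ), p + t • v₂)) = fun _ => 0 := by
        funext t; simp [action]
      rw [hz] at hc
      exact hc.unique (hasDerivAt_const _ _)
    simp [h1, O.R_zero, time, shift]

include hU hu hw in
/-- In the coordinates `(s, E, G)` the form `dx ∧ dy` is `dt ∧ dE - dS ∧ dG`. -/
theorem twoForm {z : ℂ × ℂ × ℂ} (hz : z ∈ O.dom) (a b : ℂ × ℂ × ℂ) :
    fderiv ℂ O.X z a * fderiv ℂ O.R z b - fderiv ℂ O.X z b * fderiv ℂ O.R z a =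
      (fderiv ℂ O.time z a * b.2.1 - fderiv ℂ O.time z b * a.2.1) -
      (fderiv ℂ O.shift z a * b.2.2 - fderiv ℂ O.shift z b * a.2.2) := by
  have hopen := O.isOpen_dom
  have hn := hopen.mem_nhds hz
  have hat : ∀ {f : ℂ × ℂ × ℂ → ℂ}, DifferentiableOn ℂ f O.dom → HasFDerivAt f (fderiv ℂ f z) z :=
    fun hf => (hf.differentiableAt hn).hasFDerivAt
  have key : ∀ a b : ℂ × ℂ × ℂ, fderiv ℂ (fun y => fderiv ℂ O.action y b) z a =
      O.R z * fderiv ℂ (fun y => fderiv ℂ O.X y b) z a + fderiv ℂ O.X z b * fderiv ℂ O.R z a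
        + fderiv ℂ O.time z a * b.2.1 - fderiv ℂ O.shift z a * b.2.2 := by
    intro a b
    have h1 : HasFDerivAt (fun y => fderiv ℂ O.action y b) _ z :=
      ((((hat O.diff_R).mul (hat (O.diff_X.fderiv_apply_complex hopen b))).add
        ((hat O.diff_time).mul_const b.2.1)).sub
        ((hat (O.diff_shift hu)).mul_const b.2.2)).congr_of_eventuallyEq (by
          filter_upwards [hn] with y hy
          exact O.fderiv_action hU hu hw hy b)
    rw [h1.fderiv]
    simp
    ring
  -- Antisymmetrizing the derivative of y dx + t dE - S dG must give zero, which is the claimed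
  -- relation.
  have h := O.diff_action.fderiv_fderiv_symm O.isOpen_dom hz a b
  rw [key, key, O.diff_X.fderiv_fderiv_symm O.isOpen_dom hz a b] at h
  linear_combination -h

theorem ofReal_mem_dom (s : ℝ) {p : ℂ × ℂ} (hp : p ∈ ball ((E₀ : ℂ), (G₀ : ℂ)) O.ε) :
    ((s : ℂ), p) ∈ O.dom := ofReal_mem_strip s hp

theorem two_pi_mem_dom {p : ℂ × ℂ} (hp : p ∈ ball ((E₀ : ℂ), (G₀ : ℂ)) O.ε) :
    ((2 * Real.pi : ℂ), p) ∈ O.dom := by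
  simpa using O.ofReal_mem_dom (2 * Real.pi) hp

/-- The period of the orbits. -/
def period (p : ℂ × ℂ) : ℂ := O.time (2 * Real.pi, p)

/-- The increment of `shift` over one period. -/
def totalShift (p : ℂ × ℂ) : ℂ := O.shift (2 * Real.pi, p)

/-- The action variable. -/
def actionVar (p : ℂ × ℂ) : ℂ := O.action (2 * Real.pi, p) / (2 * Real.pi)

end

end OrbitFamily

/-- By periodicity of `g` the two sides have the same derivative in s, and they agree at s = 0. Time
and shift thus grow by a fixed amount per turn. -/
theorem primitiveFst_add_two_pi {ε : ℝ} {p₀ : ℂ × ℂ} {g : ℂ × ℂ × ℂ → ℂ}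
    (hg : DifferentiableOn ℂ g (strip ε p₀)) (hper : ∀ s p, g (s + 2 * Real.pi, p) = g (s, p))
    {s : ℂ} {p : ℂ × ℂ} (hz : (s, p) ∈ strip ε p₀) :
    primitiveFst 0 g (s + 2 * Real.pi, p) =
      primitiveFst 0 g (s, p) + primitiveFst 0 g (2 * Real.pi, p) := by
  have hopen := isOpen_strip ε p₀
  have hP := differentiableOn_primitiveFst hopen (starSlices_strip ε p₀) hg
  have h2π : ∀ p ∈ ball p₀ ε, ((2 * Real.pi : ℂ), p) ∈ strip ε p₀ := fun p hp => by
    simpa using ofReal_mem_strip (2 * Real.pi) hp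
  have hf : DifferentiableOn ℂ (fun z : ℂ × ℂ × ℂ => primitiveFst 0 g (z.1 + 2 * Real.pi, z.2))
      (strip ε p₀) :=
    hP.comp (f := fun z : ℂ × ℂ × ℂ => (z.1 + 2 * Real.pi, z.2)) (by fun_prop)
      fun z hz => add_two_pi_mem_strip hz
  have hq : DifferentiableOn ℂ (fun z : ℂ × ℂ × ℂ => primitiveFst 0 g (2 * Real.pi, z.2))
      (strip ε p₀) :=
    hP.comp (f := fun z : ℂ × ℂ × ℂ => ((2 * Real.pi : ℂ), z.2)) (by fun_prop)
      fun z hz => h2π _ hz.2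
  refine eq_of_fderiv_fst_eq
    (f := fun z : ℂ × ℂ × ℂ => primitiveFst 0 g (z.1 + 2 * Real.pi, z.2))
    (g := fun z : ℂ × ℂ × ℂ => primitiveFst 0 g z + primitiveFst 0 g (2 * Real.pi, z.2))
    hf (hP.add hq) ?_ ?_ hz
  · rintro ⟨s, p⟩ hz
    have hz' := add_two_pi_mem_strip hz
    have h1 := hasDerivAt_slice hopen hf hz
    have h2 := (hasDerivAt_slice hopen hP hz').comp_add_const s (2 * Real.pi)
    have h3 := hasDerivAt_slice hopen (hP.add hq) hz
    have h4 := (hasDerivAt_slice hopen hP hz).add_const (primitiveFst 0 g (2 * Real.pi, p))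
    refine (h1.unique h2).trans (Eq.trans ?_ (h4.unique h3))
    rw [fderiv_primitiveFst hopen (starSlices_strip ε p₀) hg hz,
      fderiv_primitiveFst hopen (starSlices_strip ε p₀) hg hz', hper]
  · intro p hp
    simp

theorem primitiveFst_ofReal {g : ℂ × ℂ × ℂ → ℂ} {s : ℝ} {p : ℂ × ℂ}
    (hg : ∀ s : ℝ, (g (s, p)).im = 0) :
    primitiveFst 0 g (s, p) = ((∫ x in (0 : ℝ)..s, (g (x, p)).re : ℝ) : ℂ) := by
  have hre : ∀ x : ℝ, g (x, p) = ((g (x, p)).re : ℂ) := fun x => by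
    apply Complex.ext <;> simp [hg x]
  have := segmentAverage_ofReal (g := g) (f := fun x => (g (x, p)).re) (c := 0) (s := s) (p := p)
    fun τ _ => by
      have := hre (τ * s)
      simpa using this
  have h2 := intervalIntegral.smul_integral_comp_mul_right (a := 0) (b := 1)
    (fun x : ℝ => (g (x, p)).re) s
  simp only [zero_mul, one_mul, smul_eq_mul] at h2
  simp only [Complex.ofReal_zero, sub_zero, zero_add] at this
  rw [primitiveFst, this, ← h2]
  push_cast
  ring

namespace OrbitFamily

variable {U : Set ℂ} {u w : ℂ → ℂ} {E₀ G₀ : ℝ} (O : OrbitFamily U u w E₀ G₀)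

section

variable (hU : IsOpen U) (hu : DifferentiableOn ℂ u U) (hw : DifferentiableOn ℂ w U)

theorem diff_comp_two_pi {f : ℂ × ℂ × ℂ → ℂ} (hf : DifferentiableOn ℂ f O.dom) :
    DifferentiableOn ℂ (fun p : ℂ × ℂ => f (2 * Real.pi, p)) (ball (E₀, G₀) O.ε) :=
  hf.comp (f := fun p : ℂ × ℂ => ((2 * Real.pi : ℂ), p)) (by fun_prop)
    fun _ hp => O.two_pi_mem_dom hp

theorem diff_period : DifferentiableOn ℂ O.period (ball (E₀, G₀) O.ε) :=
  O.diff_comp_two_pi O.diff_time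

include hu in
theorem diff_totalShift : DifferentiableOn ℂ O.totalShift (ball (E₀, G₀) O.ε) :=
  O.diff_comp_two_pi (O.diff_shift hu)

theorem diff_actionVar : DifferentiableOn ℂ O.actionVar (ball (E₀, G₀) O.ε) :=
  (O.diff_comp_two_pi O.diff_action).mul_const ((2 * Real.pi : ℂ)⁻¹)

theorem time_add_two_pi {s : ℂ} {p : ℂ × ℂ} (hz : (s, p) ∈ O.dom) :
    O.time (s + 2 * Real.pi, p) = O.time (s, p) + O.period p :=
  primitiveFst_add_two_pi O.diff_κ O.periodic_κ hz

include hu in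
theorem shift_add_two_pi {s : ℂ} {p : ℂ × ℂ} (hz : (s, p) ∈ O.dom) :
    O.shift (s + 2 * Real.pi, p) = O.shift (s, p) + O.totalShift p :=
  primitiveFst_add_two_pi (O.diff_shiftIntegrand hu)
    (fun s p => by simp only [O.periodic_κ, O.periodic_X]) hz

include hU hu hw in
-- After one turn the orbit is back at a turning point, so the term y dx of d𝒜 drops out and only T
-- dE - Σ dG is left.
theorem hasFDerivAt_actionVar {p : ℂ × ℂ} (hp : p ∈ ball ((E₀ : ℂ), (G₀ : ℂ)) O.ε) (v : ℂ × ℂ) :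
    fderiv ℂ O.actionVar p v =
      (O.period p * v.1 - O.totalShift p * v.2) / (2 * Real.pi) := by
  have hz := O.two_pi_mem_dom hp
  have h1 := (O.diff_action.differentiableAt (O.isOpen_dom.mem_nhds hz)).hasFDerivAt
  have h2 : HasFDerivAt (fun p : ℂ × ℂ => ((2 * Real.pi : ℂ), p))
      ((0 : ℂ × ℂ →L[ℂ] ℂ).prod (ContinuousLinearMap.id ℂ _)) p :=
    (hasFDerivAt_const _ _).prodMk (hasFDerivAt_id _)
  have h3 := (h1.comp p h2).mul_const ((2 * Real.pi : ℂ)⁻¹)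
  have h4 : HasFDerivAt O.actionVar _ p := h3
  rw [h4.fderiv]
  have := O.fderiv_action hU hu hw hz (0, v)
  simp [this, O.R_two_pi, period, totalShift]
  ring

include hU hu hw in
/-- The form `T dE - Σ dG` is closed. -/
theorem fderiv_period_symm {p : ℂ × ℂ} (hp : p ∈ ball ((E₀ : ℂ), (G₀ : ℂ)) O.ε) (a b : ℂ × ℂ) :
    fderiv ℂ O.period p a * b.1 - fderiv ℂ O.period p b * a.1 =
      fderiv ℂ O.totalShift p a * b.2 - fderiv ℂ O.totalShift p b * a.2 := by
  have hn : ball ((E₀ : ℂ), (G₀ : ℂ)) O.ε ∈ 𝓝 p := isOpen_ball.mem_nhds hp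
  have hT := (O.diff_period.differentiableAt hn).hasFDerivAt
  have hS := ((O.diff_totalShift hu).differentiableAt hn).hasFDerivAt
  have key : ∀ a b : ℂ × ℂ, fderiv ℂ (fun y => fderiv ℂ O.actionVar y b) p a =
      (fderiv ℂ O.period p a * b.1 - fderiv ℂ O.totalShift p a * b.2) / (2 * Real.pi) := by
    intro a b
    have h1 : HasFDerivAt (fun y => fderiv ℂ O.actionVar y b) _ p :=
      (((hT.mul_const b.1).sub (hS.mul_const b.2)).mul_const
        ((2 * Real.pi : ℂ)⁻¹)).congr_of_eventuallyEq (by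
          filter_upwards [hn] with y hy
          rw [O.hasFDerivAt_actionVar hU hu hw hy]; rfl)
    rw [h1.fderiv]
    simp
    ring
  have h := O.diff_actionVar.fderiv_fderiv_symm isOpen_ball hp a b
  rw [key, key] at h
  have hpi : (2 * Real.pi : ℂ) ≠ 0 := by simp [Real.pi_ne_zero]
  field_simp at h
  linear_combination h

end

section Real

variable {E G : ℝ} (hp : ((E : ℂ), (G : ℂ)) ∈ ball ((E₀ : ℂ), (G₀ : ℂ)) O.ε)

include hp

theorem time_ofReal (s : ℝ) :
    O.time (s, E, G) = ((∫ x in (0 : ℝ)..s, (O.κ (x, E, G)).re : ℝ) : ℂ) :=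
  primitiveFst_ofReal fun s => O.real_κ s E G hp

theorem X_ofReal (s : ℝ) : O.X (s, E, G) = ((O.X (s, E, G)).re : ℂ) := by
  apply Complex.ext <;> simp [O.real_X s E G hp]

theorem R_ofReal (s : ℝ) : O.R (s, E, G) = ((O.R (s, E, G)).re : ℂ) := by
  apply Complex.ext <;> simp [O.real_R s E G hp]

theorem κ_ofReal (s : ℝ) : O.κ (s, E, G) = ((O.κ (s, E, G)).re : ℂ) := by
  apply Complex.ext <;> simp [O.real_κ s E G hp]

theorem shift_im (hur : ∀ x : ℝ, (x : ℂ) ∈ U → (u x).im = 0) (s : ℝ) :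
    (O.shift (s, E, G)).im = 0 := by
  rw [shift, primitiveFst_ofReal]
  · exact Complex.ofReal_im _
  · intro x
    have hu : (u (O.X (x, E, G))).im = 0 := by
      rw [O.X_ofReal hp]
      apply hur
      rw [← O.X_ofReal hp]
      exact O.mem_X _ (O.ofReal_mem_dom x hp)
    simp [O.real_κ x E G hp, hu]

theorem action_ofReal (s : ℝ) : O.action (s, E, G) =
    ((∫ x in (0 : ℝ)..s, (O.κ (x, E, G)).re * (O.R (x, E, G)).re ^ 2 : ℝ) : ℂ) := by
  have : ∀ x : ℝ, O.κ (x, E, G) * O.R (x, E, G) ^ 2 =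
      (((O.κ (x, E, G)).re * (O.R (x, E, G)).re ^ 2 : ℝ) : ℂ) := fun x => by
    push_cast
    rw [← O.κ_ofReal hp, ← O.R_ofReal hp]
  rw [action, primitiveFst_ofReal]
  · congr 1
    refine intervalIntegral.integral_congr fun x _ => ?_
    simp only [this x, Complex.ofReal_re]
  · intro x
    simp only [this x, Complex.ofReal_im]

theorem continuous_real {f : ℂ × ℂ × ℂ → ℂ} (hf : DifferentiableOn ℂ f O.dom) :
    Continuous fun s : ℝ => (f (s, E, G)).re :=
  Complex.continuous_re.comp (hf.continuousOn.comp_continuous (by fun_prop)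
    fun s => O.ofReal_mem_dom s hp)

theorem period_ofReal :
    O.period (E, G) = ((∫ x in (0 : ℝ)..2 * Real.pi, (O.κ (x, E, G)).re : ℝ) : ℂ) := by
  have := O.time_ofReal hp (2 * Real.pi)
  push_cast at this
  exact this

theorem period_re_pos : 0 < (O.period (E, G)).re := by
  rw [O.period_ofReal hp, Complex.ofReal_re]
  exact intervalIntegral.intervalIntegral_pos_of_pos
    ((O.continuous_real hp O.diff_κ).intervalIntegrable _ _)
    (fun x => O.pos_κ x E G hp) Real.two_pi_pos

theorem period_im : (O.period (E, G)).im = 0 := by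
  rw [O.period_ofReal hp, Complex.ofReal_im]

theorem totalShift_im (hur : ∀ x : ℝ, (x : ℂ) ∈ U → (u x).im = 0) :
    (O.totalShift (E, G)).im = 0 := by
  have := O.shift_im hp hur (2 * Real.pi)
  push_cast at this
  exact this

theorem hasDerivAt_X (s : ℝ) : HasDerivAt (fun s : ℝ => (O.X (s, E, G)).re)
    ((O.κ (s, E, G)).re * (O.R (s, E, G)).re) s := by
  have hz := O.ofReal_mem_dom s hp
  have h1 := (hasDerivAt_slice O.isOpen_dom O.diff_X hz)
  rw [O.fderiv_X _ hz, O.κ_ofReal hp, O.R_ofReal hp, ← Complex.ofReal_mul] at h1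
  have h2 := h1.real_of_complex
  simpa using h2

/-- The parameter runs along the lower branch for s in (0, π), where dX/ds = κR < 0. -/
theorem strictAntiOn_X : StrictAntiOn (fun s : ℝ => (O.X (s, E, G)).re) (Icc 0 Real.pi) := by
  refine strictAntiOn_of_deriv_neg (convex_Icc _ _)
    (O.continuous_real hp O.diff_X).continuousOn fun s hs => ?_
  rw [interior_Icc] at hs
  rw [(O.hasDerivAt_X hp s).deriv]
  exact mul_neg_of_pos_of_neg (O.pos_κ s E G hp) (O.neg_R s E G hp hs)

variable {W : ℝ → ℝ} (hW : ∀ x : ℝ, (x : ℂ) ∈ U → ((G : ℂ) ^ 2 * u x + w x) = W x)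

include hW

theorem energy_real (s : ℝ) :
    (O.R (s, E, G)).re ^ 2 / 2 + W ((O.X (s, E, G)).re) = E := by
  have hz := O.ofReal_mem_dom s hp
  have h := O.energy _ hz
  have hXU := O.mem_X _ hz
  rw [O.X_ofReal hp] at hXU h
  simp only at h
  rw [O.R_ofReal hp, add_assoc, hW _ hXU] at h
  exact_mod_cast h

variable {I : Set ℝ} (hI : ∀ x : ℝ, x ∈ I ↔ (x : ℂ) ∈ U) {a b : ℝ}
  (hab : {r | r ∈ I ∧ W r ≤ E} = Icc a b) (hin : ∀ r ∈ Ioo a b, W r < E)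

include hI in
theorem X_mem_real (s : ℝ) : (O.X (s, E, G)).re ∈ I := by
  rw [hI, ← O.X_ofReal hp]
  exact O.mem_X _ (O.ofReal_mem_dom s hp)

include hI hab hin in
-- R vanishes at s = 0 and s = π, and W < E strictly inside the well, so X is an endpoint there;
-- monotonicity decides which one.
theorem X_endpoints : (O.X (0, E, G)).re = b ∧ (O.X (Real.pi, E, G)).re = a := by
  have hmem : ∀ s : ℝ, (O.X (s, E, G)).re ∈ Icc a b := fun s => by
    rw [← hab]
    refine ⟨O.X_mem_real hp hW hI s, ?_⟩
    nlinarith [O.energy_real hp hW s, sq_nonneg (O.R (s, E, G)).re]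
  have hend : ∀ s : ℝ, O.R (s, E, G) = 0 → (O.X (s, E, G)).re = a ∨ (O.X (s, E, G)).re = b := by
    intro s hs
    have h := O.energy_real hp hW s
    rw [hs] at h
    by_contra! hne
    have := hin _ ⟨lt_of_le_of_ne (hmem s).1 hne.1.symm, lt_of_le_of_ne (hmem s).2 hne.2⟩
    simp at h
    linarith
  have hlt := O.strictAntiOn_X hp (left_mem_Icc.2 Real.pi_pos.le) (right_mem_Icc.2 Real.pi_pos.le)
    Real.pi_pos
  have h0 := hend 0 (by simpa using O.R_zero (E, G))
  have h1 := hend Real.pi (O.R_pi (E, G))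
  have m0 := hmem 0
  have m1 := hmem Real.pi
  simp only [Complex.ofReal_zero] at hlt h0 m0
  rcases h0 with h0 | h0 <;> rcases h1 with h1 | h1
  · linarith
  · linarith [m0.2]
  · exact ⟨h0, h1⟩
  · linarith

include hI hab hin in
-- The lower branch is reached by the intermediate value theorem on [0, π]; the upper branch follows
-- from s ↦ -s, since X is even and R odd.
theorem exists_param {x y : ℝ} (hx : x ∈ I) (hxy : y ^ 2 / 2 + W x = E) :
    ∃ s : ℝ, O.X (s, E, G) = x ∧ O.R (s, E, G) = y := by
  obtain ⟨hb, ha⟩ := O.X_endpoints hp hW hI hab hin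
  have hmem : x ∈ Icc a b := by
    rw [← hab]; exact ⟨hx, by nlinarith [sq_nonneg y]⟩
  have hivt := intermediate_value_Icc' Real.pi_pos.le
    (O.continuous_real hp O.diff_X).continuousOn (f := fun s : ℝ => (O.X (s, E, G)).re)
  simp only [Complex.ofReal_zero, ha, hb] at hivt
  obtain ⟨s, -, hs⟩ := hivt hmem
  have h := O.energy_real hp hW s
  simp only at hs
  rw [hs] at h
  have hsq : y ^ 2 = (O.R (s, E, G)).re ^ 2 := by linarith
  rcases sq_eq_sq_iff_eq_or_eq_neg.1 hsq with hy | hy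
  · exact ⟨s, by rw [O.X_ofReal hp, hs], by rw [O.R_ofReal hp, hy]⟩
  · refine ⟨-s, ?_, ?_⟩
    · push_cast; rw [O.even_X, O.X_ofReal hp, hs]
    · push_cast; rw [O.odd_R, O.R_ofReal hp, hy]; push_cast; ring

include hI hab hin in
-- The substitution x = X(s) turns the integral of κR² over a half turn into that of √(2(E - W))
-- over the well. This identifies the holomorphic action with the one in the hypotheses.
theorem actionVar_eq_loopAction (hWc : ContinuousOn W I) :
    O.actionVar (E, G) = (loopAction I W E : ℂ) := by
  obtain ⟨hb, ha⟩ := O.X_endpoints hp hW hI hab hin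
  have hle : a ≤ b := by
    rw [← ha, ← hb]
    have := (O.strictAntiOn_X hp (left_mem_Icc.2 Real.pi_pos.le)
      (right_mem_Icc.2 Real.pi_pos.le) Real.pi_pos).le
    simpa using this
  have hcκ := O.continuous_real hp O.diff_κ
  have hcR := O.continuous_real hp O.diff_R
  have hc : Continuous fun x : ℝ => (O.κ (x, E, G)).re * (O.R (x, E, G)).re ^ 2 :=
    hcκ.mul (hcR.pow 2)
  set f : ℝ → ℝ := fun x : ℝ => (O.κ (x, E, G)).re * (O.R (x, E, G)).re ^ 2 with hf
  -- The integrand is even and 2π-periodic, so the half turns contribute equally; they are the two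
  -- branches of the loop.
  have hsymm : ∫ x in (0 : ℝ)..2 * Real.pi, f x = 2 * ∫ x in (0 : ℝ)..Real.pi, f x := by
    have h1 := intervalIntegral.integral_comp_sub_left (a := 0) (b := Real.pi) f (2 * Real.pi)
    have h2 : ∀ x, f (2 * Real.pi - x) = f x := by
      intro x
      simp only [f]
      push_cast
      rw [sub_eq_neg_add, O.periodic_κ, O.periodic_R, O.even_κ, O.odd_R]
      simp
    simp only [h2] at h1
    rw [sub_zero, show 2 * Real.pi - Real.pi = Real.pi by ring] at h1
    rw [← intervalIntegral.integral_add_adjacent_intervals (hc.intervalIntegrable 0 Real.pi)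
      (hc.intervalIntegrable Real.pi (2 * Real.pi)), ← h1]
    ring
  have hsub := intervalIntegral.integral_comp_mul_deriv' (a := 0) (b := Real.pi)
    (f := fun s : ℝ => (O.X (s, E, G)).re)
    (f' := fun s : ℝ => (O.κ (s, E, G)).re * (O.R (s, E, G)).re)
    (g := fun x => Real.sqrt (2 * (E - W x))) (fun s _ => O.hasDerivAt_X hp s)
    (hcκ.mul hcR).continuousOn
    (by
      refine ContinuousOn.mono (s := I) ?_ ?_
      · exact Real.continuous_sqrt.comp_continuousOn
          (continuousOn_const.mul (continuousOn_const.sub hWc))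
      · rintro _ ⟨s, -, rfl⟩
        exact O.X_mem_real hp hW hI s)
  simp only [Complex.ofReal_zero, ha, hb] at hsub
  -- On [0, π] one has R ≤ 0, hence √(2(E - W)) = -R; this sign compensates for X running from b
  -- down to a.
  have hlhs : ∫ x in (0 : ℝ)..Real.pi, ((fun x => Real.sqrt (2 * (E - W x))) ∘
      fun s : ℝ => (O.X (s, E, G)).re) x * ((O.κ (x, E, G)).re * (O.R (x, E, G)).re) =
      -∫ x in (0 : ℝ)..Real.pi, f x := by
    rw [← intervalIntegral.integral_neg]
    refine intervalIntegral.integral_congr fun s hs => ?_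
    rw [uIcc_of_le Real.pi_pos.le] at hs
    have hR : (O.R (s, E, G)).re ≤ 0 := by
      rcases eq_or_lt_of_le hs.1 with h | h
      · rw [← h, Complex.ofReal_zero, O.R_zero]; simp
      rcases eq_or_lt_of_le hs.2 with h' | h'
      · rw [h', O.R_pi]; simp
      · exact (O.neg_R s E G hp ⟨h, h'⟩).le
    have hE := O.energy_real hp hW s
    have : 2 * (E - W ((O.X (s, E, G)).re)) = (O.R (s, E, G)).re ^ 2 := by linarith
    simp only [Function.comp, this, Real.sqrt_sq_eq_abs, abs_of_nonpos hR, f]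
    ring
  rw [hlhs, intervalIntegral.integral_symm a b, neg_inj] at hsub
  rw [loopAction, hab, MeasureTheory.integral_Icc_eq_integral_Ioc,
    ← intervalIntegral.integral_of_le hle, ← hsub, ← hsymm, actionVar]
  have := O.action_ofReal hp (2 * Real.pi)
  push_cast at this ⊢
  rw [this]
  simp only [f]
  ring

end Real

end OrbitFamily

end OrbitFamilies

/-! ### Construction of an orbit family from a well with non-critical ends. -/

section OrbitConstruction

open Metric Set Filter Topology ComplexConjugate

theorem segmentAverage_im {P : Type*} [NormedAddCommGroup P] [NormedSpace ℂ P] {g : ℂ × P → ℂ} {c s : ℝ} {p : P}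
    (hg : ∀ τ ∈ Icc (0 : ℝ) 1, (g ((c + τ * (s - c) : ℝ), p)).im = 0) :
    (segmentAverage c g (s, p)).im = 0 := by
  rw [segmentAverage_ofReal (f := fun x => (g (x, p)).re)]
  · exact Complex.ofReal_im _
  · intro τ hτ
    have := hg τ hτ
    push_cast at this ⊢
    apply Complex.ext <;> simp [this]

section

variable {P : Type*} [NormedAddCommGroup P] [NormedSpace ℂ P] {Ω : Set (ℂ × P)}

theorem fderiv_fst_eq {f : ℂ × P → ℂ} (hΩ : IsOpen Ω) (hf : DifferentiableOn ℂ f Ω) {s : ℂ} {p : P}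
    (hz : (s, p) ∈ Ω) {f' : ℂ} (h : HasDerivAt (fun s => f (s, p)) f' s) :
    fderiv ℂ f (s, p) (1, 0) = f' :=
  (hasDerivAt_slice hΩ hf hz).unique h

theorem fderiv_fst_im {f : ℂ × P → ℂ} (hΩ : IsOpen Ω) (hf : DifferentiableOn ℂ f Ω) {p : P}
    (hreal : ∀ x : ℝ, ((x : ℂ), p) ∈ Ω → (f (x, p)).im = 0) {s : ℝ} (hz : ((s : ℂ), p) ∈ Ω) :
    (fderiv ℂ f (s, p) (1, 0)).im = 0 := by
  have h1 := (hasDerivAt_slice hΩ hf hz).comp_ofReal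
  have h2 := Complex.imCLM.hasFDerivAt.comp_hasDerivAt s h1
  have h3 : HasDerivAt (Complex.imCLM ∘ fun y : ℝ => f (y, p)) 0 s := by
    refine (hasDerivAt_const s (0 : ℝ)).congr_of_eventuallyEq ?_
    have : ∀ᶠ x : ℝ in 𝓝 s, ((x : ℂ), p) ∈ Ω :=
      (show Continuous fun x : ℝ => ((x : ℂ), p) by fun_prop).continuousAt.eventually
        (hΩ.mem_nhds hz)
    filter_upwards [this] with x hx
    simpa using hreal x hx
  exact h2.unique h3

end

variable {U : Set ℂ} {u w : ℂ → ℂ}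

/-- A holomorphic implicit function theorem with reality: (x, G) ↦ (G² u + w, G) is injective near
the turning point, and ρ is the first component of its inverse. -/
theorem exists_turningPoint (hU : IsOpen U) (hu : DifferentiableOn ℂ u U)
    (hw : DifferentiableOn ℂ w U) (hur : ∀ x : ℝ, (x : ℂ) ∈ U → (u x).im = 0)
    (hwr : ∀ x : ℝ, (x : ℂ) ∈ U → (w x).im = 0) {E₀ G₀ r : ℝ} (hr : (r : ℂ) ∈ U)
    (hE : (G₀ : ℂ) ^ 2 * u r + w r = E₀) (hd : (G₀ : ℂ) ^ 2 * deriv u r + deriv w r ≠ 0) :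
    ∃ δ > 0, ∃ ρ : ℂ × ℂ → ℂ, DifferentiableOn ℂ ρ (ball (E₀, G₀) δ) ∧ ρ (E₀, G₀) = r ∧
      (∀ p ∈ ball ((E₀ : ℂ), (G₀ : ℂ)) δ, ρ p ∈ U ∧ p.2 ^ 2 * u (ρ p) + w (ρ p) = p.1) ∧
      ∀ E G : ℝ, ((E : ℂ), (G : ℂ)) ∈ ball ((E₀ : ℂ), (G₀ : ℂ)) δ → (ρ (E, G)).im = 0 := by
  set Ω₀ : Set (ℂ × ℂ) := U ×ˢ univ
  have hΩ₀ : IsOpen Ω₀ := hU.prod isOpen_univ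
  have hufst : DifferentiableOn ℂ (fun z : ℂ × ℂ => u z.1) Ω₀ :=
    hu.comp differentiableOn_fst fun z hz => hz.1
  have hwfst : DifferentiableOn ℂ (fun z : ℂ × ℂ => w z.1) Ω₀ :=
    hw.comp differentiableOn_fst fun z hz => hz.1
  set f : ℂ × ℂ → ℂ := fun z => z.2 ^ 2 * u z.1 + w z.1
  have hf : DifferentiableOn ℂ f Ω₀ := (DifferentiableOn.mul (by fun_prop) hufst).add hwfst
  set A : ℂ × ℂ → ℂ := fun z => z.2 ^ 2 * deriv u z.1 + deriv w z.1
  have hA : ContinuousOn A Ω₀ := by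
    have h1 : ContinuousOn (fun z : ℂ × ℂ => deriv u z.1) Ω₀ :=
      (hu.deriv hU).continuousOn.comp continuousOn_fst fun z hz => hz.1
    have h2 : ContinuousOn (fun z : ℂ × ℂ => deriv w z.1) Ω₀ :=
      (hw.deriv hU).continuousOn.comp continuousOn_fst fun z hz => hz.1
    exact (ContinuousOn.mul (by fun_prop) h1).add h2
  have hfA : ∀ z ∈ Ω₀, HasDerivAt (fun x => f (x, z.2)) (A z) z.1 := by
    intro z hz
    exact (((hu.differentiableAt (hU.mem_nhds hz.1)).hasDerivAt).const_mul (z.2 ^ 2)).add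
      (hw.differentiableAt (hU.mem_nhds hz.1)).hasDerivAt
  set a₀ := A (r, G₀) with ha₀
  have hmem₀ : ((r : ℂ), (G₀ : ℂ)) ∈ Ω₀ := ⟨hr, mem_univ _⟩
  -- Multiplication by the conjugate of `a₀` makes the derivative at the base point positive.
  -- Positivity of its real part persists on a ball, where the half-plane criterion gives
  -- injectivity in x.
  have hopen : IsOpen (Ω₀ ∩ (fun z => (conj a₀ * A z).re) ⁻¹' Ioi 0) :=
    (Complex.continuous_re.comp_continuousOn (continuousOn_const.mul hA)).isOpen_inter_preimage
      hΩ₀ isOpen_Ioi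
  obtain ⟨η, hη, hηsub⟩ := Metric.isOpen_iff.1 hopen ((r : ℂ), (G₀ : ℂ)) ⟨hmem₀, by
    simp only [mem_preimage, ← ha₀, mem_Ioi]
    rw [← Complex.normSq_eq_conj_mul_self, Complex.ofReal_re]
    exact Complex.normSq_pos.2 hd⟩
  set Ω := ball ((r : ℂ), (G₀ : ℂ)) η
  have hΩ : IsOpen Ω := isOpen_ball
  have hΩΩ₀ : Ω ⊆ Ω₀ := fun z hz => (hηsub hz).1
  have hAne : ∀ z ∈ Ω, A z ≠ 0 := fun z hz h0 => by
    have := (hηsub hz).2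
    simp [h0] at this
  set M : ℂ × ℂ → ℂ × ℂ := fun z => (f z, z.2)
  have hM : DifferentiableOn ℂ M Ω := (hf.mono hΩΩ₀).prodMk differentiableOn_snd
  have hinj : InjOn M Ω := by
    rintro ⟨x, G⟩ hz ⟨x', G'⟩ hz' h
    have hG : G = G' := (Prod.ext_iff.1 h).2
    subst hG
    have hball : ∀ {y : ℂ}, (y, G) ∈ Ω ↔ y ∈ ball (r : ℂ) η ∧ G ∈ ball (G₀ : ℂ) η := by
      intro y
      simp only [Ω]
      rw [← ball_prod_same]
      exact Iff.rfl
    have hinj := (convex_ball (r : ℂ) η).injOn_of_re_deriv_pos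
      (f := fun x => conj a₀ * f (x, G)) (f' := fun x => conj a₀ * A (x, G))
      (fun y hy => (hfA (y, G) (hΩΩ₀ (hball.2 ⟨hy, (hball.1 hz).2⟩))).const_mul _)
      (fun y hy => (hηsub (hball.2 ⟨hy, (hball.1 hz).2⟩)).2)
    have hx := hinj (hball.1 hz).1 (hball.1 hz').1
      (congrArg (fun t => conj a₀ * t) (Prod.ext_iff.1 h).1)
    rw [hx]
  have hder : ∀ z ∈ Ω, ∀ v, fderiv ℂ M z v = 0 → v = 0 := by
    rintro ⟨x, G⟩ hz ⟨v₁, v₂⟩ hv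
    have hfd := (hf.differentiableAt (hΩ₀.mem_nhds (hΩΩ₀ hz))).hasFDerivAt
    have h1 : HasFDerivAt M _ (x, G) := hfd.prodMk hasFDerivAt_snd
    rw [h1.fderiv] at hv
    simp only [ContinuousLinearMap.prod_apply, ContinuousLinearMap.coe_snd', Prod.mk_eq_zero] at hv
    obtain ⟨hv1, rfl⟩ := hv
    have h2 : fderiv ℂ f (x, G) (1, 0) = A (x, G) :=
      fderiv_fst_eq hΩ₀ hf (hΩΩ₀ hz) (hfA (x, G) (hΩΩ₀ hz))
    rw [show ((v₁, 0) : ℂ × ℂ) = v₁ • (1, 0) by simp, map_smul, h2, smul_eq_mul] at hv1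
    rcases mul_eq_zero.1 hv1 with h | h
    · rw [h]; rfl
    · exact absurd h (hAne _ hz)
  obtain ⟨hopenM, g, hg, hgM, -⟩ := hinj.exists_holomorphic_inverse hΩ hM hder
  have hcball : ((r : ℂ), (G₀ : ℂ)) ∈ Ω := mem_ball_self hη
  have hMc : M ((r : ℂ), (G₀ : ℂ)) = ((E₀ : ℂ), (G₀ : ℂ)) := by simp only [M, f, hE]
  obtain ⟨δ, hδ, hδsub⟩ := Metric.isOpen_iff.1 hopenM ((E₀ : ℂ), (G₀ : ℂ)) ⟨_, hcball, hMc⟩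
  have hinv : ∀ p ∈ ball ((E₀ : ℂ), (G₀ : ℂ)) δ, g p ∈ Ω ∧ M (g p) = p := by
    intro p hp
    obtain ⟨z, hz, rfl⟩ := hδsub hp
    rw [hgM z hz]
    exact ⟨hz, rfl⟩
  refine ⟨δ, hδ, fun p => (g p).1, ?_, ?_, ?_, ?_⟩
  · exact differentiableOn_fst.comp (hg.mono hδsub) (mapsTo_univ _ _)
  · simp only [← hMc, hgM _ hcball]
  · intro p hp
    obtain ⟨h1, h2⟩ := hinv p hp
    refine ⟨(hΩΩ₀ h1).1, ?_⟩
    have h3 : (g p).2 = p.2 := (Prod.ext_iff.1 h2).2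
    have h4 : f (g p) = p.1 := (Prod.ext_iff.1 h2).1
    simp only [f, h3] at h4
    exact h4
  -- For real (E, G), reflection along the line ℓ through the real part of x, with ℓ(±i) equal to
  -- the solution and its conjugate, shows that the conjugate also solves the equation. Injectivity
  -- makes x real.
  · intro E G hp
    obtain ⟨h1, h2⟩ := hinv _ hp
    set z := g ((E : ℂ), (G : ℂ)) with hz
    have hzG : z.2 = G := congrArg Prod.snd h2
    set ℓ : ℂ → ℂ × ℂ := fun t => (z.1.re + t * z.1.im, G)
    have hℓI : ℓ Complex.I = z := by
      refine Prod.ext ?_ hzG.symm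
      simp only [ℓ]
      rw [mul_comm]; exact Complex.re_add_im _
    have hℓI' : ℓ (-Complex.I) = (conj z.1, (G : ℂ)) := by
      refine Prod.ext ?_ rfl
      apply Complex.ext <;> simp [ℓ]
    have hℓc : ∀ t, ℓ (conj t) = (conj (ℓ t).1, conj (ℓ t).2) := fun t => by simp [ℓ]
    have hO : IsOpen (ℓ ⁻¹' Ω) := hΩ.preimage (by fun_prop)
    have hconv : Convex ℝ (ℓ ⁻¹' Ω) := by
      have h : ∀ {s t : ℂ} {a b : ℝ}, a + b = 1 → ℓ (a • s + b • t) = a • ℓ s + b • ℓ t := by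
        intro s t a b hab
        have hab' : (a : ℂ) + b = 1 := by exact_mod_cast hab
        refine Prod.ext ?_ ?_ <;> simp only [ℓ, Prod.fst_add, Prod.snd_add, Prod.smul_fst,
          Prod.smul_snd, Complex.real_smul]
        · linear_combination (-(z.1.re : ℂ)) * hab'
        · linear_combination (-(G : ℂ)) * hab'
      intro s hs t ht a b ha hb hab
      rw [mem_preimage, h hab]
      exact convex_ball _ _ hs ht ha hb hab
    have hcj : ∀ t ∈ ℓ ⁻¹' Ω, conj t ∈ ℓ ⁻¹' Ω := by
      intro t ht
      rw [mem_preimage, hℓc]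
      have hd : ∀ (x : ℝ) (y : ℂ), dist (conj y) (x : ℂ) = dist y x := fun x y => by
        rw [← Complex.conj_ofReal x, Complex.dist_conj_conj, Complex.conj_ofReal]
      simpa only [Ω, mem_preimage, mem_ball, Prod.dist_eq, hd] using ht
    have hreal : ∀ x : ℝ, (x : ℂ) ∈ ℓ ⁻¹' Ω → ((f ∘ ℓ) x).im = 0 := by
      intro x hx
      have hxU : ((z.1.re + x * z.1.im : ℝ) : ℂ) ∈ U := by
        have := (hΩΩ₀ hx).1
        simpa [ℓ] using this
      have h1 := hur _ hxU
      have h2 := hwr _ hxU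
      push_cast at h1 h2
      simp [f, ℓ, h1, h2, ← Complex.ofReal_pow]
    have := eq_conj_of_real_on_line hO hconv hcj (by rw [mem_preimage, hℓI]; exact h1)
      ((hf.mono hΩΩ₀).comp (show DifferentiableOn ℂ ℓ _ by fun_prop) fun t ht => ht) hreal
    simp only [Function.comp, hℓI, hℓI'] at this
    have h4 : f z = E := congrArg Prod.fst h2
    rw [h4, Complex.conj_ofReal] at this
    have hIm : -Complex.I ∈ ℓ ⁻¹' Ω := by
      have := hcj Complex.I (by rw [mem_preimage, hℓI]; exact h1)
      simpa using this
    rw [mem_preimage, hℓI'] at hIm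
    have heq := hinj hIm h1 (Prod.ext (this.trans h4.symm) hzG.symm)
    exact Complex.conj_eq_iff_im.1 (congrArg Prod.fst heq)

/-- Complex neighbourhoods of the segment `[-1, 1]` times balls of parameters. -/
def segmentNhd (η : ℝ) (p₀ : ℂ × ℂ) : Set (ℂ × ℂ × ℂ) :=
  thickening η ((fun x : ℝ => (x : ℂ)) '' Icc (-1) 1) ×ˢ ball p₀ η

theorem isOpen_segmentNhd (η : ℝ) (p₀ : ℂ × ℂ) : IsOpen (segmentNhd η p₀) :=
  isOpen_thickening.prod isOpen_ball

theorem convex_thickening_segment (η : ℝ) :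
    Convex ℝ (thickening η ((fun x : ℝ => (x : ℂ)) '' Icc (-1) 1)) :=
  Convex.thickening ((convex_Icc (-1 : ℝ) 1).linear_image Complex.ofRealCLM.toLinearMap) η

theorem starSlices_segmentNhd {η : ℝ} {p₀ : ℂ × ℂ} (hη : 0 < η) {c : ℝ}
    (hc : c ∈ Icc (-1 : ℝ) 1) : StarSlices (c : ℂ) (segmentNhd η p₀) := by
  intro z hz τ hτ
  refine ⟨?_, hz.2⟩
  have := (convex_thickening_segment η).add_smul_sub_mem
    (self_subset_thickening hη _ ⟨c, hc, rfl⟩) hz.1 hτ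
  simpa using this

theorem exists_segmentNhd_subset {p₀ : ℂ × ℂ} {O : Set (ℂ × ℂ × ℂ)} (hO : IsOpen O)
    (h : ∀ x ∈ Icc (-1 : ℝ) 1, ((x : ℂ), p₀) ∈ O) : ∃ η > 0, segmentNhd η p₀ ⊆ O := by
  have hK : IsCompact (((fun x : ℝ => (x : ℂ)) '' Icc (-1) 1) ×ˢ ({p₀} : Set (ℂ × ℂ))) :=
    (isCompact_Icc.image Complex.continuous_ofReal).prod isCompact_singleton
  obtain ⟨η, hη, hsub⟩ := hK.exists_thickening_subset_open hO (by
    rintro ⟨_, _⟩ ⟨⟨x, hx, rfl⟩, rfl⟩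
    exact h x hx)
  refine ⟨η, hη, fun z hz => hsub ?_⟩
  obtain ⟨y, hy, hzy⟩ := mem_thickening_iff.1 hz.1
  refine mem_thickening_iff.2 ⟨(y, p₀), ⟨hy, rfl⟩, ?_⟩
  rw [Prod.dist_eq]
  exact max_lt hzy hz.2

/-- Factorization of `E - G² u - w` between two turning points, in the affine coordinate on the
first factor in which the turning points are `±1`. -/
theorem exists_factorization (hU : IsOpen U) (hu : DifferentiableOn ℂ u U)
    (hw : DifferentiableOn ℂ w U) (hur : ∀ x : ℝ, (x : ℂ) ∈ U → (u x).im = 0)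
    (hwr : ∀ x : ℝ, (x : ℂ) ∈ U → (w x).im = 0) {E₀ G₀ a b : ℝ} (hab : a < b)
    (hsub : ∀ x ∈ Icc a b, (x : ℂ) ∈ U)
    (ha : (G₀ : ℂ) ^ 2 * u a + w a = E₀) (hb : (G₀ : ℂ) ^ 2 * u b + w b = E₀)
    (hin : ∀ x ∈ Ioo a b, ((G₀ : ℂ) ^ 2 * u x + w x).re < E₀)
    (hda : (G₀ : ℂ) ^ 2 * deriv u a + deriv w a ≠ 0)
    (hdb : (G₀ : ℂ) ^ 2 * deriv u b + deriv w b ≠ 0) :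
    ∃ η > 0, ∃ (m d : ℂ × ℂ → ℂ) (q : ℂ × ℂ × ℂ → ℂ),
      DifferentiableOn ℂ m (ball (E₀, G₀) η) ∧ DifferentiableOn ℂ d (ball (E₀, G₀) η) ∧
      DifferentiableOn ℂ q (segmentNhd η (E₀, G₀)) ∧
      (∀ E G : ℝ, ((E : ℂ), (G : ℂ)) ∈ ball ((E₀ : ℂ), (G₀ : ℂ)) η →
        (m (E, G)).im = 0 ∧ (d (E, G)).im = 0) ∧
      (∀ Y E G : ℝ, ((Y : ℂ), (E : ℂ), (G : ℂ)) ∈ segmentNhd η (E₀, G₀) → (q (Y, E, G)).im = 0) ∧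
      (∀ z ∈ segmentNhd η (E₀, G₀), m z.2 + d z.2 * z.1 ∈ U ∧
        z.2.1 - (z.2.2 ^ 2 * u (m z.2 + d z.2 * z.1) + w (m z.2 + d z.2 * z.1)) =
          (1 - z.1 ^ 2) * q z) ∧
      0 < (d (E₀, G₀)).re ∧ ∀ Y ∈ Icc (-1 : ℝ) 1, 0 < (q (Y, E₀, G₀)).re := by
  obtain ⟨δ₁, hδ₁, ρ, hρ, hρ₀, hρU, hρr⟩ := exists_turningPoint hU hu hw hur hwr
    (hsub a (left_mem_Icc.2 hab.le)) ha hda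
  obtain ⟨δ₂, hδ₂, θ, hθ, hθ₀, hθU, hθr⟩ := exists_turningPoint hU hu hw hur hwr
    (hsub b (right_mem_Icc.2 hab.le)) hb hdb
  set p₀ : ℂ × ℂ := ((E₀ : ℂ), (G₀ : ℂ)) with hp₀
  set δ := min δ₁ δ₂ with hδ_def
  have hδ : 0 < δ := lt_min hδ₁ hδ₂
  have hρ' : DifferentiableOn ℂ ρ (ball p₀ δ) := hρ.mono (ball_subset_ball (min_le_left _ _))
  have hθ' : DifferentiableOn ℂ θ (ball p₀ δ) := hθ.mono (ball_subset_ball (min_le_right _ _))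
  -- Midpoint and half-length of the well: x = m + d Y sends Y = -1 to the left turning point ρ and
  -- Y = 1 to the right one θ.
  set m : ℂ × ℂ → ℂ := fun p => (θ p + ρ p) / 2 with hm_def
  set d : ℂ × ℂ → ℂ := fun p => (θ p - ρ p) / 2 with hd_def
  have hm : DifferentiableOn ℂ m (ball p₀ δ) := (hθ'.add hρ').mul_const ((2 : ℂ)⁻¹)
  have hd : DifferentiableOn ℂ d (ball p₀ δ) := (hθ'.sub hρ').mul_const ((2 : ℂ)⁻¹)
  have hmd0 : ∀ Y : ℝ, m p₀ + d p₀ * Y = (((b + a) / 2 + (b - a) / 2 * Y : ℝ) : ℂ) := fun Y => by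
    simp only [hm_def, hd_def, hθ₀, hρ₀]; push_cast; ring
  set Ω₀ : Set (ℂ × ℂ × ℂ) := univ ×ˢ ball p₀ δ with hΩ₀_def
  have hΩ₀ : IsOpen Ω₀ := isOpen_univ.prod isOpen_ball
  have hx : DifferentiableOn ℂ (fun z : ℂ × ℂ × ℂ => m z.2 + d z.2 * z.1) Ω₀ :=
    (hm.comp differentiableOn_snd fun z hz => hz.2).add
      ((hd.comp differentiableOn_snd fun z hz => hz.2).mul differentiableOn_fst)
  have hIcc : ∀ Y ∈ Icc (-1 : ℝ) 1, (b + a) / 2 + (b - a) / 2 * Y ∈ Icc a b := fun Y hY =>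
    ⟨by nlinarith [hY.1, hY.2], by nlinarith [hY.1, hY.2]⟩
  obtain ⟨η, hη, hηsub⟩ := exists_segmentNhd_subset (p₀ := p₀)
    (hx.continuousOn.isOpen_inter_preimage hΩ₀ hU) (fun Y hY => by
      refine ⟨⟨mem_univ _, mem_ball_self hδ⟩, ?_⟩
      rw [mem_preimage, hmd0]
      exact hsub _ (hIcc Y hY))
  set Ω := segmentNhd η p₀ with hΩ_def
  have hΩ : IsOpen Ω := isOpen_segmentNhd η p₀
  have hmemseg : ∀ Y ∈ Icc (-1 : ℝ) 1, ∀ p ∈ ball p₀ η, ((Y : ℂ), p) ∈ Ω := fun Y hY p hp =>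
    ⟨self_subset_thickening hη _ ⟨Y, hY, rfl⟩, hp⟩
  have h1mem : (1 : ℝ) ∈ Icc (-1 : ℝ) 1 := by norm_num
  have hn1mem : (-1 : ℝ) ∈ Icc (-1 : ℝ) 1 := by norm_num
  have hball : ball p₀ η ⊆ ball p₀ δ := fun p hp => (hηsub (hmemseg 1 h1mem p hp)).1.2
  have hxΩ := hx.mono fun z hz => (hηsub hz).1
  have hxU : ∀ z ∈ Ω, m z.2 + d z.2 * z.1 ∈ U := fun z hz => (hηsub hz).2
  set k : ℂ × ℂ × ℂ → ℂ := fun z =>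
    z.2.1 - (z.2.2 ^ 2 * u (m z.2 + d z.2 * z.1) + w (m z.2 + d z.2 * z.1)) with hk_def
  have hk : DifferentiableOn ℂ k Ω := by
    refine DifferentiableOn.sub (by fun_prop) (DifferentiableOn.add (DifferentiableOn.mul
      (by fun_prop) (hu.comp hxΩ hxU)) (hw.comp hxΩ hxU))
  have hstar1 : StarSlices 1 Ω := by simpa using starSlices_segmentNhd (p₀ := p₀) hη h1mem
  have hstarn1 : StarSlices (-1) Ω := by simpa using starSlices_segmentNhd (p₀ := p₀) hη hn1mem
  -- Two successive divisions: `k` vanishes at Y = 1, and its quotient `q₁` vanishes at Y = -1. Thus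
  -- k = (Y - 1)(Y + 1) q₂, and the required factor is -q₂.
  set q₁ := segmentAverage 1 (fun z => fderiv ℂ k z (1, 0)) with hq₁_def
  have hdk := hk.fderiv_apply_complex hΩ (1, 0)
  have hq₁ : DifferentiableOn ℂ q₁ Ω := differentiableOn_segmentAverage hΩ hstar1 hdk
  have hdq₁ := hq₁.fderiv_apply_complex hΩ (1, 0)
  set q₂ := segmentAverage (-1) (fun z => fderiv ℂ q₁ z (1, 0)) with hq₂_def
  have hq₂ : DifferentiableOn ℂ q₂ Ω := differentiableOn_segmentAverage hΩ hstarn1 hdq₁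
  have hk1 : ∀ p ∈ ball p₀ η, k (1, p) = 0 := fun p hp => by
    have h := (hθU p (ball_subset_ball (min_le_right _ _) (hball hp))).2
    simp only [hk_def, mul_one, show m p + d p = θ p by simp only [hm_def, hd_def]; ring, h, sub_self]
  have hkn1 : ∀ p ∈ ball p₀ η, k (-1, p) = 0 := fun p hp => by
    have h := (hρU p (ball_subset_ball (min_le_left _ _) (hball hp))).2
    simp only [hk_def, show m p + d p * -1 = ρ p by simp only [hm_def, hd_def]; ring, h, sub_self]
  have hkq₁ : ∀ z ∈ Ω, k z = (z.1 - 1) * q₁ z := fun z hz =>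
    eq_sub_mul_segmentAverage hΩ hstar1 hk (fun _ _ => rfl) hdk.continuousOn hz (hk1 _ hz.2)
  have hq₁n1 : ∀ p ∈ ball p₀ η, q₁ (-1, p) = 0 := fun p hp => by
    have := hkq₁ (-1, p) (by simpa using hmemseg (-1) hn1mem p hp)
    rw [hkn1 p hp] at this
    rcases mul_eq_zero.1 this.symm with h | h
    · norm_num at h
    · exact h
  have hq₁q₂ : ∀ z ∈ Ω, q₁ z = (z.1 + 1) * q₂ z := fun z hz => by
    have := eq_sub_mul_segmentAverage hΩ hstarn1 hq₁ (fun _ _ => rfl) hdq₁.continuousOn hz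
      (hq₁n1 _ hz.2)
    rw [this, primitiveFst, sub_neg_eq_add]
  have hkq : ∀ z ∈ Ω, k z = (1 - z.1 ^ 2) * -q₂ z := fun z hz => by
    rw [hkq₁ z hz, hq₁q₂ z hz]; ring
  have hmr : ∀ E G : ℝ, ((E : ℂ), (G : ℂ)) ∈ ball p₀ η →
      (m (E, G)).im = 0 ∧ (d (E, G)).im = 0 := fun E G hp => by
    have h1 := hθr E G (ball_subset_ball (min_le_right _ _) (hball hp))
    have h2 := hρr E G (ball_subset_ball (min_le_left _ _) (hball hp))
    constructor
    · simp [hm_def, h1, h2]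
    · simp [hd_def, h1, h2]
  have hkr : ∀ E G : ℝ, ∀ Y : ℝ, ((Y : ℂ), (E : ℂ), (G : ℂ)) ∈ Ω → (k (Y, E, G)).im = 0 := by
    intro E G Y hz
    obtain ⟨h1, h2⟩ := hmr E G hz.2
    have hre : m (E, G) + d (E, G) * Y =
        (((m (E, G)).re + (d (E, G)).re * Y : ℝ) : ℂ) := by
      apply Complex.ext <;> simp [h1, h2]
    have hU' := hxU _ hz
    simp only at hU'
    rw [hre] at hU'
    have h3 := hur _ hU'
    have h4 := hwr _ hU'
    simp only [hk_def]
    rw [hre]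
    push_cast at h3 h4
    simp [h3, h4, ← Complex.ofReal_pow]
  have hseg : ∀ E G Y c : ℝ, ((Y : ℂ), (E : ℂ), (G : ℂ)) ∈ Ω → StarSlices (c : ℂ) Ω →
      ∀ τ ∈ Icc (0 : ℝ) 1, (((c + τ * (Y - c) : ℝ) : ℂ), (E : ℂ), (G : ℂ)) ∈ Ω := by
    intro E G Y c hz hs τ hτ
    have := hs _ hz τ hτ
    push_cast
    exact this
  have hq₁r : ∀ E G : ℝ, ∀ Y : ℝ, ((Y : ℂ), (E : ℂ), (G : ℂ)) ∈ Ω → (q₁ (Y, E, G)).im = 0 := by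
    intro E G Y hz
    have := segmentAverage_im (g := fun z => fderiv ℂ k z (1, 0)) (c := 1) (s := Y)
      (p := ((E : ℂ), (G : ℂ))) fun τ hτ => fderiv_fst_im hΩ hk (hkr E G)
        (hseg E G Y 1 hz (by simpa using hstar1) τ hτ)
    simpa using this
  have hq₂r : ∀ E G : ℝ, ∀ Y : ℝ, ((Y : ℂ), (E : ℂ), (G : ℂ)) ∈ Ω → (q₂ (Y, E, G)).im = 0 := by
    intro E G Y hz
    have := segmentAverage_im (g := fun z => fderiv ℂ q₁ z (1, 0)) (c := -1) (s := Y)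
      (p := ((E : ℂ), (G : ℂ))) fun τ hτ => fderiv_fst_im hΩ hq₁ (hq₁r E G)
        (hseg E G Y (-1) hz (by simpa using hstarn1) τ hτ)
    simpa using this
  have hp₀η : p₀ ∈ ball p₀ η := mem_ball_self hη
  refine ⟨η, hη, m, d, fun z => -q₂ z, hm.mono hball, hd.mono hball, hq₂.neg, hmr, ?_,
    fun z hz => ⟨hxU z hz, hkq z hz⟩, ?_, ?_⟩
  · intro Y E G hz
    simp [hq₂r E G Y hz]
  · simp only [hd_def, hθ₀, hρ₀]
    rw [← Complex.ofReal_sub, show ((b - a : ℝ) : ℂ) / 2 = (((b - a) / 2 : ℝ) : ℂ) by push_cast; rfl,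
      Complex.ofReal_re]
    linarith
  -- At the base parameters both k and 1 - Y² are positive inside; continuity gives q ≥ 0 at the
  -- ends, and only q ≠ 0 there is left.
  · have hcont : ContinuousOn (fun Y : ℝ => (-q₂ (Y, p₀)).re) (Icc (-1) 1) :=
      Complex.continuous_re.comp_continuousOn (hq₂.neg.continuousOn.comp
        (f := fun Y : ℝ => ((Y : ℂ), p₀)) (by fun_prop) fun Y hY => hmemseg Y hY _ hp₀η)
    have hint : ∀ Y ∈ Ioo (-1 : ℝ) 1, 0 < (-q₂ (Y, p₀)).re := by
      intro Y hY
      have hz := hmemseg Y (Ioo_subset_Icc_self hY) _ hp₀η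
      have h1 := hkq _ hz
      have h2 : 0 < (k (Y, p₀)).re := by
        simp only [hk_def]
        rw [hmd0]
        have := hin ((b + a) / 2 + (b - a) / 2 * Y)
          ⟨by nlinarith [hY.1, hY.2], by nlinarith [hY.1, hY.2]⟩
        simp only [hp₀, Complex.sub_re, Complex.ofReal_re]
        linarith
      rw [h1] at h2
      simp only [← Complex.ofReal_pow, ← Complex.ofReal_one, ← Complex.ofReal_sub] at h2
      rw [Complex.re_ofReal_mul] at h2
      exact pos_of_mul_pos_right h2 (by nlinarith [hY.1, hY.2])
    have hnonneg : ∀ Y ∈ Icc (-1 : ℝ) 1, 0 ≤ (-q₂ (Y, p₀)).re := by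
      have hcl : closure (Ioo (-1 : ℝ) 1) = Icc (-1) 1 := closure_Ioo (by norm_num)
      rw [← hcl] at hcont ⊢
      intro Y hY
      exact ContinuousWithinAt.closure_le (f := fun _ => (0 : ℝ))
        (g := fun Y : ℝ => (-q₂ (Y, p₀)).re) hY continuousWithinAt_const
        ((hcont Y hY).mono subset_closure) fun Y hY => (hint Y hY).le
    -- If q vanished at an end, `k` would have a double zero there and the potential a critical
    -- turning point.
    have hend : ∀ e : ℝ, e = 1 ∨ e = -1 → q₂ (e, p₀) ≠ 0 := by
      intro e he h0
      have hez : ((e : ℂ), p₀) ∈ Ω := hmemseg e (by rcases he with rfl | rfl <;> norm_num) _ hp₀η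
      have h1 : HasDerivAt (fun Y : ℂ => (1 - Y ^ 2) * -q₂ (Y, p₀)) 0 e := by
        have h := ((((hasDerivAt_id (e : ℂ)).pow 2).const_sub 1).mul
          (hasDerivAt_slice hΩ hq₂ hez).neg)
        refine h.congr_deriv ?_
        rcases he with rfl | rfl <;> simp <;> simpa using h0
      have h2 : HasDerivAt (fun Y : ℂ => k (Y, p₀)) 0 e := by
        refine h1.congr_of_eventuallyEq ?_
        have : ∀ᶠ Y : ℂ in 𝓝 (e : ℂ), (Y, p₀) ∈ Ω :=
          (show Continuous fun Y : ℂ => (Y, p₀) by fun_prop).continuousAt.eventually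
            (hΩ.mem_nhds hez)
        filter_upwards [this] with Y hY using hkq _ hY
      have hx' : HasDerivAt (fun Y : ℂ => m p₀ + d p₀ * Y) (d p₀) e := by
        simpa using ((hasDerivAt_id (e : ℂ)).const_mul (d p₀)).const_add (m p₀)
      have hUe := hxU _ hez
      simp only at hUe
      have h3 := (((hu.differentiableAt (hU.mem_nhds hUe)).hasDerivAt.comp (e : ℂ) hx').const_mul
        ((G₀ : ℂ) ^ 2)).add ((hw.differentiableAt (hU.mem_nhds hUe)).hasDerivAt.comp (e : ℂ) hx')
      have h4 := (h3.const_sub (E₀ : ℂ)).unique h2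
      have hd0 : d p₀ ≠ 0 := by
        simp only [hd_def, hθ₀, hρ₀, ← Complex.ofReal_sub]
        have : (b - a : ℝ) ≠ 0 := by linarith
        exact div_ne_zero (by exact_mod_cast this) two_ne_zero
      have h5 : (G₀ : ℂ) ^ 2 * deriv u (m p₀ + d p₀ * e) + deriv w (m p₀ + d p₀ * e) = 0 := by
        apply mul_right_cancel₀ hd0
        linear_combination -h4
      rw [hmd0] at h5
      rcases he with rfl | rfl
      · rw [show (b + a) / 2 + (b - a) / 2 * 1 = b by ring] at h5
        exact hdb h5
      · rw [show (b + a) / 2 + (b - a) / 2 * -1 = a by ring] at h5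
        exact hda h5
    intro Y hY
    refine lt_of_le_of_ne (hnonneg Y hY) fun h => ?_
    rcases eq_or_lt_of_le hY.1 with h1 | h1
    · refine hend Y (Or.inr h1.symm) (Complex.ext ?_ (hq₂r E₀ G₀ Y (hmemseg Y hY _ hp₀η)))
      simpa using h.symm
    rcases eq_or_lt_of_le hY.2 with h2 | h2
    · refine hend Y (Or.inl h2) (Complex.ext ?_ (hq₂r E₀ G₀ Y (hmemseg Y hY _ hp₀η)))
      simpa using h.symm
    · exact (hint Y ⟨h1, h2⟩).ne h

/-- A uniform width exists by compactness of one period; periodicity of `O` carries it to the whole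
strip. -/
theorem exists_strip_subset {p₀ : ℂ × ℂ} {O : Set (ℂ × ℂ × ℂ)} (hO : IsOpen O)
    (hper : ∀ (s : ℂ) (p : ℂ × ℂ), (s + 2 * Real.pi, p) ∈ O ↔ (s, p) ∈ O)
    (h : ∀ x : ℝ, ((x : ℂ), p₀) ∈ O) :
    ∃ ε > 0, strip ε p₀ ⊆ O := by
  have hK : IsCompact (((fun x : ℝ => (x : ℂ)) '' Icc 0 (2 * Real.pi)) ×ˢ
      ({p₀} : Set (ℂ × ℂ))) :=
    (isCompact_Icc.image Complex.continuous_ofReal).prod isCompact_singleton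
  obtain ⟨ε, hε, hsub⟩ := hK.exists_thickening_subset_open hO (by
    rintro ⟨_, _⟩ ⟨⟨x, hx, rfl⟩, rfl⟩
    exact h x)
  refine ⟨ε, hε, ?_⟩
  rintro ⟨s, p⟩ ⟨hs, hp⟩
  have hperz : ∀ (n : ℤ) s p, (s + n • (2 * Real.pi : ℂ), p) ∈ O ↔ (s, p) ∈ O := by
    intro n
    induction n with
    | zero => simp
    | succ n ih =>
      intro s p
      rw [add_smul, one_smul, ← add_assoc, hper, ih]
    | pred n ih =>
      intro s p
      rw [← hper, sub_smul, one_smul, ← ih s p]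
      ring_nf
  obtain ⟨n, hn⟩ : ∃ n : ℤ, s.re + n • (2 * Real.pi) ∈ Ico 0 (0 + 2 * Real.pi) :=
    ⟨-toIcoDiv Real.two_pi_pos 0 s.re, by
      have := sub_toIcoDiv_zsmul_mem_Ico Real.two_pi_pos 0 s.re
      rwa [sub_eq_add_neg, ← neg_smul] at this⟩
  rw [← hperz n]
  apply hsub
  refine mem_thickening_iff.2 ⟨(((s.re + n • (2 * Real.pi) : ℝ) : ℂ), p₀),
    ⟨⟨_, ⟨hn.1, by simpa using hn.2.le⟩, rfl⟩, rfl⟩, ?_⟩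
  rw [Prod.dist_eq]
  refine max_lt ?_ hp
  rw [Complex.dist_eq]
  have : s + n • (2 * Real.pi : ℂ) - ((s.re + n • (2 * Real.pi) : ℝ) : ℂ) = s.im * Complex.I := by
    push_cast
    simp only [zsmul_eq_mul, add_sub_add_right_eq_sub]
    linear_combination -Complex.re_add_im s
  rw [this]
  simpa using hs

/-- A potential well with non-critical end points carries a holomorphic family of closed orbits. -/
theorem exists_orbitFamily (hU : IsOpen U) (hu : DifferentiableOn ℂ u U)
    (hw : DifferentiableOn ℂ w U) (hur : ∀ x : ℝ, (x : ℂ) ∈ U → (u x).im = 0)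
    (hwr : ∀ x : ℝ, (x : ℂ) ∈ U → (w x).im = 0) {E₀ G₀ a b : ℝ} (hab : a < b)
    (hsub : ∀ x ∈ Icc a b, (x : ℂ) ∈ U)
    (ha : (G₀ : ℂ) ^ 2 * u a + w a = E₀) (hb : (G₀ : ℂ) ^ 2 * u b + w b = E₀)
    (hin : ∀ x ∈ Ioo a b, ((G₀ : ℂ) ^ 2 * u x + w x).re < E₀)
    (hda : (G₀ : ℂ) ^ 2 * deriv u a + deriv w a ≠ 0)
    (hdb : (G₀ : ℂ) ^ 2 * deriv u b + deriv w b ≠ 0) :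
    Nonempty (OrbitFamily U u w E₀ G₀) := by
  obtain ⟨η, hη, m, d, q, hm, hd, hq, hmdr, hqr, hfac, hdpos, hqpos⟩ :=
    exists_factorization hU hu hw hur hwr hab hsub ha hb hin hda hdb
  set p₀ : ℂ × ℂ := ((E₀ : ℂ), (G₀ : ℂ)) with hp₀
  set Ω := segmentNhd η p₀ with hΩ_def
  have hΩ : IsOpen Ω := isOpen_segmentNhd η p₀
  set c : ℂ × ℂ × ℂ → ℂ × ℂ × ℂ := fun z => (Complex.cos z.1, z.2) with hc_def
  have hc : Differentiable ℂ c := by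
    simp only [hc_def]
    exact (Complex.differentiable_cos.comp differentiable_fst).prodMk differentiable_snd
  set O : Set (ℂ × ℂ × ℂ) := c ⁻¹' (Ω ∩ (fun z => ((q z).re, (d z.2).re)) ⁻¹' (Ioi 0 ×ˢ Ioi 0))
    with hO_def
  have hdΩ : DifferentiableOn ℂ (fun z : ℂ × ℂ × ℂ => d z.2) Ω :=
    hd.comp differentiableOn_snd fun z hz => hz.2
  have hO : IsOpen O := by
    refine IsOpen.preimage hc.continuous (ContinuousOn.isOpen_inter_preimage ?_ hΩ
      (isOpen_Ioi.prod isOpen_Ioi))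
    exact (Complex.continuous_re.comp_continuousOn hq.continuousOn).prodMk
      (Complex.continuous_re.comp_continuousOn hdΩ.continuousOn)
  obtain ⟨ε, hε, hεO⟩ := exists_strip_subset (p₀ := p₀) hO
    (fun s p => by simp only [hO_def, mem_preimage, hc_def, Complex.cos_add_two_pi])
    (fun x => by
      have hx : Real.cos x ∈ Icc (-1 : ℝ) 1 := ⟨Real.neg_one_le_cos x, Real.cos_le_one x⟩
      refine ⟨⟨self_subset_thickening hη _ ⟨Real.cos x, hx, ?_⟩, mem_ball_self hη⟩, ?_, hdpos⟩
      · exact Complex.ofReal_cos x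
      · have := hqpos _ hx
        rw [Complex.ofReal_cos] at this
        exact this)
  have hopen := isOpen_strip ε p₀
  have hcΩ : ∀ z ∈ strip ε p₀, c z ∈ Ω := fun z hz => (hεO hz).1
  have hqp : ∀ z ∈ strip ε p₀, 0 < (q (c z)).re := fun z hz => (hεO hz).2.1
  have hdp : ∀ z ∈ strip ε p₀, 0 < (d z.2).re := fun z hz => (hεO hz).2.2
  have hd0 : ∀ z ∈ strip ε p₀, d z.2 ≠ 0 := fun z hz h => by
    have := hdp z hz
    simp [h] at this
  have hq0 : ∀ z ∈ strip ε p₀, q (c z) ≠ 0 := fun z hz h => by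
    have := hqp z hz
    simp [h] at this
  have hslit : ∀ z ∈ strip ε p₀, 2 * q (c z) ∈ Complex.slitPlane := fun z hz => by
    left
    have := hqp z hz
    simpa using this
  -- A holomorphic branch of √(2q), available because Re q > 0 on the strip.
  set sq : ℂ × ℂ × ℂ → ℂ := fun z => Complex.exp (Complex.log (2 * q (c z)) / 2) with hsq_def
  have hsq0 : ∀ z, sq z ≠ 0 := fun z => Complex.exp_ne_zero _
  have hsq2 : ∀ z ∈ strip ε p₀, sq z ^ 2 = 2 * q (c z) := fun z hz => by
    simp only [hsq_def, ← Complex.exp_nat_mul]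
    rw [show ((2 : ℕ) : ℂ) * (Complex.log (2 * q (c z)) / 2) = Complex.log (2 * q (c z)) by
      push_cast; ring, Complex.exp_log (mul_ne_zero two_ne_zero (hq0 z hz))]
  have hqc : DifferentiableOn ℂ (fun z => q (c z)) (strip ε p₀) :=
    hq.comp hc.differentiableOn hcΩ
  have hsqd : DifferentiableOn ℂ sq (strip ε p₀) := by
    have h1 : DifferentiableOn ℂ (fun z => Complex.log (2 * q (c z))) (strip ε p₀) :=
      (hqc.const_mul 2).clog hslit
    exact (h1.mul_const ((2 : ℂ)⁻¹)).cexp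
  have hdd : DifferentiableOn ℂ (fun z : ℂ × ℂ × ℂ => d z.2) (strip ε p₀) :=
    hd.comp differentiableOn_snd fun z hz => (hcΩ z hz).2
  have hmm : DifferentiableOn ℂ (fun z : ℂ × ℂ × ℂ => m z.2) (strip ε p₀) :=
    hm.comp differentiableOn_snd fun z hz => (hcΩ z hz).2
  have hcos : DifferentiableOn ℂ (fun z : ℂ × ℂ × ℂ => Complex.cos z.1) (strip ε p₀) :=
    (Complex.differentiable_cos.comp differentiable_fst).differentiableOn
  have hsin : DifferentiableOn ℂ (fun z : ℂ × ℂ × ℂ => Complex.sin z.1) (strip ε p₀) :=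
    (Complex.differentiable_sin.comp differentiable_fst).differentiableOn
  -- With Y = cos s the factorization reads R²/2 = sin² s · q, so R is a single-valued function of
  -- s. The rate κ = d/√(2q) is forced by dX/ds = -d sin s = κR.
  set X : ℂ × ℂ × ℂ → ℂ := fun z => m z.2 + d z.2 * Complex.cos z.1 with hX_def
  set R : ℂ × ℂ × ℂ → ℂ := fun z => -(sq z * Complex.sin z.1) with hR_def
  set κ : ℂ × ℂ × ℂ → ℂ := fun z => d z.2 / sq z with hκ_def
  have hX : DifferentiableOn ℂ X (strip ε p₀) := hmm.add (hdd.mul hcos)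
  have hR : DifferentiableOn ℂ R (strip ε p₀) := (hsqd.mul hsin).neg
  have hκ : DifferentiableOn ℂ κ (strip ε p₀) :=
    hdd.mul (hsqd.inv fun z _ => hsq0 z)
  have hsqr : ∀ s E G : ℝ, ((E : ℂ), (G : ℂ)) ∈ ball p₀ ε →
      ∃ y : ℝ, 0 < y ∧ sq (s, E, G) = y := by
    intro s E G hp
    have hz := ofReal_mem_strip s hp
    have him : (q (c (s, E, G))).im = 0 := by
      have := hqr (Real.cos s) E G (by rw [Complex.ofReal_cos]; exact hcΩ (s, E, G) hz)
      rw [Complex.ofReal_cos] at this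
      exact this
    refine ⟨Real.exp (Real.log (2 * (q (c (s, E, G))).re) / 2), Real.exp_pos _, ?_⟩
    have hre : 2 * q (c (s, E, G)) = ((2 * (q (c (s, E, G))).re : ℝ) : ℂ) := by
      apply Complex.ext <;> simp [him]
    have hpos : 0 ≤ 2 * (q (c (s, E, G))).re := mul_nonneg zero_le_two (hqp (s, E, G) hz).le
    change Complex.exp (Complex.log (2 * q (c (s, E, G))) / 2) = _
    rw [hre, ← Complex.ofReal_log hpos, Complex.ofReal_exp, Complex.ofReal_div,
      Complex.ofReal_ofNat]
  have hdr : ∀ s E G : ℝ, ((E : ℂ), (G : ℂ)) ∈ ball p₀ ε →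
      ∃ y : ℝ, 0 < y ∧ d (E, G) = y := by
    intro s E G hp
    have hz := ofReal_mem_strip s hp
    refine ⟨(d (E, G)).re, hdp (s, E, G) hz, ?_⟩
    have := (hmdr E G (hcΩ (s, E, G) hz).2).2
    apply Complex.ext <;> simp [this]
  have hmr : ∀ s E G : ℝ, ((E : ℂ), (G : ℂ)) ∈ ball p₀ ε → (m (E, G)).im = 0 :=
    fun s E G hp => (hmdr E G (hcΩ (s, E, G) (ofReal_mem_strip s hp)).2).1
  refine ⟨⟨ε, X, R, κ, hε, hX, hR, hκ, ?_, ?_, ?_, ?_, ?_, ?_, ?_, ?_, ?_, ?_, ?_, ?_, ?_, ?_, ?_,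
    ?_⟩⟩
  · intro s E G hp
    obtain ⟨y, -, hy⟩ := hdr s E G hp
    simp only [hX_def, hy, ← Complex.ofReal_cos]
    simp [hmr s E G hp]
  · intro s E G hp
    obtain ⟨y, -, hy⟩ := hsqr s E G hp
    simp only [hR_def, hy, ← Complex.ofReal_sin]
    simp
  · intro s E G hp
    obtain ⟨y, -, hy⟩ := hsqr s E G hp
    obtain ⟨y', -, hy'⟩ := hdr s E G hp
    simp only [hκ_def, hy, hy', ← Complex.ofReal_div, Complex.ofReal_im]
  · intro s E G hp
    obtain ⟨y, hy0, hy⟩ := hsqr s E G hp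
    obtain ⟨y', hy0', hy'⟩ := hdr s E G hp
    simp only [hκ_def, hy, hy', ← Complex.ofReal_div, Complex.ofReal_re]
    positivity
  · intro s E G hp hs
    obtain ⟨y, hy0, hy⟩ := hsqr s E G hp
    simp only [hR_def, hy, ← Complex.ofReal_sin, ← Complex.ofReal_mul, ← Complex.ofReal_neg,
      Complex.ofReal_re]
    have := Real.sin_pos_of_mem_Ioo hs
    nlinarith
  · intro z hz
    exact (hfac _ (hcΩ z hz)).1
  · intro z hz
    have h := (hfac _ (hcΩ z hz)).2
    have h2 := hsq2 z hz
    simp only [hc_def] at h h2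
    have h3 := Complex.sin_sq_add_cos_sq z.1
    simp only [hR_def, hX_def]
    linear_combination (Complex.sin z.1 ^ 2 / 2) * h2 - h + q (Complex.cos z.1, z.2) * h3
  · rintro ⟨s, p⟩ hz
    have h : HasDerivAt (fun s => X (s, p)) (d p * -Complex.sin s) s :=
      ((Complex.hasDerivAt_cos s).const_mul (d p)).const_add (m p)
    rw [fderiv_fst_eq hopen hX hz h]
    have := hsq0 (s, p)
    simp only [hκ_def, hR_def]
    field_simp
  · rintro ⟨s, p⟩ hz
    have hz' : (Complex.cos s, p) ∈ Ω := hcΩ (s, p) hz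
    set qY := fderiv ℂ q (Complex.cos s, p) (1, 0)
    have hqY : HasDerivAt (fun Y => q (Y, p)) qY (Complex.cos s) := hasDerivAt_slice hΩ hq hz'
    have hqs : HasDerivAt (fun s => 2 * q (c (s, p))) (2 * (qY * -Complex.sin s)) s :=
      (hqY.comp s (Complex.hasDerivAt_cos s)).const_mul 2
    have hsqs : HasDerivAt (fun s => sq (s, p))
        (sq (s, p) * (2 * (qY * -Complex.sin s) / (2 * q (c (s, p))) / 2)) s :=
      ((hqs.clog (hslit (s, p) hz)).div_const 2).cexp
    have hRs : HasDerivAt (fun s => R (s, p)) _ s := (hsqs.mul (Complex.hasDerivAt_sin s)).neg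
    rw [fderiv_fst_eq hopen hR hz hRs]
    -- Differentiating the factorization in Y in two ways expresses the force through q and its
    -- derivative, which is what the equation for dR/ds needs.
    have hk1 : HasDerivAt (fun Y : ℂ => (1 - Y ^ 2) * q (Y, p))
        (-(2 * Complex.cos s) * q (Complex.cos s, p) + (1 - Complex.cos s ^ 2) * qY)
        (Complex.cos s) := by
      have := (((hasDerivAt_id (Complex.cos s)).pow 2).const_sub 1).mul hqY
      refine this.congr_deriv ?_
      simp
    have hXU := (hfac _ hz').1
    have hx' : HasDerivAt (fun Y : ℂ => m p + d p * Y) (d p) (Complex.cos s) := by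
      simpa using ((hasDerivAt_id (Complex.cos s)).const_mul (d p)).const_add (m p)
    have hk2 := (((hu.differentiableAt (hU.mem_nhds hXU)).hasDerivAt.comp (Complex.cos s)
      hx').const_mul (p.2 ^ 2)).add
      ((hw.differentiableAt (hU.mem_nhds hXU)).hasDerivAt.comp (Complex.cos s) hx')
    have hk3 := (hk2.const_sub p.1).congr_of_eventuallyEq
      (f₁ := fun Y : ℂ => (1 - Y ^ 2) * q (Y, p)) (by
        have : ∀ᶠ Y : ℂ in 𝓝 (Complex.cos s), (Y, p) ∈ Ω :=
          (show Continuous fun Y : ℂ => (Y, p) by fun_prop).continuousAt.eventually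
            (hΩ.mem_nhds hz')
        filter_upwards [this] with Y hY
        exact (hfac _ hY).2.symm)
    have hk := hk1.unique hk3
    have hs0 := hsq0 (s, p)
    have hq0' := hq0 (s, p) hz
    have hs2 := hsq2 (s, p) hz
    have htrig := Complex.sin_sq_add_cos_sq s
    simp only [hκ_def, hX_def, hc_def] at hq0' hs2 ⊢
    simp only at hk
    set A := p.2 ^ 2 * deriv u (m p + d p * Complex.cos s) + deriv w (m p + d p * Complex.cos s)
      with hA
    have hk' : -(2 * Complex.cos s) * q (Complex.cos s, p) + (1 - Complex.cos s ^ 2) * qY =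
        -(d p * A) := by rw [hk, hA]; ring
    generalize sq (s, p) = σ at *
    generalize q (Complex.cos s, p) = Q at *
    field_simp
    rw [hs2]
    linear_combination (2 * Q) * hk' + 2 * Q * qY * htrig
  · intro s p
    simp only [hX_def, Complex.cos_add_two_pi]
  · intro s p
    simp only [hR_def, hsq_def, hc_def, Complex.cos_add_two_pi, Complex.sin_add_two_pi]
  · intro s p
    simp only [hκ_def, hsq_def, hc_def, Complex.cos_add_two_pi]
  · intro s p
    simp only [hX_def, Complex.cos_neg]
  · intro s p
    simp only [hR_def, hsq_def, hc_def, Complex.cos_neg, Complex.sin_neg]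
    ring
  · intro s p
    simp only [hκ_def, hsq_def, hc_def, Complex.cos_neg]
  -- Equal X gives equal cosines since d ≠ 0. The square root depends on s only through cos s, so
  -- equal R then gives equal sines, and e^{is} determines s modulo 2π.
  · intro s s' p hz hz' hXX hRR
    have hcc : Complex.cos s = Complex.cos s' := by
      simp only [hX_def] at hXX
      exact mul_left_cancel₀ (hd0 _ hz) (add_left_cancel hXX)
    have hss : Complex.sin s = Complex.sin s' := by
      simp only [hR_def, hsq_def, hc_def, hcc, neg_inj] at hRR
      exact mul_left_cancel₀ (Complex.exp_ne_zero _) hRR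
    have hexp : Complex.exp (s * Complex.I) = Complex.exp (s' * Complex.I) := by
      rw [Complex.exp_mul_I, Complex.exp_mul_I, hcc, hss]
    obtain ⟨n, hn⟩ := Complex.exp_eq_exp_iff_exists_int.1 hexp
    refine ⟨n, mul_right_cancel₀ Complex.I_ne_zero ?_⟩
    rw [hn]; ring

end OrbitConstruction

/-! ### Complex phase space and the symplectic chart of an angle-action pair. -/

section Charts

open Metric Set Filter Topology ComplexConjugate

variable {N : ℕ}

/-- Translation of the angles by the period vector `2π k`. -/
def translateAngles (k : Fin N → ℤ) (z : CPhase N) : CPhase N :=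
  (z.1 + WithLp.toLp 2 fun j => 2 * (Real.pi : ℂ) * (k j : ℂ), z.2)

/-- Complex conjugation of all coordinates. -/
def conjPhase (z : CPhase N) : CPhase N :=
  (WithLp.toLp 2 fun j => conj (z.1 j), WithLp.toLp 2 fun j => conj (z.2 j))

/-- The real part of a point of complex phase space. -/
def rePhase (z : CPhase N) : Phase N :=
  (WithLp.toLp 2 fun j => (z.1 j).re, WithLp.toLp 2 fun j => (z.2 j).re)

/-- The imaginary part of a point of complex phase space. -/
def imPhase (z : CPhase N) : Phase N :=
  (WithLp.toLp 2 fun j => (z.1 j).im, WithLp.toLp 2 fun j => (z.2 j).im)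

theorem cphase_ext {z z' : CPhase N} (h1 : ∀ j, z.1 j = z'.1 j) (h2 : ∀ j, z.2 j = z'.2 j) :
    z = z' := by
  refine Prod.ext ?_ ?_ <;> ext j
  exacts [h1 j, h2 j]

theorem complexifyPhase_injective : Function.Injective (complexifyPhase (N := N)) := by
  intro z z' h
  refine Prod.ext ?_ ?_ <;> ext j
  · have := congrArg (fun y : CPhase N => y.1 j) h
    simpa [complexifyPhase] using this
  · have := congrArg (fun y : CPhase N => y.2 j) h
    simpa [complexifyPhase] using this

@[simp]
theorem rePhase_complexifyPhase (z : Phase N) : rePhase (complexifyPhase z) = z := by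
  refine Prod.ext ?_ ?_ <;> ext j <;> simp [rePhase, complexifyPhase]

theorem complexifyPhase_rePhase {z : CPhase N} (h : conjPhase z = z) :
    complexifyPhase (rePhase z) = z := by
  refine cphase_ext (fun j => ?_) fun j => ?_
  · have := congrArg (fun y : CPhase N => y.1 j) h
    simpa [complexifyPhase, rePhase] using Complex.conj_eq_iff_re.1 this
  · have := congrArg (fun y : CPhase N => y.2 j) h
    simpa [complexifyPhase, rePhase] using Complex.conj_eq_iff_re.1 this

theorem norm_complexify (x : EuclideanSpace ℝ (Fin N)) :
    ‖(WithLp.toLp 2 fun j => (x j : ℂ) : EuclideanSpace ℂ (Fin N))‖ = ‖x‖ := by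
  simp [EuclideanSpace.norm_eq]

theorem complexifyPhase_mem_torusBall {σ ρ : ℝ} (hσ : 0 < σ) {z : Phase N} (hz : ‖z.2‖ < ρ) :
    complexifyPhase z ∈ torusBall N σ ρ :=
  ⟨fun j => by simpa [complexifyPhase] using hσ, by
    simpa only [complexifyPhase, norm_complexify] using hz⟩

theorem isOpen_torusBall (σ ρ : ℝ) : IsOpen (torusBall N σ ρ) := by
  have : torusBall N σ ρ = (⋂ j, {z : CPhase N | |(z.1 j).im| < σ}) ∩ {z | ‖z.2‖ < ρ} := by
    ext z; simp [torusBall]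
  rw [this]
  refine (isOpen_iInter_of_finite fun j => ?_).inter (isOpen_lt (by fun_prop) continuous_const)
  exact isOpen_lt (by fun_prop) continuous_const

theorem convex_torusBall (σ ρ : ℝ) : Convex ℝ (torusBall N σ ρ) := by
  intro z hz z' hz' a b ha hb hab
  refine ⟨fun j => ?_, ?_⟩
  · have h := convex_strip_slice σ (hz.1 j) (hz'.1 j) ha hb hab
    simpa using h
  · have h := convex_ball (0 : EuclideanSpace ℂ (Fin N)) ρ (x := z.2) (by simpa using hz.2)
      (y := z'.2) (by simpa using hz'.2) ha hb hab
    simpa using h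

theorem translateAngles_mem_torusBall {σ ρ : ℝ} {z : CPhase N} (hz : z ∈ torusBall N σ ρ)
    (k : Fin N → ℤ) : translateAngles k z ∈ torusBall N σ ρ :=
  ⟨fun j => by simpa [translateAngles] using hz.1 j, hz.2⟩

theorem translateAngles_neg (k : Fin N → ℤ) (z : CPhase N) :
    translateAngles (-k) (translateAngles k z) = z :=
  cphase_ext (fun j => by simp [translateAngles]) fun j => rfl

theorem eq_translateAngles_iff {z z' : CPhase N} :
    (∃ k, z = translateAngles k z') ↔
      z.2 = z'.2 ∧ ∃ k : Fin N → ℤ, ∀ j, z.1 j = z'.1 j + 2 * (Real.pi : ℂ) * (k j : ℂ) := by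
  constructor
  · rintro ⟨k, rfl⟩
    exact ⟨rfl, k, fun j => by simp [translateAngles]⟩
  · rintro ⟨h, k, hk⟩
    exact ⟨k, cphase_ext (fun j => by simp [translateAngles, hk]) fun j => by rw [h]; rfl⟩

theorem conjPhase_mem_torusBall {σ ρ : ℝ} {z : CPhase N} (hz : z ∈ torusBall N σ ρ) :
    conjPhase z ∈ torusBall N σ ρ := by
  refine ⟨fun j => by simpa [conjPhase] using hz.1 j, ?_⟩
  have : ‖(conjPhase z).2‖ = ‖z.2‖ := by simp [EuclideanSpace.norm_eq, conjPhase]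
  rw [this]; exact hz.2

theorem norm_le_sum_norm (x : EuclideanSpace ℂ (Fin N)) : ‖x‖ ≤ ∑ j, ‖x j‖ := by
  have h := (EuclideanSpace.basisFun (Fin N) ℂ).sum_repr x
  conv_lhs => rw [← h]
  refine (norm_sum_le _ _).trans (Finset.sum_le_sum fun j _ => ?_)
  rw [norm_smul]
  simp

theorem exists_torusBall_subset {O : Set (CPhase N)} (hO : IsOpen O)
    (hper : ∀ k z, translateAngles k z ∈ O → z ∈ O)
    (h : ∀ φ : EuclideanSpace ℝ (Fin N), complexifyPhase (φ, 0) ∈ O) :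
    ∃ ρ > 0, ∃ σ > 0, torusBall N σ ρ ⊆ O := by
  have hcont : Continuous fun x : Fin N → ℝ =>
      (complexifyPhase (WithLp.toLp 2 x, 0) : CPhase N) := by
    exact Continuous.prodMk ((PiLp.continuous_toLp 2 _).comp (by fun_prop))
      ((PiLp.continuous_toLp 2 _).comp (by fun_prop))
  have hK := (isCompact_univ_pi fun _ : Fin N => isCompact_Icc (a := 0) (b := 2 * Real.pi)).image
    hcont
  obtain ⟨ε, hε, hsub⟩ := hK.exists_thickening_subset_open hO (by
    rintro _ ⟨x, -, rfl⟩
    exact h _)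
  -- The Euclidean norm of the imaginary parts is at most their sum, here at most Nε/(N + 1) < ε;
  -- the real parts have been reduced to one period.
  refine ⟨ε, hε, ε / (N + 1), by positivity, fun z hz => ?_⟩
  have hn : ∀ j, ∃ n : ℤ, (z.1 j).re + n • (2 * Real.pi) ∈ Ico 0 (0 + 2 * Real.pi) := fun j =>
    ⟨-toIcoDiv Real.two_pi_pos 0 (z.1 j).re, by
      have := sub_toIcoDiv_zsmul_mem_Ico Real.two_pi_pos 0 (z.1 j).re
      rwa [sub_eq_add_neg, ← neg_smul] at this⟩
  choose n hn using hn
  apply hper n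
  apply hsub
  refine mem_thickening_iff.2 ⟨_, ⟨fun j => (z.1 j).re + n j • (2 * Real.pi), fun j _ =>
    ⟨(hn j).1, by simpa using (hn j).2.le⟩, rfl⟩, ?_⟩
  rw [Prod.dist_eq]
  refine max_lt ?_ ?_
  · rw [dist_eq_norm]
    refine (norm_le_sum_norm _).trans_lt ?_
    have hj : ∀ j, ‖((translateAngles n z).1 - (complexifyPhase
        (WithLp.toLp 2 fun j => (z.1 j).re + n j • (2 * Real.pi), 0)).1) j‖ ≤ ε / (N + 1) := by
      intro j
      have : ((translateAngles n z).1 - (complexifyPhase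
        (WithLp.toLp 2 fun j => (z.1 j).re + n j • (2 * Real.pi), 0)).1) j =
          (z.1 j).im * Complex.I := by
        simp [translateAngles, complexifyPhase]
        linear_combination -Complex.re_add_im (z.1 j)
      rw [this]
      simpa using (hz.1 j).le
    refine (Finset.sum_le_sum fun j _ => hj j).trans_lt ?_
    rw [Finset.sum_const, Finset.card_univ, Fintype.card_fin, nsmul_eq_mul,
      mul_div_assoc', div_lt_iff₀ (by positivity)]
    nlinarith
  · have : (complexifyPhase (WithLp.toLp 2 fun j => (z.1 j).re + n j • (2 * Real.pi), 0)
        : CPhase N).2 = 0 := by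
      ext j; simp [complexifyPhase]
    rw [this, dist_zero_right]
    exact hz.2

/-- Holomorphic maps of phase space which are real on real points commute with conjugation. -/
theorem map_conjPhase {σ ρ : ℝ} {A : CPhase N → CPhase N}
    (hA : DifferentiableOn ℂ A (torusBall N σ ρ))
    (hreal : ∀ z : Phase N, ‖z.2‖ < ρ → ∃ z', A (complexifyPhase z) = complexifyPhase z')
    {z : CPhase N} (hz : z ∈ torusBall N σ ρ) : A (conjPhase z) = conjPhase (A z) := by
  -- The complex line Re z + t Im z passes through z at t = i and through its conjugate at t = -i,
  -- so one-variable reflection applies to each component.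
  set ℓ : ℂ → CPhase N := fun t => complexifyPhase (rePhase z) + t • complexifyPhase (imPhase z)
  have hℓI : ℓ Complex.I = z := cphase_ext
    (fun j => by
      simp only [ℓ, complexifyPhase, rePhase, imPhase, Prod.fst_add, Prod.smul_fst,
        PiLp.add_apply, PiLp.smul_apply, smul_eq_mul]
      rw [mul_comm]; exact Complex.re_add_im _)
    (fun j => by
      simp only [ℓ, complexifyPhase, rePhase, imPhase, Prod.snd_add, Prod.smul_snd,
        PiLp.add_apply, PiLp.smul_apply, smul_eq_mul]
      rw [mul_comm]; exact Complex.re_add_im _)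
  have hℓc : ∀ t, ℓ (conj t) = conjPhase (ℓ t) := fun t => cphase_ext
    (fun j => by simp [ℓ, conjPhase, complexifyPhase])
    (fun j => by simp [ℓ, conjPhase, complexifyPhase])
  have hℓI' : ℓ (-Complex.I) = conjPhase z := by rw [← Complex.conj_I, hℓc, hℓI]
  have hℓr : ∀ x : ℝ, ℓ x = complexifyPhase (rePhase z + x • imPhase z) := fun x => cphase_ext
    (fun j => by simp [ℓ, complexifyPhase])
    (fun j => by simp [ℓ, complexifyPhase])
  have hℓd : Differentiable ℂ ℓ := by fun_prop
  have hO : IsOpen (ℓ ⁻¹' torusBall N σ ρ) := (isOpen_torusBall σ ρ).preimage hℓd.continuous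
  have hconv : Convex ℝ (ℓ ⁻¹' torusBall N σ ρ) := by
    intro s hs t ht a b ha hb hab
    have : ℓ (a • s + b • t) = a • ℓ s + b • ℓ t := by
      have hab' : (a : ℂ) + b = 1 := by exact_mod_cast hab
      simp only [ℓ, smul_add, add_smul, smul_assoc]
      have h : complexifyPhase (rePhase z) =
          a • complexifyPhase (rePhase z) + b • complexifyPhase (rePhase z) := by
        rw [← add_smul, hab, one_smul]
      nth_rewrite 1 [h]
      abel
    rw [mem_preimage, this]
    exact convex_torusBall σ ρ hs ht ha hb hab
  have hcj : ∀ t ∈ ℓ ⁻¹' torusBall N σ ρ, conj t ∈ ℓ ⁻¹' torusBall N σ ρ := fun t ht => by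
    rw [mem_preimage, hℓc]
    exact conjPhase_mem_torusBall ht
  have hAℓ : DifferentiableOn ℂ (A ∘ ℓ) (ℓ ⁻¹' torusBall N σ ρ) :=
    hA.comp hℓd.differentiableOn fun t ht => ht
  have hrealℓ : ∀ x : ℝ, (x : ℂ) ∈ ℓ ⁻¹' torusBall N σ ρ → ∃ z', A (ℓ x) = complexifyPhase z' := by
    intro x hx
    rw [mem_preimage, hℓr] at hx
    rw [hℓr]
    exact hreal _ (by simpa only [complexifyPhase, norm_complexify] using hx.2)
  have hImem : Complex.I ∈ ℓ ⁻¹' torusBall N σ ρ := by rw [mem_preimage, hℓI]; exact hz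
  rw [← hℓI']
  conv_rhs => rw [← hℓI]
  refine cphase_ext (fun j => ?_) fun j => ?_
  · refine eq_conj_of_real_on_line (g := fun t => (A (ℓ t)).1 j) hO hconv hcj hImem ?_ ?_
    · exact (((EuclideanSpace.proj (𝕜 := ℂ) j).comp
        (ContinuousLinearMap.fst ℂ _ _)).differentiable.comp_differentiableOn hAℓ)
    · intro x hx
      obtain ⟨z', hz'⟩ := hrealℓ x hx
      simp only [hz', complexifyPhase, Complex.ofReal_im]
  · refine eq_conj_of_real_on_line (g := fun t => (A (ℓ t)).2 j) hO hconv hcj hImem ?_ ?_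
    · exact (((EuclideanSpace.proj (𝕜 := ℂ) j).comp
        (ContinuousLinearMap.snd ℂ _ _)).differentiable.comp_differentiableOn hAℓ)
    · intro x hx
      obtain ⟨z', hz'⟩ := hrealℓ x hx
      simp only [hz', complexifyPhase, Complex.ofReal_im]

/-- A pair of holomorphic maps `A` (to angle-action coordinates) and `B` (to phase space) of a
complex neighbourhood of a torus which pull back the symplectic form to the same form. -/
structure IsAngleActionPair (Ω T : Set (Phase N)) (ε : ℝ) (A B : CPhase N → CPhase N) : Prop where
  pos : 0 < ε
  diff_left : DifferentiableOn ℂ A (torusBall N ε ε)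
  diff_right : DifferentiableOn ℂ B (torusBall N ε ε)
  left_translate : ∀ z ∈ torusBall N ε ε, ∀ k, A (translateAngles k z) = translateAngles k (A z)
  right_translate : ∀ z ∈ torusBall N ε ε, ∀ k, B (translateAngles k z) = B z
  left_injOn : InjOn A (torusBall N ε ε)
  left_fderiv : ∀ z ∈ torusBall N ε ε, ∀ v, fderiv ℂ A z v = 0 → v = 0
  left_real : ∀ z : Phase N, ‖z.2‖ < ε → ∃ z', A (complexifyPhase z) = complexifyPhase z'
  right_real : ∀ z : Phase N, ‖z.2‖ < ε → ∃ z' ∈ Ω, B (complexifyPhase z) = complexifyPhase z'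
  left_surj : ∀ φ, ∃ θ, A (complexifyPhase (θ, 0)) = complexifyPhase (φ, 0)
  left_zero : ∀ θ, ∃ φ, A (complexifyPhase (θ, 0)) = complexifyPhase (φ, 0)
  torus : T = {z | ∃ θ, B (complexifyPhase (θ, 0)) = complexifyPhase z}
  right_inj : ∀ z ∈ torusBall N ε ε, ∀ z' ∈ torusBall N ε ε, B z = B z' →
    ∃ k, z = translateAngles k z'
  symplectic : ∀ z ∈ torusBall N ε ε, ∀ u v, symplForm (fderiv ℂ B z u) (fderiv ℂ B z v) =
    symplForm (fderiv ℂ A z u) (fderiv ℂ A z v)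

/-- The symplectic chart `B ∘ A⁻¹` of an angle-action pair. -/
theorem IsAngleActionPair.exists_isSymplecticChart {Ω T : Set (Phase N)} {ε : ℝ}
    {A B : CPhase N → CPhase N} (hAB : IsAngleActionPair Ω T ε A B) :
    ∃ ρ > 0, ∃ σ > 0, ∃ (ψ : Phase N → Phase N) (Ψ g : CPhase N → CPhase N),
      IsSymplecticChart Ω T σ ρ ψ Ψ ∧ DifferentiableOn ℂ g (torusBall N σ ρ) ∧
      (∀ z ∈ torusBall N σ ρ, g z ∈ torusBall N ε ε ∧ A (g z) = z ∧ Ψ z = B (g z)) ∧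
      (∀ z : Phase N, ‖z.2‖ < ρ → ∃ z', g (complexifyPhase z) = complexifyPhase z') ∧
      ∀ φ, ∃ θ, g (complexifyPhase (φ, 0)) = complexifyPhase (θ, 0) := by
  obtain ⟨hε, hA, hB, hAper, hBper, hAinj, hAder, hAreal, hBreal, hAsurj, hA0, hT, hBinj, hsymp⟩ :=
    hAB
  obtain ⟨hopen, g, hg, hgA, -⟩ :=
    hAinj.exists_holomorphic_inverse (isOpen_torusBall ε ε) hA hAder
  have h0mem : ∀ θ : EuclideanSpace ℝ (Fin N), complexifyPhase (θ, 0) ∈ torusBall N ε ε :=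
    fun θ => complexifyPhase_mem_torusBall hε (by simpa using hε)
  -- The image of `A` is open, invariant under angle translations and contains the real torus; hence
  -- it contains a full polydomain.
  obtain ⟨ρ, hρ, σ, hσ, hsub⟩ := exists_torusBall_subset hopen
    (by
      rintro k z ⟨y, hy, hyz⟩
      refine ⟨translateAngles (-k) y, translateAngles_mem_torusBall hy _, ?_⟩
      rw [hAper y hy, hyz, translateAngles_neg])
    (fun φ => by
      obtain ⟨θ, hθ⟩ := hAsurj φ
      exact ⟨_, h0mem θ, hθ⟩)
  have hgm : ∀ z ∈ torusBall N σ ρ, g z ∈ torusBall N ε ε ∧ A (g z) = z := by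
    intro z hz
    obtain ⟨y, hy, rfl⟩ := hsub hz
    rw [hgA y hy]
    exact ⟨hy, rfl⟩
  have hgd : DifferentiableOn ℂ g (torusBall N σ ρ) := hg.mono hsub
  have hgreal : ∀ z : Phase N, ‖z.2‖ < ρ →
      complexifyPhase (rePhase (g (complexifyPhase z))) = g (complexifyPhase z) := by
    intro z hz
    have hzm := complexifyPhase_mem_torusBall hσ hz
    obtain ⟨h1, h2⟩ := hgm _ hzm
    -- The inverse is real on real points: the conjugate of a preimage is also a preimage, because
    -- `A` commutes with conjugation, and `A` is injective.
    apply complexifyPhase_rePhase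
    refine hAinj (conjPhase_mem_torusBall h1) h1 ?_
    rw [map_conjPhase hA hAreal h1, h2]
    exact cphase_ext (fun j => by simp [conjPhase, complexifyPhase])
      fun j => by simp [conjPhase, complexifyPhase]
  have hgreal' : ∀ z : Phase N, ‖z.2‖ < ρ → ‖(rePhase (g (complexifyPhase z))).2‖ < ε := by
    intro z hz
    have h := (hgm _ (complexifyPhase_mem_torusBall hσ hz)).1.2
    rw [← hgreal z hz] at h
    simpa only [complexifyPhase, norm_complexify] using h
  have hψ : ∀ z : Phase N, ‖z.2‖ < ρ → ∃ z' ∈ Ω, B (g (complexifyPhase z)) = complexifyPhase z' := by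
    intro z hz
    rw [← hgreal z hz]
    exact hBreal _ (hgreal' z hz)
  have hψeq : ∀ z : Phase N, ‖z.2‖ < ρ →
      B (g (complexifyPhase z)) = complexifyPhase (rePhase (B (g (complexifyPhase z)))) := by
    intro z hz
    obtain ⟨z', -, h⟩ := hψ z hz
    rw [h, rePhase_complexifyPhase]
  refine ⟨ρ, hρ, σ, hσ, fun z => rePhase (B (g (complexifyPhase z))), fun z => B (g z), g,
    ⟨hB.comp hgd fun z hz => (hgm z hz).1, ?_, ?_, hψeq, ?_, ?_⟩, hgd,
    fun z hz => ⟨(hgm z hz).1, (hgm z hz).2, rfl⟩, fun z hz => ⟨_, (hgreal z hz).symm⟩, fun φ => ?_⟩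
  · intro z hz z' hz'
    obtain ⟨h1, h2⟩ := hgm z hz
    obtain ⟨h1', h2'⟩ := hgm z' hz'
    rw [← eq_translateAngles_iff]
    constructor
    · intro h
      obtain ⟨k, hk⟩ := hBinj _ h1 _ h1' h
      exact ⟨k, by rw [← h2, hk, hAper _ h1', h2']⟩
    · rintro ⟨k, hk⟩
      have : g z = translateAngles k (g z') := by
        refine hAinj h1 (translateAngles_mem_torusBall h1' k) ?_
        rw [hAper _ h1', h2, h2', hk]
      rw [this, hBper _ h1']
  · intro z hz u v
    obtain ⟨h1, h2⟩ := hgm z hz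
    have hdg := (hgd.differentiableAt ((isOpen_torusBall σ ρ).mem_nhds hz)).hasFDerivAt
    have hdA := (hA.differentiableAt ((isOpen_torusBall ε ε).mem_nhds h1)).hasFDerivAt
    have hdB := (hB.differentiableAt ((isOpen_torusBall ε ε).mem_nhds h1)).hasFDerivAt
    have hBg : HasFDerivAt (fun z => B (g z)) _ z := hdB.comp z hdg
    -- Differentiating A ∘ g = id cancels dA against dg, so the common pulled-back form becomes the
    -- canonical one.
    have hAg : HasFDerivAt (fun z => z) _ z := (hdA.comp z hdg).congr_of_eventuallyEq (by
      filter_upwards [(isOpen_torusBall σ ρ).mem_nhds hz] with y hy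
      exact (hgm y hy).2.symm)
    have hid := hAg.unique (hasFDerivAt_id z)
    have hidv : ∀ v, fderiv ℂ A (g z) (fderiv ℂ g z v) = v := fun v => by
      have := DFunLike.congr_fun hid v
      simpa using this
    rw [hBg.fderiv, ContinuousLinearMap.comp_apply, ContinuousLinearMap.comp_apply,
      hsymp _ h1, hidv, hidv]
  · intro z hz
    obtain ⟨z', h1, h2⟩ := hψ z hz
    simp only [h2, rePhase_complexifyPhase]
    exact h1
  · rw [hT]
    ext z
    simp only [mem_range, Set.mem_ofPred_eq]
    have hz0 : ∀ φ : EuclideanSpace ℝ (Fin N), ‖((φ, 0) : Phase N).2‖ < ρ := fun φ => by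
      simpa using hρ
    constructor
    · rintro ⟨φ, rfl⟩
      obtain ⟨θ, hθ⟩ := hAsurj φ
      refine ⟨θ, ?_⟩
      rw [← hψeq _ (hz0 φ), ← hθ, hgA _ (h0mem θ)]
    · rintro ⟨θ, hθ⟩
      obtain ⟨φ, hφ⟩ := hA0 θ
      refine ⟨φ, ?_⟩
      rw [← hφ, hgA _ (h0mem θ), hθ, rePhase_complexifyPhase]
  · obtain ⟨θ, hθ⟩ := hAsurj φ
    exact ⟨θ, by rw [← hθ, hgA _ (h0mem θ)]⟩

end Charts

/-! ### From an angle-action pair to the normal form. -/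

section NormalForm

open Metric Set Filter Topology ComplexConjugate

/-- The Taylor remainder of order two has vanishing derivatives up to order two. -/
theorem iteratedFDeriv_taylorRemainder_two {E : Type*} [NormedAddCommGroup E] [NormedSpace ℂ E]
    {f : E → ℂ} {x : E} (hf : ContDiffAt ℂ 2 f x) (hx : x = 0) {n : ℕ} (hn : n ≤ 2) :
    iteratedFDeriv ℂ n (fun J => f J - (f 0 + fderiv ℂ f 0 J +
      (1 / 2) * fderiv ℂ (fderiv ℂ f) 0 J J)) 0 = 0 := by
  subst hx
  set b := fderiv ℂ (fderiv ℂ f) 0 with hb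
  have hsym : ∀ v w, b v w = b w v := hf.isSymmSndFDerivAt (by simp)
  have hfd : ∀ᶠ J in 𝓝 (0 : E), DifferentiableAt ℂ f J := by
    filter_upwards [hf.eventually (by simp)] with J hJ using hJ.differentiableAt (by simp)
  -- Symmetry of the second derivative turns the derivative of half the quadratic term into `b J`.
  have hd1 : ∀ J, DifferentiableAt ℂ f J →
      HasFDerivAt (fun J => f J - (f 0 + fderiv ℂ f 0 J + (1 / 2) * b J J))
        (fderiv ℂ f J - fderiv ℂ f 0 - b J) J := by
    intro J hJ
    have hbil : HasFDerivAt (fun J => b J J) (b J + b.flip J) J := by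
      have := (b.hasFDerivAt (x := J)).clm_apply (hasFDerivAt_id J)
      refine this.congr_fderiv ?_
      ext v
      simp
    have := hJ.hasFDerivAt.sub ((((fderiv ℂ f 0).hasFDerivAt (x := J)).const_add (f 0)).add
      (hbil.const_mul (1 / 2)))
    refine this.congr_fderiv ?_
    ext v
    simp [hsym v J]
    ring
  have hd0 : DifferentiableAt ℂ f 0 := hf.differentiableAt (by simp)
  interval_cases n
  · ext v
    simp
  · ext v
    rw [iteratedFDeriv_one_apply, (hd1 0 hd0).fderiv]
    simp
  · ext v
    rw [iteratedFDeriv_two_apply]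
    have h2 : fderiv ℂ (fun J => f J - (f 0 + fderiv ℂ f 0 J + (1 / 2) * b J J)) =ᶠ[𝓝 0]
        fun J => fderiv ℂ f J - fderiv ℂ f 0 - b J := by
      filter_upwards [hfd] with J hJ using (hd1 J hJ).fderiv
    have hff : DifferentiableAt ℂ (fderiv ℂ f) 0 :=
      (hf.fderiv_right (m := 1) (by norm_num)).differentiableAt (by simp)
    have h3 : HasFDerivAt (fun J => fderiv ℂ f J - fderiv ℂ f 0 - b J) (b - b) 0 :=
      (hff.hasFDerivAt.sub_const _).sub b.hasFDerivAt
    rw [h2.fderiv_eq, h3.fderiv]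
    simp

variable {N : ℕ}

/-- The inclusion of `ℝᴺ` in `ℂᴺ`. -/
def complexifyVec : EuclideanSpace ℝ (Fin N) →L[ℝ] EuclideanSpace ℂ (Fin N) :=
  LinearMap.toContinuousLinearMap
    { toFun := fun x => WithLp.toLp 2 fun j => (x j : ℂ)
      map_add' := fun x y => by ext j; simp
      map_smul' := fun a x => by ext j; simp }

@[simp]
theorem complexifyVec_apply (x : EuclideanSpace ℝ (Fin N)) (j : Fin N) :
    complexifyVec x j = (x j : ℂ) := rfl

theorem complexifyPhase_eq (z : Phase N) :
    complexifyPhase z = (complexifyVec z.1, complexifyVec z.2) := rfl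

theorem complexifyVec_eq_sum (x : EuclideanSpace ℝ (Fin N)) :
    complexifyVec x = ∑ j, (x j : ℂ) • complexifyVec (EuclideanSpace.single j (1 : ℝ)) := by
  ext i
  simp [Finset.sum_apply, PiLp.single_apply, apply_ite]

/-- Real derivatives of the restriction of a holomorphic function to real points. -/
theorem hasFDerivAt_of_complexify {Hc : EuclideanSpace ℂ (Fin N) → ℂ}
    {F : EuclideanSpace ℝ (Fin N) → ℝ} {x : EuclideanSpace ℝ (Fin N)}
    (hd : DifferentiableAt ℂ Hc (complexifyVec x))
    (h : ∀ᶠ y in 𝓝 x, Hc (complexifyVec y) = F y) :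
    HasFDerivAt F (Complex.reCLM.comp
      (((fderiv ℂ Hc (complexifyVec x)).restrictScalars ℝ).comp complexifyVec)) x ∧
    ∀ v, (fderiv ℂ Hc (complexifyVec x) (complexifyVec v)).im = 0 := by
  have h1 : HasFDerivAt (fun y => Hc (complexifyVec y))
      (((fderiv ℂ Hc (complexifyVec x)).restrictScalars ℝ).comp complexifyVec) x :=
    (hd.hasFDerivAt.restrictScalars ℝ).comp x complexifyVec.hasFDerivAt
  constructor
  · refine (Complex.reCLM.hasFDerivAt.comp x h1).congr_of_eventuallyEq ?_
    filter_upwards [h] with y hy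
    simp [hy]
  · intro v
    have h2 := Complex.imCLM.hasFDerivAt.comp x h1
    have h3 : HasFDerivAt (Complex.imCLM ∘ fun y => Hc (complexifyVec y))
        (0 : EuclideanSpace ℝ (Fin N) →L[ℝ] ℝ) x := by
      refine (hasFDerivAt_const (0 : ℝ) x).congr_of_eventuallyEq ?_
      filter_upwards [h] with y hy
      simp [hy]
    have := DFunLike.congr_fun (h2.unique h3) v
    simpa using this

theorem gradient_apply_eq_fderiv (F : EuclideanSpace ℝ (Fin N) → ℝ) (x : EuclideanSpace ℝ (Fin N))
    (j : Fin N) : gradient F x j = fderiv ℝ F x (EuclideanSpace.single j (1 : ℝ)) := by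
  have h : inner ℝ (gradient F x) (EuclideanSpace.single j (1 : ℝ)) =
      fderiv ℝ F x (EuclideanSpace.single j (1 : ℝ)) := by
    rw [gradient, InnerProductSpace.toDual_symm_apply]
  rw [← h, EuclideanSpace.inner_single_right]
  simp

/-- The actions determine the energy coordinate, so in the chart the energy is a holomorphic
function of J alone. Near 0 its real restriction is `F`: frequency and Hessian are therefore those
of `F`, whose regularity is inherited and not assumed. -/
theorem IsAngleActionPair.propertyP1 {Ω T : Set (Phase N)} {ε : ℝ} {A B : CPhase N → CPhase N}
    (hAB : IsAngleActionPair Ω T ε A B)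
    (hA2 : ∀ z ∈ torusBall N ε ε, ∀ z' ∈ torusBall N ε ε, (A z).2 = (A z').2 → z.2 = z'.2)
    {𝓔 : EuclideanSpace ℂ (Fin N) → ℂ} (h𝓔 : Differentiable ℂ 𝓔) {h : Phase N → ℝ}
    (hen : ∀ z z' : Phase N, ‖z.2‖ < ε → B (complexifyPhase z) = complexifyPhase z' →
      (h z' : ℂ) = 𝓔 (complexifyVec z.2))
    {F : EuclideanSpace ℝ (Fin N) → ℝ} {δ : ℝ} (hδ : 0 < δ)
    (hF : ∀ z z' : Phase N, ‖z.2‖ < δ → ‖z.2‖ < ε → A (complexifyPhase z) = complexifyPhase z' →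
      (F z'.2 : ℂ) = 𝓔 (complexifyVec z.2))
    (hnd : ∀ v, fderiv ℝ (gradient F) 0 v = 0 → v = 0) (hdio : IsDiophantine (gradient F 0)) :
    PropertyP1 Ω (fun _ => h) (fun _ => T) (fun _ => gradient F 0) := by
  obtain ⟨ρ, hρ, σ, hσ, ψ, Ψ, g, hchart, hgd, hg, hgreal, hg0⟩ := hAB.exists_isSymplecticChart
  set Hc : EuclideanSpace ℂ (Fin N) → ℂ := fun J => 𝓔 (g (0, J)).2 with hHc_def
  have hmem0 : ∀ J ∈ ball (0 : EuclideanSpace ℂ (Fin N)) ρ, ((0, J) : CPhase N) ∈ torusBall N σ ρ :=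
    fun J hJ => ⟨fun j => by simpa using hσ, by simpa using hJ⟩
  have hgd0 : DifferentiableOn ℂ (fun J : EuclideanSpace ℂ (Fin N) => g (0, J)) (ball 0 ρ) :=
    hgd.comp (f := fun J : EuclideanSpace ℂ (Fin N) => ((0, J) : CPhase N)) (by fun_prop) hmem0
  have hHc : DifferentiableOn ℂ Hc (ball 0 ρ) :=
    h𝓔.comp_differentiableOn (differentiable_snd.comp_differentiableOn hgd0)
  -- The energy does not depend on the angles, so it may be evaluated at φ = 0.
  have hHcg : ∀ z ∈ torusBall N σ ρ, 𝓔 (g z).2 = Hc z.2 := by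
    intro z hz
    have hz2 := hmem0 z.2 (by simpa using hz.2)
    simp only [hHc_def]
    rw [hA2 _ (hg z hz).1 _ (hg _ hz2).1 (by rw [(hg z hz).2.1, (hg _ hz2).2.1])]
  have hvec : ∀ {x : EuclideanSpace ℝ (Fin N)}, ‖x‖ < ρ → complexifyVec x ∈ ball 0 ρ := by
    intro x hx
    rw [mem_ball_zero_iff]
    exact (norm_complexify x).trans_lt hx
  have henergy : ∀ z : Phase N, ‖z.2‖ < ρ → (h (ψ z) : ℂ) = Hc (complexifyVec z.2) := by
    intro z hz
    have hzm := complexifyPhase_mem_torusBall hσ hz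
    obtain ⟨z', hz'⟩ := hgreal z hz
    obtain ⟨h1, h2, h3⟩ := hg _ hzm
    have h4 := hchart.real_on_real z hz
    have h5 : ‖z'.2‖ < ε := by
      rw [hz'] at h1
      have := h1.2
      simpa only [complexifyPhase, norm_complexify] using this
    rw [h3, hz'] at h4
    rw [hen z' (ψ z) h5 h4]
    have h6 := hHcg _ hzm
    rw [hz'] at h6
    exact h6
  set Fr : EuclideanSpace ℝ (Fin N) → ℝ := fun x => (Hc (complexifyVec x)).re with hFr_def
  have hFr : ∀ x, ‖x‖ < ρ → Hc (complexifyVec x) = Fr x := by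
    intro x hx
    have := henergy (0, x) hx
    simp only [hFr_def]
    rw [← this, Complex.ofReal_re]
  have hball : ∀ {x : EuclideanSpace ℝ (Fin N)}, ‖x‖ < ρ → ∀ᶠ y in 𝓝 x, ‖y‖ < ρ := fun hx =>
    (isOpen_lt continuous_norm continuous_const).mem_nhds hx
  have hd1 : ∀ x, ‖x‖ < ρ → HasFDerivAt Fr (Complex.reCLM.comp
      (((fderiv ℂ Hc (complexifyVec x)).restrictScalars ℝ).comp complexifyVec)) x ∧
      ∀ v, (fderiv ℂ Hc (complexifyVec x) (complexifyVec v)).im = 0 := fun x hx =>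
    hasFDerivAt_of_complexify (hHc.differentiableAt (isOpen_ball.mem_nhds (hvec hx)))
      ((hball hx).mono hFr)
  set e : Fin N → EuclideanSpace ℝ (Fin N) := fun j => EuclideanSpace.single j (1 : ℝ) with he
  set D : Fin N → EuclideanSpace ℂ (Fin N) → ℂ := fun k J => fderiv ℂ Hc J (complexifyVec (e k))
    with hD_def
  have hDd : ∀ k, DifferentiableOn ℂ (D k) (ball 0 ρ) := fun k =>
    hHc.fderiv_apply_complex isOpen_ball _
  have hgrad : ∀ x, ‖x‖ < ρ → ∀ k, D k (complexifyVec x) = gradient Fr x k := by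
    intro x hx k
    rw [gradient_apply_eq_fderiv, (hd1 x hx).1.fderiv]
    apply Complex.ext
    · simp [hD_def, he]
    · rw [Complex.ofReal_im]
      exact (hd1 x hx).2 _
  have hnorm0 : ‖(0 : EuclideanSpace ℝ (Fin N))‖ < ρ := by simpa using hρ
  have hd2 : ∀ k, HasFDerivAt (fun x => gradient Fr x k) (Complex.reCLM.comp
      (((fderiv ℂ (D k) (complexifyVec 0)).restrictScalars ℝ).comp complexifyVec)) 0 ∧
      ∀ v, (fderiv ℂ (D k) (complexifyVec 0) (complexifyVec v)).im = 0 := fun k =>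
    hasFDerivAt_of_complexify
      ((hDd k).differentiableAt (isOpen_ball.mem_nhds (hvec hnorm0)))
      ((hball hnorm0).mono fun x hx => hgrad x hx k)
  have hvec0 : complexifyVec (0 : EuclideanSpace ℝ (Fin N)) = 0 := map_zero _
  rw [hvec0] at hd2
  have h0ball : (0 : EuclideanSpace ℂ (Fin N)) ∈ ball (0 : EuclideanSpace ℂ (Fin N)) ρ :=
    mem_ball_self hρ
  set Am : Matrix (Fin N) (Fin N) ℝ := fun j k =>
    (fderiv ℂ (D k) 0 (complexifyVec (e j))).re with hAm_def
  have hAm : ∀ j k, (Am j k : ℂ) = fderiv ℂ (D k) 0 (complexifyVec (e j)) := fun j k => by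
    apply Complex.ext
    · simp [hAm_def]
    · rw [Complex.ofReal_im, (hd2 k).2]
  have hsymm : ∀ j k, Am j k = Am k j := fun j k => by
    simp only [hAm_def, hD_def]
    rw [hHc.fderiv_fderiv_symm isOpen_ball h0ball]
  -- The inverse map sends small actions to small energy coordinates, inside the range δ where `F`
  -- is known to be the energy.
  have hgradF : gradient F =ᶠ[𝓝 0] gradient Fr := by
    have hFF : ∀ᶠ x in 𝓝 (0 : EuclideanSpace ℝ (Fin N)), F x = Fr x := by
      have hcont : ContinuousAt (fun x : EuclideanSpace ℝ (Fin N) => (g (0, complexifyVec x)).2) 0 := by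
        have h1 : ContinuousAt (fun J : EuclideanSpace ℂ (Fin N) => g (0, J)) (complexifyVec 0) :=
          (hgd0.differentiableAt (isOpen_ball.mem_nhds (hvec hnorm0))).continuousAt
        exact continuous_snd.continuousAt.comp
          (ContinuousAt.comp (g := fun J : EuclideanSpace ℂ (Fin N) => g (0, J))
            (f := fun x : EuclideanSpace ℝ (Fin N) => complexifyVec x) h1
            complexifyVec.continuous.continuousAt)
      have hval : (g (0, complexifyVec (0 : EuclideanSpace ℝ (Fin N)))).2 = 0 := by
        obtain ⟨θ, hθ⟩ := hg0 0
        rw [complexifyPhase_eq, complexifyPhase_eq] at hθ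
        simp only [map_zero] at hθ ⊢
        rw [hθ]
      have hev : ∀ᶠ x in 𝓝 (0 : EuclideanSpace ℝ (Fin N)), ‖(g (0, complexifyVec x)).2‖ < δ := by
        have := hcont.norm
        rw [ContinuousAt, hval, norm_zero] at this
        exact this.eventually (gt_mem_nhds hδ)
      filter_upwards [hev, hball hnorm0] with x hx hxρ
      have hzm := complexifyPhase_mem_torusBall (z := ((0 : EuclideanSpace ℝ (Fin N)), x)) hσ hxρ
      obtain ⟨z', hz'⟩ := hgreal (0, x) hxρ
      obtain ⟨h1, h2, -⟩ := hg _ hzm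
      have hz'' : g (0, complexifyVec x) = complexifyPhase z' := by
        rw [← hz', complexifyPhase_eq, map_zero]
      rw [hz''] at hx
      rw [hz'] at h1 h2
      have h5 := h1.2
      simp only [complexifyPhase, norm_complexify] at hx h5
      have h6 := hF z' (0, x) hx h5 h2
      have h7 := hFr x hxρ
      simp only [hHc_def] at h7
      rw [hz''] at h7
      have h8 : (F x : ℂ) = Fr x := h6.trans h7
      exact_mod_cast h8
    filter_upwards [hFF.eventually_nhds] with x hx
    simp only [gradient]
    rw [EventuallyEq.fderiv_eq hx]
  have hξ : gradient F 0 = gradient Fr 0 := hgradF.self_of_nhds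
  have hξD : ∀ k, D k 0 = gradient Fr 0 k := fun k => by rw [← hgrad 0 hnorm0 k, hvec0]
  -- A kernel vector of the matrix is killed by the derivative of the gradient of `F`, hence zero by
  -- the non-degeneracy hypothesis.
  have hunit : IsUnit Am.det := by
    rw [← Matrix.isUnit_iff_isUnit_det, ← Matrix.mulVec_injective_iff_isUnit]
    refine (injective_iff_map_eq_zero (Matrix.mulVecLin Am)).2 fun v hv => ?_
    have hfd : DifferentiableAt ℝ (gradient Fr) 0 :=
      differentiableAt_euclidean.2 fun k => (hd2 k).1.differentiableAt
    have hw : fderiv ℝ (gradient F) 0 (WithLp.toLp 2 v) = 0 := by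
      rw [hgradF.fderiv_eq]
      ext k
      have h1 : HasFDerivAt (fun x => gradient Fr x k)
          ((EuclideanSpace.proj k : EuclideanSpace ℝ (Fin N) →L[ℝ] ℝ).comp
            (fderiv ℝ (gradient Fr) 0)) 0 :=
        (EuclideanSpace.proj k : EuclideanSpace ℝ (Fin N) →L[ℝ] ℝ).hasFDerivAt.comp 0
          hfd.hasFDerivAt
      have h2 := DFunLike.congr_fun (h1.unique (hd2 k).1) (WithLp.toLp 2 v)
      have h3 : (∑ j, Am k j * v j) = 0 := congrFun hv k
      have h4 : fderiv ℂ (D k) 0 (complexifyVec (WithLp.toLp 2 v)) =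
          ((∑ j, Am k j * v j : ℝ) : ℂ) := by
        rw [complexifyVec_eq_sum, map_sum]
        push_cast
        refine Finset.sum_congr rfl fun j _ => ?_
        rw [map_smul, smul_eq_mul, hsymm, hAm, mul_comm]
      rw [h3] at h4
      simp only [ContinuousLinearMap.comp_apply, ContinuousLinearMap.coe_restrictScalars', h4] at h2
      simpa using h2
    simpa using congrArg WithLp.ofLp (hnd _ hw)
  obtain ⟨γ, τ, hγ, hτ, hDC⟩ := hdio
  -- For a constant family the compact set is one point and the bound on the inverse is its own
  -- norm.
  refine ⟨ρ, σ, γ, τ, hρ, hσ, hγ, hτ, {gradient F 0}, isCompact_singleton, fun _ => Am,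
    fun i => ⟨rfl, hDC, Matrix.IsSymm.ext fun j k => hsymm k j, hunit, ?_⟩, _, fun i => le_rfl⟩
  have hlin : ∀ y : EuclideanSpace ℝ (Fin N), fderiv ℂ Hc 0 (complexifyVec y) =
      ((∑ j, gradient F 0 j * y j : ℝ) : ℂ) := by
    intro y
    rw [complexifyVec_eq_sum, map_sum]
    push_cast
    refine Finset.sum_congr rfl fun j _ => ?_
    rw [map_smul, smul_eq_mul, hξ, ← hξD, mul_comm]
  have hcd : ContDiffAt ℂ 2 Hc 0 :=
    ((hHc.contDiffOn_complex isOpen_ball).contDiffAt (isOpen_ball.mem_nhds h0ball)).of_le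
      (by exact WithTop.coe_le_coe.2 le_top)
  have hff : DifferentiableAt ℂ (fderiv ℂ Hc) 0 :=
    (hcd.fderiv_right (m := 1) (by norm_num)).differentiableAt (by simp)
  have hquad : ∀ y : EuclideanSpace ℝ (Fin N),
      fderiv ℂ (fderiv ℂ Hc) 0 (complexifyVec y) (complexifyVec y) =
      ((∑ j, ∑ k, Am j k * y k * y j : ℝ) : ℂ) := by
    intro y
    have hDe : ∀ j k, fderiv ℂ (fderiv ℂ Hc) 0 (complexifyVec (e j)) (complexifyVec (e k)) =
        Am j k := by
      intro j k
      rw [hAm]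
      simp only [hD_def]
      rw [fderiv_clm_apply hff (differentiableAt_const _)]
      simp
    have h1 : ∀ a, fderiv ℂ (fderiv ℂ Hc) 0 a (complexifyVec y) =
        ∑ k, (y k : ℂ) * fderiv ℂ (fderiv ℂ Hc) 0 a (complexifyVec (e k)) := by
      intro a
      rw [complexifyVec_eq_sum, map_sum]
      simp only [map_smul, smul_eq_mul, he]
    have h2 : ∀ k, fderiv ℂ (fderiv ℂ Hc) 0 (complexifyVec y) (complexifyVec (e k)) =
        ∑ j, (y j : ℂ) * (Am j k : ℂ) := by
      intro k
      rw [complexifyVec_eq_sum, map_sum, sum_apply]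
      simp only [map_smul, smul_apply, smul_eq_mul, ← hDe, he]
    rw [h1, Finset.sum_congr rfl fun k _ => by rw [h2 k, Finset.mul_sum], Finset.sum_comm]
    push_cast
    exact Finset.sum_congr rfl fun j _ => Finset.sum_congr rfl fun k _ => by ring
  -- P is the Taylor remainder of the energy, independent of the angles.
  refine ⟨ψ, Ψ, fun z => Hc z.2 - (Hc 0 + fderiv ℂ Hc 0 z.2 +
    (1 / 2) * fderiv ℂ (fderiv ℂ Hc) 0 z.2 z.2), Fr 0, hchart, ?_, ?_, ?_⟩
  · refine DifferentiableOn.sub ?_ ?_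
    · exact hHc.comp differentiableOn_snd fun z hz => by simpa using hz.2
    · fun_prop
  · intro z hz n hn
    exact iteratedFDeriv_taylorRemainder_two hcd rfl hn
  · intro z hz
    rw [henergy z hz]
    have h0 : Hc 0 = Fr 0 := by rw [← hvec0, hFr 0 hnorm0]
    simp only [complexifyPhase_eq, hlin, hquad, h0]
    push_cast
    ring

end NormalForm

/-! ### Closed level curves and potential wells. -/

section Levels

open Set Filter Topology Function

/-- The sublevel set `{W ≤ E}` in `I` is a compact interval `[a, b]` of positive length, and
`W = E` exactly at its endpoints. -/
structure IsPotentialWell (I : Set ℝ) (W : ℝ → ℝ) (E a b : ℝ) : Prop where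
  lt : a < b
  sublevel : {r | r ∈ I ∧ W r ≤ E} = Icc a b
  left : W a = E
  right : W b = E
  inside : ∀ r ∈ Ioo a b, W r < E

variable {I : Set ℝ} {W : ℝ → ℝ} {E a b : ℝ}

theorem IsPotentialWell.subset (h : IsPotentialWell I W E a b) : Icc a b ⊆ I := fun x hx => by
  rw [← h.sublevel] at hx
  exact hx.1

theorem IsPotentialWell.left_mem (h : IsPotentialWell I W E a b) : a ∈ I :=
  h.subset (left_mem_Icc.2 h.lt.le)

theorem IsPotentialWell.right_mem (h : IsPotentialWell I W E a b) : b ∈ I :=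
  h.subset (right_mem_Icc.2 h.lt.le)

theorem IsPotentialWell.eq_endpoint (h : IsPotentialWell I W E a b) {x : ℝ} (hx : x ∈ I)
    (hxE : W x = E) : x = a ∨ x = b := by
  have hm : x ∈ Icc a b := by rw [← h.sublevel]; exact ⟨hx, hxE.le⟩
  by_contra! hne
  exact (h.inside x ⟨lt_of_le_of_ne hm.1 hne.1.symm, lt_of_le_of_ne hm.2 hne.2⟩).ne hxE

theorem Function.Periodic.eq_add_int_of_injOn {α : Type*} {c : ℝ → α} (hper : Periodic c 1)
    (hinj : InjOn c (Ico 0 1)) {s t : ℝ} (h : c s = c t) : ∃ m : ℤ, s = t + m := by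
  have hf : ∀ x, c (Int.fract x) = c x := fun x => by
    have := hper.sub_int_mul_eq (x := x) ⌊x⌋
    rwa [mul_one] at this
  have hm : ∀ x : ℝ, Int.fract x ∈ Ico (0 : ℝ) 1 := fun x => ⟨Int.fract_nonneg x, Int.fract_lt_one x⟩
  have := hinj (hm s) (hm t) (by rw [hf, hf, h])
  refine ⟨⌊s⌋ - ⌊t⌋, ?_⟩
  have h1 := Int.fract_add_floor s
  have h2 := Int.fract_add_floor t
  push_cast
  linarith

/-- An energy level that is a simple closed curve bounds a potential well. -/
theorem exists_isPotentialWell (hI : IsOpen I) (hW : ContinuousOn W I) {c : ℝ → ℝ × ℝ}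
    (hc : Continuous c) (hper : Periodic c 1) (hinj : InjOn c (Ico 0 1))
    (hrange : range c = levelCurve I W E) : ∃ a b, IsPotentialWell I W E a b := by
  have hcm : ∀ t, (c t).1 ∈ I ∧ (c t).2 ^ 2 / 2 + W (c t).1 = E := fun t => by
    have : c t ∈ levelCurve I W E := hrange ▸ mem_range_self t
    exact this
  have hmc : ∀ {x p : ℝ}, x ∈ I → p ^ 2 / 2 + W x = E → ∃ t, c t = (x, p) := fun {x p} hx h => by
    have : (x, p) ∈ range c := by rw [hrange]; exact ⟨hx, h⟩
    exact this
  -- The sublevel set is the projection of the curve, hence compact and connected: a closed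
  -- interval.
  have hK : {r | r ∈ I ∧ W r ≤ E} = range (fun t => (c t).1) := by
    ext r
    constructor
    · rintro ⟨hr, hrE⟩
      obtain ⟨t, ht⟩ := hmc (p := Real.sqrt (2 * (E - W r))) hr
        (by rw [Real.sq_sqrt (by linarith)]; ring)
      exact ⟨t, by simp [ht]⟩
    · rintro ⟨t, rfl⟩
      obtain ⟨h1, h2⟩ := hcm t
      exact ⟨h1, by nlinarith [sq_nonneg (c t).2]⟩
  have hc1 : Continuous fun t => (c t).1 := continuous_fst.comp hc
  have hper1 : Periodic (fun t => (c t).1) 1 := fun t => by simp only [hper t]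
  have hcomp : IsCompact (range fun t => (c t).1) := by
    rw [← hper1.image_Icc one_pos 0]
    exact isCompact_Icc.image hc1
  have hconn : IsConnected (range fun t => (c t).1) := isConnected_range hc1
  have hIcc := eq_Icc_of_connected_compact hconn hcomp
  set a := sInf (range fun t => (c t).1)
  set b := sSup (range fun t => (c t).1)
  rw [← hK] at hIcc
  have hmemK : ∀ t, (c t).1 ∈ Icc a b := fun t => by
    rw [← hIcc, hK]
    exact mem_range_self t
  -- Over a single point the level has at most two points ±p, whereas a simple closed curve has at
  -- least three: the parameters 0, 1/4, 1/2 already clash.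
  have hab : a < b := by
    by_contra! hba
    have hx : ∀ t, (c t).1 = a := fun t => le_antisymm ((hmemK t).2.trans hba) (hmemK t).1
    have hp : ∀ s t, (c s).2 ^ 2 = (c t).2 ^ 2 := fun s t => by
      have h1 := (hcm s).2
      have h2 := (hcm t).2
      rw [hx] at h1 h2
      linarith
    have hne : ∀ s t, s ∈ Ico (0 : ℝ) 1 → t ∈ Ico (0 : ℝ) 1 → s ≠ t → (c s).2 = -(c t).2 := by
      intro s t hs ht hst
      refine (sq_eq_sq_iff_eq_or_eq_neg.1 (hp s t)).resolve_left fun h => hst ?_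
      exact hinj hs ht (Prod.ext ((hx s).trans (hx t).symm) h)
    have h1 := hne 0 (1 / 4) (by norm_num) (by norm_num) (by norm_num)
    have h2 := hne 0 (1 / 2) (by norm_num) (by norm_num) (by norm_num)
    have h3 := hne (1 / 4) (1 / 2) (by norm_num) (by norm_num) (by norm_num)
    have h4 : (1 / 4 : ℝ) = 1 / 2 := hinj (by norm_num) (by norm_num)
      (Prod.ext ((hx _).trans (hx _).symm) (by linarith))
    norm_num at h4
  have haK : a ∈ {r | r ∈ I ∧ W r ≤ E} := by rw [hIcc]; exact left_mem_Icc.2 hab.le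
  have hbK : b ∈ {r | r ∈ I ∧ W r ≤ E} := by rw [hIcc]; exact right_mem_Icc.2 hab.le
  -- A point strictly below E has a whole neighbourhood in the sublevel interval, so it cannot be an
  -- endpoint.
  have hnhds : ∀ x ∈ I, W x < E → Icc a b ∈ 𝓝 x := fun x hx hxE => by
    rw [← hIcc]
    filter_upwards [hI.mem_nhds hx,
      (hW.continuousAt (hI.mem_nhds hx)).eventually (gt_mem_nhds hxE)] with y hy hyE
    exact ⟨hy, hyE.le⟩
  have hWa : W a = E := by
    refine le_antisymm haK.2 (not_lt.1 fun h => ?_)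
    have := mem_interior_iff_mem_nhds.2 (hnhds a haK.1 h)
    rw [interior_Icc] at this
    exact lt_irrefl _ this.1
  have hWb : W b = E := by
    refine le_antisymm hbK.2 (not_lt.1 fun h => ?_)
    have := mem_interior_iff_mem_nhds.2 (hnhds b hbK.1 h)
    rw [interior_Icc] at this
    exact lt_irrefl _ this.2
  refine ⟨a, b, hab, hIcc, hWa, hWb, fun x hx => ?_⟩
  have hxK : x ∈ {r | r ∈ I ∧ W r ≤ E} := by rw [hIcc]; exact Ioo_subset_Icc_self hx
  -- If W = E at an interior x, then (x, 0) is the only level point above x. The curve minus that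
  -- point is still connected and its projection contains both ends, so it must pass over x again: a
  -- contradiction.
  refine lt_of_le_of_ne hxK.2 fun hxE => ?_
  obtain ⟨t₀, ht₀⟩ := hmc (p := 0) hxK.1 (by rw [hxE]; ring)
  have hend : ∀ y ∈ I, W y = E → y ≠ x → ∃ t ∈ Ioo t₀ (t₀ + 1), (c t).1 = y := by
    intro y hy hyE hyx
    obtain ⟨s, hs⟩ := hmc (p := 0) hy (by rw [hyE]; ring)
    have hmem : c s ∈ c '' Icc t₀ (t₀ + 1) := by
      rw [hper.image_Icc one_pos]
      exact mem_range_self s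
    obtain ⟨t, ht, hts⟩ := hmem
    rw [hs] at hts
    refine ⟨t, ⟨lt_of_le_of_ne ht.1 ?_, lt_of_le_of_ne ht.2 ?_⟩, by rw [hts]⟩
    · rintro rfl
      rw [ht₀] at hts
      exact hyx (congrArg Prod.fst hts).symm
    · rintro rfl
      rw [hper, ht₀] at hts
      exact hyx (congrArg Prod.fst hts).symm
  obtain ⟨ta, hta, hca⟩ := hend a haK.1 hWa hx.1.ne
  obtain ⟨tb, htb, hcb⟩ := hend b hbK.1 hWb hx.2.ne'
  have hpre : IsPreconnected ((fun t => (c t).1) '' Ioo t₀ (t₀ + 1)) :=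
    isPreconnected_Ioo.image _ hc1.continuousOn
  obtain ⟨t, ht, htx⟩ := hpre.Icc_subset ⟨ta, hta, hca⟩ ⟨tb, htb, hcb⟩ (Ioo_subset_Icc_self hx)
  have h0 : (c t).2 = 0 := by
    have := (hcm t).2
    simp only at htx
    rw [htx, hxE] at this
    have h2 : (c t).2 ^ 2 = 0 := by linarith
    exact pow_eq_zero_iff two_ne_zero |>.1 h2
  obtain ⟨m, hm⟩ := hper.eq_add_int_of_injOn hinj (s := t) (t := t₀)
    (by rw [ht₀]; exact Prod.ext htx h0)
  have h1 : (0 : ℝ) < m := by linarith [ht.1]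
  have h2 : (m : ℝ) < 1 := by linarith [ht.2]
  have h3 : 0 < m := by exact_mod_cast h1
  have h4 : m < 1 := by exact_mod_cast h2
  omega

theorem IsClosedCurve.exists_isPotentialWell (hI : IsOpen I) (hW : ContinuousOn W I)
    (h : IsClosedCurve (levelCurve I W E)) : ∃ a b, IsPotentialWell I W E a b := by
  obtain ⟨e⟩ := h
  have hpi := Real.pi_pos
  have hc : Continuous fun t : ℝ => (e (Circle.exp (2 * Real.pi * t)) : ℝ × ℝ) := by fun_prop
  refine _root_.exists_isPotentialWell hI hW hc ?_ ?_ ?_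
  · intro t
    simp only [mul_add, mul_one, Circle.periodic_exp _]
  · intro s hs t ht hst
    obtain ⟨m, hm⟩ := Circle.exp_eq_exp.1 (e.injective (Subtype.ext hst))
    have h1 : s = t + m := by
      have : 2 * Real.pi * (s - t - m) = 0 := by linarith
      rcases mul_eq_zero.1 this with h | h
      · linarith
      · linarith
    have h2 : (m : ℝ) < 1 := by linarith [hs.2, ht.1]
    have h3 : (-1 : ℝ) < m := by linarith [hs.1, ht.2]
    have h4 : m < 1 := by exact_mod_cast h2
    have h5 : -1 < m := by exact_mod_cast h3
    have h6 : m = 0 := by omega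
    rw [h1, h6]
    simp
  · ext q
    constructor
    · rintro ⟨t, rfl⟩
      exact (e _).2
    · intro hq
      obtain ⟨x, hx⟩ := Circle.exp_surjective (e.symm ⟨q, hq⟩)
      refine ⟨x / (2 * Real.pi), ?_⟩
      simp only
      rw [mul_div_cancel₀ _ (by positivity), hx]
      simp

theorem IsSmoothClosedCurve.exists_isPotentialWell (hI : IsOpen I) (hW : ContinuousOn W I)
    (h : IsSmoothClosedCurve (levelCurve I W E)) : ∃ a b, IsPotentialWell I W E a b := by
  obtain ⟨c, hc, hper, -, hinj, hrange⟩ := h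
  exact _root_.exists_isPotentialWell hI hW hc.continuous hper hinj hrange

/-- On a regular level curve the potential has no critical point at a turning point. -/
theorem deriv_ne_zero_of_isSmoothClosedCurve (hW : AnalyticOnNhd ℝ W I)
    (h : IsSmoothClosedCurve (levelCurve I W E)) {x₀ : ℝ} (hx₀ : x₀ ∈ I) (hE : W x₀ = E)
    (hext : (∀ x ∈ I, W x ≤ E → x₀ ≤ x) ∨ ∀ x ∈ I, W x ≤ E → x ≤ x₀) : deriv W x₀ ≠ 0 := by
  obtain ⟨c, hc, -, hreg, -, hrange⟩ := h
  intro hd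
  have hcm : ∀ t, (c t).1 ∈ I ∧ (c t).2 ^ 2 / 2 + W (c t).1 = E := fun t => by
    have : c t ∈ levelCurve I W E := hrange ▸ mem_range_self t
    exact this
  obtain ⟨t₀, ht₀⟩ : (x₀, (0 : ℝ)) ∈ range c := by
    rw [hrange]
    exact ⟨hx₀, by rw [hE]; ring⟩
  set x : ℝ → ℝ := fun t => (c t).1 with hx_def
  set p : ℝ → ℝ := fun t => (c t).2 with hp_def
  have hxs : ContDiff ℝ ∞ x := contDiff_fst.comp hc
  have hps : ContDiff ℝ ∞ p := contDiff_snd.comp hc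
  have hxd : ∀ t, HasDerivAt x (deriv x t) t := fun t =>
    (hxs.differentiable (by simp) t).hasDerivAt
  have hpd : ∀ t, HasDerivAt p (deriv p t) t := fun t =>
    (hps.differentiable (by simp) t).hasDerivAt
  have hx0 : x t₀ = x₀ := by simp [hx_def, ht₀]
  have hp0 : p t₀ = 0 := by simp [hp_def, ht₀]
  have hle : ∀ t, W (x t) ≤ E := fun t => by
    have := (hcm t).2
    simp only [hx_def]
    nlinarith [sq_nonneg (c t).2]
  -- At the turning point the position is extremal along the curve.
  have hx' : deriv x t₀ = 0 := by
    apply IsLocalExtr.deriv_eq_zero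
    rcases hext with h | h
    · exact Or.inl (Eventually.of_forall fun t => by rw [hx0]; exact h _ (hcm t).1 (hle t))
    · exact Or.inr (Eventually.of_forall fun t => by rw [hx0]; exact h _ (hcm t).1 (hle t))
  have hen : ∀ t, p t * deriv p t + deriv W (x t) * deriv x t = 0 := fun t => by
    have h1 : HasDerivAt (fun t => p t ^ 2 / 2 + W (x t))
        (p t * deriv p t + deriv W (x t) * deriv x t) t := by
      have h2 := (((hpd t).pow 2).div_const 2).add
        (((hW _ (hcm t).1).differentiableAt.hasDerivAt).comp t (hxd t))
      exact h2.congr_deriv (by push_cast; ring)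
    have h2 : (fun t => p t ^ 2 / 2 + W (x t)) = fun _ => E := funext fun t => (hcm t).2
    rw [h2] at h1
    exact h1.unique (hasDerivAt_const t E)
  have hx2 : DifferentiableAt ℝ (deriv x) t₀ :=
    ((contDiff_infty_iff_deriv.1 hxs).2.differentiable (by simp)) t₀
  have hp2 : DifferentiableAt ℝ (deriv p) t₀ :=
    ((contDiff_infty_iff_deriv.1 hps).2.differentiable (by simp)) t₀
  have hW2 : HasDerivAt (deriv W) (deriv (deriv W) (x t₀)) (x t₀) := by
    rw [hx0]
    exact (hW.deriv x₀ hx₀).differentiableAt.hasDerivAt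
  -- The second derivative of the energy along the curve is p'² + pp'' + W''x'² + W'x'' = 0. At the
  -- point p, x' and W' vanish, so p' = 0 too and the velocity is zero.
  have h1 := ((hpd t₀).mul hp2.hasDerivAt).add ((hW2.comp t₀ (hxd t₀)).mul hx2.hasDerivAt)
  have h2 : (p * deriv p + (deriv W ∘ x) * deriv x) = fun _ => 0 := funext hen
  rw [h2] at h1
  have h3 := h1.unique (hasDerivAt_const t₀ 0)
  simp only [Function.comp_apply, hx', hp0, hx0, hd] at h3
  have h4 : deriv p t₀ = 0 := by
    have : deriv p t₀ * deriv p t₀ = 0 := by linarith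
    exact mul_self_eq_zero.1 this
  refine hreg t₀ ?_
  have h5 : HasDerivAt c (deriv x t₀, deriv p t₀) t₀ := (hxd t₀).prodMk (hpd t₀)
  rw [h5.deriv, hx', h4]
  rfl

theorem IsPotentialWell.left_le (h : IsPotentialWell I W E a b) {x : ℝ} (hx : x ∈ I)
    (hxE : W x ≤ E) : a ≤ x ∧ x ≤ b := by
  have hm : x ∈ Icc a b := by rw [← h.sublevel]; exact ⟨hx, hxE⟩
  exact hm

theorem IsPotentialWell.deriv_left_nonpos (h : IsPotentialWell I W E a b) {W' : ℝ}
    (hd : HasDerivAt W W' a) : W' ≤ 0 := by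
  by_contra! hpos
  have h1 := (hasDerivAt_iff_tendsto_slope.1 hd).mono_left
    (nhdsWithin_mono a (show Ioi a ⊆ {a}ᶜ from fun y hy => ne_of_gt hy))
  obtain ⟨y, hy, hyI⟩ := ((h1.eventually (lt_mem_nhds hpos)).and (Ioo_mem_nhdsGT h.lt)).exists
  rw [slope_def_field, h.left] at hy
  have h2 : 0 < y - a := sub_pos.2 hyI.1
  have h3 : 0 < W y - E := by
    by_contra! h4
    exact absurd hy (not_lt.2 (div_nonpos_of_nonpos_of_nonneg h4 h2.le))
  linarith [h.inside y hyI]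

theorem IsPotentialWell.deriv_right_nonneg (h : IsPotentialWell I W E a b) {W' : ℝ}
    (hd : HasDerivAt W W' b) : 0 ≤ W' := by
  by_contra! hneg
  have h1 := (hasDerivAt_iff_tendsto_slope.1 hd).mono_left
    (nhdsWithin_mono b (show Iio b ⊆ {b}ᶜ from fun y hy => ne_of_lt hy))
  obtain ⟨y, hy, hyI⟩ := ((h1.eventually (gt_mem_nhds hneg)).and (Ioo_mem_nhdsLT h.lt)).exists
  rw [slope_def_field, h.right] at hy
  have h2 : y - b < 0 := sub_neg.2 hyI.2
  have h3 : 0 < W y - E := by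
    by_contra! h4
    exact absurd hy (not_lt.2 (div_nonneg_of_nonpos h4 h2.le))
  linarith [h.inside y hyI]

end Levels

/-! ### The effective potential: non-critical turning points and parity in the angular momentum. -/

section EffectivePotential

open Set Filter Topology

variable {V : ℝ → ℝ}

theorem analyticOnNhd_effPot (hV : AnalyticOnNhd ℝ V (Ioi 0)) (G : ℝ) :
    AnalyticOnNhd ℝ (effPot V G) (Ioi 0) := by
  intro r hr
  have hr' : (2 * r ^ 2) ≠ 0 := by have : 0 < r := hr; positivity
  have h1 : AnalyticAt ℝ (fun r : ℝ => 2 * r ^ 2) r := by fun_prop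
  have h2 : AnalyticAt ℝ (fun _ : ℝ => G ^ 2) r := by fun_prop
  exact (h2.div h1 hr').sub (hV r hr)

theorem effPot_eq_add (V : ℝ → ℝ) (G G' r : ℝ) :
    effPot V G' r = effPot V G r + (G' ^ 2 - G ^ 2) / 2 * (r ^ 2)⁻¹ := by
  simp only [effPot]
  rw [div_eq_mul_inv, mul_inv, div_eq_mul_inv (G ^ 2), mul_inv]
  ring

/-- Effective potentials differ by a multiple of r⁻², so the slope at fixed r rises when |G| is
lowered and falls when |G| is raised. -/
theorem hasDerivAt_effPot (hV : AnalyticOnNhd ℝ V (Ioi 0)) (G G' : ℝ) {r : ℝ} (hr : 0 < r) :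
    HasDerivAt (effPot V G') (deriv (effPot V G) r + (G ^ 2 - G' ^ 2) / r ^ 3) r := by
  have h1 := (analyticOnNhd_effPot hV G r hr).differentiableAt.hasDerivAt
  have h2 := ((hasDerivAt_pow 2 r).inv (pow_ne_zero 2 hr.ne')).const_mul ((G' ^ 2 - G ^ 2) / 2)
  have h3 := h1.add h2
  have h4 : (effPot V G + fun y => (G' ^ 2 - G ^ 2) / 2 * (fun x : ℝ => x ^ 2)⁻¹ y) = effPot V G' := by
    funext y
    rw [effPot_eq_add V G G']
    rfl
  rw [h4] at h3
  refine h3.congr_deriv ?_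
  have hr' := hr.ne'
  have h5 : ((2 : ℕ) : ℝ) * r ^ (2 - 1) = 2 * r := by norm_num
  rw [h5]
  field_simp
  ring

theorem continuous_effPot_momentum (V : ℝ → ℝ) (r : ℝ) : Continuous fun G => effPot V G r := by
  unfold effPot
  fun_prop

/-- If all nearby levels are potential wells, the turning points of the level `E` of the effective
potential with nonzero angular momentum are not critical. -/
theorem deriv_effPot_ne_zero (hV : AnalyticOnNhd ℝ V (Ioi 0)) {G E a b : ℝ} (hG : G ≠ 0)
    (hwell : IsPotentialWell (Ioi 0) (effPot V G) E a b)
    (hnear : ∀ᶠ p : ℝ × ℝ in 𝓝 (E, G), ∃ a' b', IsPotentialWell (Ioi 0) (effPot V p.2) p.1 a' b') :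
    deriv (effPot V G) a ≠ 0 ∧ deriv (effPot V G) b ≠ 0 := by
  have hscale : ∀ k : ℝ, Tendsto (fun s : ℝ => G * (1 + k * s)) (𝓝[>] 0) (𝓝 G) := fun k => by
    have : Continuous fun s : ℝ => G * (1 + k * s) := by fun_prop
    simpa using (this.tendsto 0).mono_left nhdsWithin_le_nhds
  have hlim : ∀ k r, Tendsto (fun s : ℝ => effPot V (G * (1 + k * s)) r) (𝓝[>] 0)
      (𝓝 (effPot V G r)) := fun k r =>
    ((continuous_effPot_momentum V r).tendsto G).comp (hscale k)
  have hG2 : 0 < G ^ 2 := by positivity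
  -- The energy is moved together with the momentum so that r stays on the level; r is then an
  -- endpoint of the new well.
  have hwell' : ∀ k r, effPot V G r = E → ∀ᶠ s : ℝ in 𝓝[>] 0,
      ∃ a' b', IsPotentialWell (Ioi 0) (effPot V (G * (1 + k * s)))
        (effPot V (G * (1 + k * s)) r) a' b' := fun k r hr => by
    have h1 := (hlim k r).prodMk_nhds (hscale k)
    rw [hr] at h1
    exact h1.eventually hnear
  constructor
  -- Lowering |G| by the factor 1 - s makes the slope at the critical point a positive, so a is not
  -- the new left end. If a fixed interior point x > a stayed below the new energy, a could not be
  -- the right end either. Hence x never lies below, and s → 0 contradicts W(x) < E.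
  · intro hd
    have ha : 0 < a := hwell.left_mem
    obtain ⟨x, hx⟩ := exists_between hwell.lt
    refine absurd (hwell.inside x hx) (not_lt.2 ?_)
    rw [← hwell.left]
    refine le_of_tendsto_of_tendsto (hlim (-1) a) (hlim (-1) x) ?_
    filter_upwards [hwell' (-1) a hwell.left, Ioo_mem_nhdsGT (show (0 : ℝ) < 1 by norm_num)]
      with s ⟨a', b', h⟩ hs
    by_contra! hlt
    have h1 := h.left_le (lt_trans ha hx.1) hlt.le
    rcases h.eq_endpoint ha rfl with rfl | rfl
    · have h2 := h.deriv_left_nonpos (hasDerivAt_effPot hV G _ ha)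
      rw [hd, zero_add] at h2
      have h3 : 0 < G ^ 2 - (G * (1 + -1 * s)) ^ 2 := by
        have : G ^ 2 - (G * (1 + -1 * s)) ^ 2 = G ^ 2 * (s * (2 - s)) := by ring
        rw [this]
        exact mul_pos hG2 (mul_pos hs.1 (by linarith [hs.2]))
      exact absurd h2 (not_le.2 (by positivity))
    · linarith [hx.1, h1.2]
  -- The mirror argument: raising |G| by 1 + s makes the slope at b negative, which is excluded at a
  -- right end.
  · intro hd
    have hb : 0 < b := hwell.right_mem
    have ha : 0 < a := hwell.left_mem
    obtain ⟨x, hx⟩ := exists_between hwell.lt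
    refine absurd (hwell.inside x hx) (not_lt.2 ?_)
    rw [← hwell.right]
    refine le_of_tendsto_of_tendsto (hlim 1 b) (hlim 1 x) ?_
    filter_upwards [hwell' 1 b hwell.right, Ioo_mem_nhdsGT (show (0 : ℝ) < 1 by norm_num)]
      with s ⟨a', b', h⟩ hs
    by_contra! hlt
    have h1 := h.left_le (lt_trans ha hx.1) hlt.le
    rcases h.eq_endpoint hb rfl with rfl | rfl
    · linarith [hx.2, h1.1]
    · have h2 := h.deriv_right_nonneg (hasDerivAt_effPot hV G _ hb)
      rw [hd, zero_add] at h2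
      have h3 : G ^ 2 - (G * (1 + 1 * s)) ^ 2 < 0 := by
        have : G ^ 2 - (G * (1 + 1 * s)) ^ 2 = -(G ^ 2 * (s * (2 + s))) := by ring
        rw [this]
        exact neg_neg_of_pos (mul_pos hG2 (mul_pos hs.1 (by linarith [hs.1])))
      exact absurd h2 (not_le.2 (div_neg_of_neg_of_pos h3 (by positivity)))

theorem radialAction_neg (V : ℝ → ℝ) (h G : ℝ) : radialAction V h (-G) = radialAction V h G := by
  have : effPot V (-G) = effPot V G := by
    funext r
    simp [effPot]
  rw [radialAction, radialAction, this]

/-- Two local inverses of the action map agree near the base point if one is continuous. -/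
theorem IsLocalEnergyMap.eventuallyEq {h G : ℝ} {F F' : EuclideanSpace ℝ (Fin 2) → ℝ}
    (hF : IsLocalEnergyMap V h G F) (hF' : IsLocalEnergyMap V h G F')
    (hc : ContinuousAt F' !₂[radialAction V h G, G]) :
    F =ᶠ[𝓝 !₂[radialAction V h G, G]] F' := by
  have h0 : F' !₂[radialAction V h G, G] = h := hF'.left_inv.self_of_nhds
  have h1 : Tendsto (fun q : EuclideanSpace ℝ (Fin 2) => (F' q, q 1))
      (𝓝 !₂[radialAction V h G, G]) (𝓝 (h, G)) := by
    refine Tendsto.prodMk_nhds ?_ ?_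
    · rw [ContinuousAt, h0] at hc
      exact hc
    · have : Continuous fun q : EuclideanSpace ℝ (Fin 2) => q 1 := by fun_prop
      exact this.tendsto _
  -- Continuity of `F'` puts (F' q, q₁) near (h, G). The left inverse property of `F` is applied at
  -- that point, whose action is q₀ by the right inverse property of `F'`.
  filter_upwards [h1.eventually hF.left_inv, hF'.right_inv] with q hq1 hq2
  rw [hq2] at hq1
  rw [← hq1]
  congr 1
  ext i
  fin_cases i <;> rfl

/-- At zero angular momentum the frequency of the angle conjugate to `G` vanishes. -/
theorem IsLocalEnergyMap.gradient_eq_zero {h : ℝ} {F : EuclideanSpace ℝ (Fin 2) → ℝ}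
    (hF : IsLocalEnergyMap V h 0 F) (hd : DifferentiableAt ℝ F !₂[radialAction V h 0, 0]) :
    gradient F !₂[radialAction V h 0, 0] 1 = 0 := by
  set q₀ : EuclideanSpace ℝ (Fin 2) := !₂[radialAction V h 0, 0] with hq₀
  have h0 : F q₀ = h := hF.left_inv.self_of_nhds
  have h1 : Tendsto (fun q : EuclideanSpace ℝ (Fin 2) => (F q, -(q 1))) (𝓝 q₀) (𝓝 (h, 0)) := by
    refine Tendsto.prodMk_nhds ?_ ?_
    · have := hd.continuousAt
      rwa [ContinuousAt, h0] at this
    · have : Continuous fun q : EuclideanSpace ℝ (Fin 2) => -(q 1) := by fun_prop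
      have h2 := this.tendsto q₀
      simpa [hq₀] using h2
  -- The radial action is even in G, so its local inverse is too; the derivative of an even function
  -- vanishes at 0.
  have heven : ∀ᶠ q in 𝓝 q₀, F !₂[q 0, -(q 1)] = F q := by
    filter_upwards [h1.eventually hF.left_inv, hF.right_inv] with q hq1 hq2
    simp only [radialAction_neg] at hq1
    rwa [hq2] at hq1
  rw [gradient_apply_eq_fderiv]
  set e : EuclideanSpace ℝ (Fin 2) := EuclideanSpace.single 1 (1 : ℝ) with he
  have hline : HasDerivAt (fun t : ℝ => F (q₀ + t • e)) (fderiv ℝ F q₀ e) 0 := by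
    have h2 : HasDerivAt (fun t : ℝ => q₀ + t • e) e 0 := by
      simpa using ((hasDerivAt_id (0 : ℝ)).smul_const e).const_add q₀
    have h3 : HasFDerivAt F (fderiv ℝ F q₀) (q₀ + (0 : ℝ) • e) := by
      simpa using hd.hasFDerivAt
    exact h3.comp_hasDerivAt (0 : ℝ) h2
  have hneg : HasDerivAt (fun t : ℝ => F (q₀ + (-t) • e)) (-(fderiv ℝ F q₀ e)) 0 := by
    have h2 : HasDerivAt (fun t : ℝ => F (q₀ + t • e)) (fderiv ℝ F q₀ e) (-0) := by
      simpa using hline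
    have h3 := h2.comp (0 : ℝ) (hasDerivAt_neg (0 : ℝ))
    rwa [mul_neg_one] at h3
  have heq : (fun t : ℝ => F (q₀ + (-t) • e)) =ᶠ[𝓝 0] fun t : ℝ => F (q₀ + t • e) := by
    have hc : Tendsto (fun t : ℝ => q₀ + t • e) (𝓝 0) (𝓝 q₀) := by
      have : Continuous fun t : ℝ => q₀ + t • e := by fun_prop
      simpa using this.tendsto 0
    filter_upwards [hc.eventually heven] with t ht
    rw [← ht]
    congr 1
    ext i
    fin_cases i <;> simp [hq₀, he]
  have := (hneg.congr_of_eventuallyEq heq.symm).unique hline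
  linarith

/-- The Diophantine bound for the j-th unit vector is a positive lower bound for |ξⱼ|. -/
theorem IsDiophantine.apply_ne_zero {N : ℕ} {ξ : EuclideanSpace ℝ (Fin N)} (h : IsDiophantine ξ)
    (j : Fin N) : ξ j ≠ 0 := by
  obtain ⟨γ, τ, hγ, -, hξ⟩ := h
  intro h0
  have := hξ (Pi.single j 1) (by simp)
  simp [Pi.single_apply, apply_ite, h0] at this
  linarith

theorem IsLocalDiffeomorphAt.fderiv_eq_zero {F : Type*} [NormedAddCommGroup F] [NormedSpace ℝ F]
    {f : F → F} {x : F} (h : IsLocalDiffeomorphAt 𝓘(ℝ, F) 𝓘(ℝ, F) 1 f x) {v : F}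
    (hv : fderiv ℝ f x v = 0) : v = 0 := by
  have h1 := h.mfderivToContinuousLinearEquiv_coe one_ne_zero
  rw [mfderiv_eq_fderiv] at h1
  have h2 : h.mfderivToContinuousLinearEquiv one_ne_zero v = 0 :=
    (DFunLike.congr_fun h1 v).trans hv
  exact (h.mfderivToContinuousLinearEquiv one_ne_zero).map_eq_zero_iff.1 h2

end EffectivePotential

/-! ### The angle conjugate to the action, and the correction of the polar angle. -/

namespace OrbitFamily

open Metric Set Filter Topology

variable {U : Set ℂ} {u w : ℂ → ℂ} {E₀ G₀ : ℝ} (O : OrbitFamily U u w E₀ G₀)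

/-- The angle conjugate to the action variable. -/
def angle (z : ℂ × ℂ × ℂ) : ℂ := 2 * Real.pi * O.time z / O.period z.2

/-- The periodic correction that makes the angle conjugate to `G` symplectic. -/
def node (z : ℂ × ℂ × ℂ) : ℂ := O.totalShift z.2 * O.time z / O.period z.2 - O.shift z

/-- A smaller strip on which the angle is a well defined coordinate along the orbits. -/
structure IsAngleStrip (δ : ℝ) : Prop where
  pos : 0 < δ
  le : δ ≤ O.ε
  period : ∀ p ∈ ball ((E₀ : ℂ), (G₀ : ℂ)) δ, 0 < (O.period p).re
  rate : ∀ z ∈ strip δ ((E₀ : ℂ), (G₀ : ℂ)), 0 < (O.κ z / O.period z.2).re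

/-- At real points over the base parameters κ and T are positive; openness and periodicity give a
uniform complex strip. -/
theorem exists_isAngleStrip : ∃ δ, O.IsAngleStrip δ := by
  have hT : ContinuousOn (fun z : ℂ × ℂ × ℂ => O.period z.2) O.dom :=
    O.diff_period.continuousOn.comp continuousOn_snd fun z hz => hz.2
  have h0 : ((E₀ : ℂ), (G₀ : ℂ)) ∈ ball ((E₀ : ℂ), (G₀ : ℂ)) O.ε := mem_ball_self O.ε_pos
  set D : Set (ℂ × ℂ × ℂ) := O.dom ∩ {z | 0 < (O.period z.2).re} with hD
  have hDo : IsOpen D :=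
    (Complex.continuous_re.comp_continuousOn hT).isOpen_inter_preimage O.isOpen_dom isOpen_Ioi
  have hq : ContinuousOn (fun z : ℂ × ℂ × ℂ => (O.κ z / O.period z.2).re) D := by
    refine Complex.continuous_re.comp_continuousOn
      ((O.diff_κ.continuousOn.mono inter_subset_left).div (hT.mono inter_subset_left) fun z hz h => ?_)
    have := hz.2
    simp [h] at this
  have hOo := hq.isOpen_inter_preimage hDo (isOpen_Ioi (a := (0 : ℝ)))
  obtain ⟨δ, hδ, hsub⟩ := exists_strip_subset (p₀ := ((E₀ : ℂ), (G₀ : ℂ))) hOo (fun s p => by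
      simp only [hD, mem_inter_iff, mem_preimage, mem_ofPred_eq, dom, strip, O.periodic_κ]
      simp) (fun x => by
      refine ⟨⟨O.ofReal_mem_dom x h0, O.period_re_pos h0⟩, ?_⟩
      have h1 := O.pos_κ x E₀ G₀ h0
      have h2 := O.period_re_pos h0
      simp only [mem_preimage, mem_Ioi]
      rw [O.κ_ofReal h0, show O.period ((E₀ : ℂ), (G₀ : ℂ)) = ((O.period (E₀, G₀)).re : ℂ) from
        Complex.ext rfl (by simpa using O.period_im h0), ← Complex.ofReal_div, Complex.ofReal_re]
      positivity)
  refine ⟨min δ O.ε, lt_min hδ O.ε_pos, min_le_right _ _, fun p hp => ?_, fun z hz => ?_⟩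
  · have := hsub (strip_mono (min_le_left _ _) _ (ofReal_mem_strip 0 hp))
    exact this.1.2
  · exact (hsub (strip_mono (min_le_left _ _) _ hz)).2

namespace IsAngleStrip

variable {O} {δ : ℝ} (h : O.IsAngleStrip δ)

include h

theorem subset : strip δ ((E₀ : ℂ), (G₀ : ℂ)) ⊆ O.dom := strip_mono h.le _

theorem ball_subset : ball ((E₀ : ℂ), (G₀ : ℂ)) δ ⊆ ball ((E₀ : ℂ), (G₀ : ℂ)) O.ε :=
  ball_subset_ball h.le

theorem period_ne_zero {p : ℂ × ℂ} (hp : p ∈ ball ((E₀ : ℂ), (G₀ : ℂ)) δ) : O.period p ≠ 0 := by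
  intro h0
  have := h.period p hp
  simp [h0] at this

theorem κ_ne_zero {z : ℂ × ℂ × ℂ} (hz : z ∈ strip δ ((E₀ : ℂ), (G₀ : ℂ))) : O.κ z ≠ 0 := by
  intro h0
  have := h.rate z hz
  simp [h0] at this

theorem hasFDerivAt_time {z : ℂ × ℂ × ℂ} (hz : z ∈ strip δ ((E₀ : ℂ), (G₀ : ℂ))) :
    HasFDerivAt O.time (fderiv ℂ O.time z) z :=
  (O.diff_time.differentiableAt (O.isOpen_dom.mem_nhds (h.subset hz))).hasFDerivAt

theorem hasFDerivAt_period {z : ℂ × ℂ × ℂ} (hz : z ∈ strip δ ((E₀ : ℂ), (G₀ : ℂ))) :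
    HasFDerivAt (fun z : ℂ × ℂ × ℂ => O.period z.2)
      ((fderiv ℂ O.period z.2).comp (ContinuousLinearMap.snd ℂ ℂ (ℂ × ℂ))) z :=
  HasFDerivAt.comp z
    (O.diff_period.differentiableAt (isOpen_ball.mem_nhds (h.ball_subset hz.2))).hasFDerivAt
    hasFDerivAt_snd

theorem hasFDerivAt_angle {z : ℂ × ℂ × ℂ} (hz : z ∈ strip δ ((E₀ : ℂ), (G₀ : ℂ))) :
    HasFDerivAt O.angle ((2 * Real.pi / O.period z.2 : ℂ) • fderiv ℂ O.time z -
      (2 * Real.pi * O.time z / O.period z.2 ^ 2 : ℂ) •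
        (fderiv ℂ O.period z.2).comp (ContinuousLinearMap.snd ℂ ℂ (ℂ × ℂ))) z := by
  have hT := h.period_ne_zero hz.2
  have h1 := ((h.hasFDerivAt_time hz).const_mul (2 * Real.pi : ℂ)).mul
    ((hasDerivAt_inv hT).comp_hasFDerivAt z (h.hasFDerivAt_period hz))
  refine (h1.congr_fderiv ?_).congr_of_eventuallyEq (Eventually.of_forall fun y => ?_)
  · ext <;> simp <;> field_simp <;> ring
  · simp [angle, div_eq_mul_inv]

theorem hasFDerivAt_node (hu : DifferentiableOn ℂ u U) {z : ℂ × ℂ × ℂ}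
    (hz : z ∈ strip δ ((E₀ : ℂ), (G₀ : ℂ))) :
    HasFDerivAt O.node ((O.totalShift z.2 / O.period z.2) • fderiv ℂ O.time z +
      (O.time z / O.period z.2) •
        (fderiv ℂ O.totalShift z.2).comp (ContinuousLinearMap.snd ℂ ℂ (ℂ × ℂ)) -
      (O.totalShift z.2 * O.time z / O.period z.2 ^ 2) •
        (fderiv ℂ O.period z.2).comp (ContinuousLinearMap.snd ℂ ℂ (ℂ × ℂ)) -
      fderiv ℂ O.shift z) z := by
  have hT := h.period_ne_zero hz.2
  have hS : HasFDerivAt (fun z : ℂ × ℂ × ℂ => O.totalShift z.2)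
      ((fderiv ℂ O.totalShift z.2).comp (ContinuousLinearMap.snd ℂ ℂ (ℂ × ℂ))) z :=
    HasFDerivAt.comp z ((O.diff_totalShift hu).differentiableAt
      (isOpen_ball.mem_nhds (h.ball_subset hz.2))).hasFDerivAt hasFDerivAt_snd
  have hs : HasFDerivAt O.shift (fderiv ℂ O.shift z) z :=
    ((O.diff_shift hu).differentiableAt (O.isOpen_dom.mem_nhds (h.subset hz))).hasFDerivAt
  have h1 := ((hS.mul (h.hasFDerivAt_time hz)).mul
    ((hasDerivAt_inv hT).comp_hasFDerivAt z (h.hasFDerivAt_period hz))).sub hs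
  refine (h1.congr_fderiv ?_).congr_of_eventuallyEq (Eventually.of_forall fun y => ?_)
  · ext <;> simp <;> field_simp <;> ring
  · simp [node, div_eq_mul_inv]

theorem diff_angle : DifferentiableOn ℂ O.angle (strip δ ((E₀ : ℂ), (G₀ : ℂ))) := fun _ hz =>
  (h.hasFDerivAt_angle hz).differentiableAt.differentiableWithinAt

theorem fderiv_angle_fst {z : ℂ × ℂ × ℂ} (hz : z ∈ strip δ ((E₀ : ℂ), (G₀ : ℂ))) :
    fderiv ℂ O.angle z (1, 0) = 2 * Real.pi * (O.κ z / O.period z.2) := by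
  rw [(h.hasFDerivAt_angle hz).fderiv]
  simp [O.fderiv_time (h.subset hz)]
  ring

/-- The s-derivative 2πκ/T has positive real part on a convex strip. -/
theorem angle_injective {s s' : ℂ} {p : ℂ × ℂ} (hs : (s, p) ∈ strip δ ((E₀ : ℂ), (G₀ : ℂ)))
    (hs' : (s', p) ∈ strip δ ((E₀ : ℂ), (G₀ : ℂ))) (heq : O.angle (s, p) = O.angle (s', p)) :
    s = s' := by
  have hpi := Real.pi_pos
  refine (convex_strip_slice δ).injOn_of_re_deriv_pos (f := fun s => O.angle (s, p))
    (f' := fun s => 2 * Real.pi * (O.κ (s, p) / O.period p)) (fun x hx => ?_) (fun x hx => ?_)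
    hs.1 hs'.1 heq
  · have hz : (x, p) ∈ strip δ ((E₀ : ℂ), (G₀ : ℂ)) := ⟨hx, hs.2⟩
    have := hasDerivAt_slice (isOpen_strip _ _) h.diff_angle hz
    rwa [h.fderiv_angle_fst hz] at this
  · have := h.rate (x, p) ⟨hx, hs.2⟩
    rw [← Complex.ofReal_ofNat, ← Complex.ofReal_mul, Complex.re_ofReal_mul]
    positivity

/-- At fixed G, ∂L/∂E = T/2π has positive real part on a convex disc. -/
theorem actionVar_injective (hU : IsOpen U) (hu : DifferentiableOn ℂ u U)
    (hw : DifferentiableOn ℂ w U) {E E' G : ℂ} (hE : (E, G) ∈ ball ((E₀ : ℂ), (G₀ : ℂ)) δ)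
    (hE' : (E', G) ∈ ball ((E₀ : ℂ), (G₀ : ℂ)) δ) (heq : O.actionVar (E, G) = O.actionVar (E', G)) :
    E = E' := by
  have hpi := Real.pi_pos
  have hconv : Convex ℝ (ball (E₀ : ℂ) δ) := convex_ball _ _
  rw [← ball_prod_same] at hE hE'
  have hm : ∀ x ∈ ball (E₀ : ℂ) δ, (x, G) ∈ ball ((E₀ : ℂ), (G₀ : ℂ)) δ := fun x hx => by
    rw [← ball_prod_same]
    exact ⟨hx, hE.2⟩
  refine hconv.injOn_of_re_deriv_pos (f := fun E => O.actionVar (E, G))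
    (f' := fun E => O.period (E, G) / (2 * Real.pi)) (fun x hx => ?_) (fun x hx => ?_)
    hE.1 hE'.1 heq
  · have := hasDerivAt_slice isOpen_ball O.diff_actionVar (h.ball_subset (hm x hx))
    rwa [O.hasFDerivAt_actionVar hU hu hw (h.ball_subset (hm x hx)), mul_one, mul_zero,
      sub_zero] at this
  · have := h.period (x, G) (hm x hx)
    rw [← Complex.ofReal_ofNat, ← Complex.ofReal_mul, Complex.div_ofReal_re]
    positivity

/-- Expanding d(angle) ∧ dL + d(node) ∧ dG gives dt ∧ dE - dS ∧ dG plus the error -(t/T)(dT ∧ dE -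
dΣ ∧ dG), which vanishes because T dE - Σ dG is closed. -/
theorem twoForm_eq (hU : IsOpen U) (hu : DifferentiableOn ℂ u U) (hw : DifferentiableOn ℂ w U)
    {z : ℂ × ℂ × ℂ} (hz : z ∈ strip δ ((E₀ : ℂ), (G₀ : ℂ))) (a b : ℂ × ℂ × ℂ) :
    fderiv ℂ O.X z a * fderiv ℂ O.R z b - fderiv ℂ O.X z b * fderiv ℂ O.R z a =
      (fderiv ℂ O.angle z a * fderiv ℂ O.actionVar z.2 b.2 -
        fderiv ℂ O.angle z b * fderiv ℂ O.actionVar z.2 a.2) +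
      (fderiv ℂ O.node z a * b.2.2 - fderiv ℂ O.node z b * a.2.2) := by
  have hT := h.period_ne_zero hz.2
  have hpi : (Real.pi : ℂ) ≠ 0 := by exact_mod_cast Real.pi_ne_zero
  have hsym := O.fderiv_period_symm hU hu hw (h.ball_subset hz.2) a.2 b.2
  rw [O.twoForm hU hu hw (h.subset hz), (h.hasFDerivAt_angle hz).fderiv,
    (h.hasFDerivAt_node hu hz).fderiv, O.hasFDerivAt_actionVar hU hu hw (h.ball_subset hz.2),
    O.hasFDerivAt_actionVar hU hu hw (h.ball_subset hz.2)]
  simp only [sub_apply, add_apply, smul_apply, ContinuousLinearMap.comp_apply,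
    ContinuousLinearMap.coe_snd', smul_eq_mul]
  field_simp
  linear_combination (O.time z * O.period z.2) * hsym

theorem angle_add_two_pi {s : ℂ} {p : ℂ × ℂ} (hz : (s, p) ∈ strip δ ((E₀ : ℂ), (G₀ : ℂ))) :
    O.angle (s + 2 * Real.pi, p) = O.angle (s, p) + 2 * Real.pi := by
  have hT := h.period_ne_zero hz.2
  simp only [angle]
  rw [O.time_add_two_pi (h.subset hz)]
  simp only at hT
  field_simp

/-- Per turn Σt/T gains Σ, exactly the increment of the shift; the factor Σ/T is chosen for this. -/
theorem node_add_two_pi (hu : DifferentiableOn ℂ u U) {s : ℂ} {p : ℂ × ℂ}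
    (hz : (s, p) ∈ strip δ ((E₀ : ℂ), (G₀ : ℂ))) :
    O.node (s + 2 * Real.pi, p) = O.node (s, p) := by
  have hT := h.period_ne_zero hz.2
  simp only [node]
  rw [O.time_add_two_pi (h.subset hz), O.shift_add_two_pi hu (h.subset hz)]
  simp only at hT
  field_simp
  ring

end IsAngleStrip

/-- Iteration of a translation rule on a strip. -/
theorem add_int_mul_two_pi {δ : ℝ} {p₀ : ℂ × ℂ} {f : ℂ × ℂ × ℂ → ℂ} {c : ℂ}
    (hf : ∀ s p, (s, p) ∈ strip δ p₀ → f (s + 2 * Real.pi, p) = f (s, p) + c) (k : ℤ) :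
    ∀ s p, (s, p) ∈ strip δ p₀ → f (s + 2 * Real.pi * k, p) = f (s, p) + c * k := by
  have hmem : ∀ (k : ℤ) s p, (s, p) ∈ strip δ p₀ → (s + 2 * Real.pi * k, p) ∈ strip δ p₀ := by
    intro k s p hz
    refine ⟨?_, hz.2⟩
    have : (s + 2 * Real.pi * k : ℂ).im = s.im := by simp
    rw [this]
    exact hz.1
  induction k with
  | zero => intro s p _; simp
  | succ k ih =>
    intro s p hz
    have h1 := hf _ _ (hmem k s p hz)
    rw [ih s p hz] at h1
    push_cast at h1 ⊢
    rw [show s + 2 * Real.pi * ((k : ℂ) + 1) = s + 2 * Real.pi * k + 2 * Real.pi by ring, h1]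
    ring
  | pred k ih =>
    intro s p hz
    have h1 := hf _ _ (hmem (-k - 1) s p hz)
    have h2 := ih s p hz
    push_cast at h1 h2 ⊢
    rw [show s + 2 * Real.pi * (-(k : ℂ) - 1) + 2 * Real.pi = s + 2 * Real.pi * (-(k : ℂ)) by ring,
      h2] at h1
    linear_combination -h1

section Real

variable {O} {δ : ℝ} (h : O.IsAngleStrip δ) {E G : ℝ}
  (hp : ((E : ℂ), (G : ℂ)) ∈ ball ((E₀ : ℂ), (G₀ : ℂ)) δ)

include h hp

theorem IsAngleStrip.period_real : O.period (E, G) = ((O.period (E, G)).re : ℂ) :=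
  Complex.ext rfl (by simpa using O.period_im (h.ball_subset hp))

theorem IsAngleStrip.angle_im (s : ℝ) : (O.angle (s, E, G)).im = 0 := by
  simp only [angle]
  rw [h.period_real hp, O.time_ofReal (h.ball_subset hp), ← Complex.ofReal_ofNat,
    ← Complex.ofReal_mul, ← Complex.ofReal_mul, ← Complex.ofReal_div, Complex.ofReal_im]

theorem IsAngleStrip.node_im (hur : ∀ x : ℝ, (x : ℂ) ∈ U → (u x).im = 0) (s : ℝ) :
    (O.node (s, E, G)).im = 0 := by
  simp only [node]
  rw [show O.totalShift ((E : ℂ), (G : ℂ)) = ((O.totalShift (E, G)).re : ℂ) from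
    Complex.ext rfl (by simpa using O.totalShift_im (h.ball_subset hp) hur), h.period_real hp,
    O.time_ofReal (h.ball_subset hp), Complex.sub_im, O.shift_im (h.ball_subset hp) hur,
    ← Complex.ofReal_mul, ← Complex.ofReal_div, Complex.ofReal_im, sub_zero]

theorem actionVar_im : (O.actionVar (E, G)).im = 0 := by
  have h1 := O.action_ofReal (h.ball_subset hp) (2 * Real.pi)
  push_cast at h1
  rw [actionVar, h1, ← Complex.ofReal_ofNat, ← Complex.ofReal_mul, ← Complex.ofReal_div,
    Complex.ofReal_im]

/-- The real angle is continuous and gains 2π per turn, hence is unbounded in both directions. -/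
theorem IsAngleStrip.angle_surjective (φ : ℝ) : ∃ s : ℝ, O.angle (s, E, G) = φ := by
  have hpi := Real.two_pi_pos
  have hz : ∀ s : ℝ, ((s : ℂ), (E : ℂ), (G : ℂ)) ∈ strip δ ((E₀ : ℂ), (G₀ : ℂ)) := fun s =>
    ofReal_mem_strip s hp
  set f : ℝ → ℝ := fun s => (O.angle (s, E, G)).re with hf
  have hc : Continuous f := Complex.continuous_re.comp
    (h.diff_angle.continuousOn.comp_continuous (by fun_prop) hz)
  have hf' : ∀ s : ℝ, O.angle (s, E, G) = f s := fun s =>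
    Complex.ext rfl (by simpa using h.angle_im hp s)
  have hint : ∀ k : ℤ, f (2 * Real.pi * k) = f 0 + 2 * Real.pi * k := by
    intro k
    have h1 := add_int_mul_two_pi (fun s p hz => h.angle_add_two_pi hz) k 0 _
      (by simpa using hz 0)
    have h2 := hf' (2 * Real.pi * k)
    push_cast at h2
    rw [zero_add, h2, show ((0 : ℂ), (E : ℂ), (G : ℂ)) = (((0 : ℝ) : ℂ), (E : ℂ), (G : ℂ)) by simp,
      hf' 0] at h1
    exact_mod_cast h1
  obtain ⟨n, hn⟩ := exists_nat_ge (|φ - f 0| / (2 * Real.pi))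
  rw [div_le_iff₀ hpi] at hn
  have h1 := hint n
  have h2 := hint (-n)
  push_cast at h1 h2
  have h3 := abs_le.1 hn
  have hle : 2 * Real.pi * -(n : ℝ) ≤ 2 * Real.pi * n := by
    have : (0 : ℝ) ≤ 2 * Real.pi * n := by positivity
    linarith
  obtain ⟨s, -, hs⟩ := intermediate_value_Icc hle hc.continuousOn
    (show φ ∈ Icc _ _ by rw [h1, h2]; constructor <;> linarith)
  exact ⟨s, by rw [hf', hs]⟩

end Real

end OrbitFamily

/-- Orbit families near a level that is a potential well with nondegenerate turning points. -/
theorem IsPotentialWell.exists_orbitFamily {I : Set ℝ} {W : ℝ → ℝ} {E₀ G₀ a b : ℝ}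
    (hwell : IsPotentialWell I W E₀ a b) (hIo : IsOpen I)
    {U : Set ℂ} {u w : ℂ → ℂ} (hU : IsOpen U)
    (hu : DifferentiableOn ℂ u U) (hw : DifferentiableOn ℂ w U)
    (hur : ∀ x : ℝ, (x : ℂ) ∈ U → (u x).im = 0) (hwr : ∀ x : ℝ, (x : ℂ) ∈ U → (w x).im = 0)
    (hI : ∀ x : ℝ, x ∈ I ↔ (x : ℂ) ∈ U)
    (hW : ∀ x : ℝ, (x : ℂ) ∈ U → (G₀ : ℂ) ^ 2 * u x + w x = W x)
    (hda : deriv W a ≠ 0) (hdb : deriv W b ≠ 0) : Nonempty (OrbitFamily U u w E₀ G₀) := by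
  -- At real points the complex derivative of the extension restricts to the real derivative of `W`.
  have hd : ∀ x ∈ I, deriv W x ≠ 0 → (G₀ : ℂ) ^ 2 * deriv u x + deriv w x ≠ 0 := by
    intro x hx hne h0
    have hxU := (hI x).1 hx
    have h1 := ((hu.differentiableAt (hU.mem_nhds hxU)).hasDerivAt.const_mul ((G₀ : ℂ) ^ 2)).add
      (hw.differentiableAt (hU.mem_nhds hxU)).hasDerivAt
    have h2 := h1.real_of_complex
    rw [h0] at h2
    refine hne (HasDerivAt.deriv ?_)
    refine h2.congr_of_eventuallyEq ?_
    filter_upwards [hIo.mem_nhds hx] with y hy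
    have := hW y ((hI y).1 hy)
    simp [this]
  refine _root_.exists_orbitFamily hU hu hw hur hwr hwell.lt
    (fun x hx => (hI x).1 (hwell.subset hx)) ?_ ?_ ?_ (hd a hwell.left_mem hda)
    (hd b hwell.right_mem hdb)
  · rw [hW a ((hI a).1 hwell.left_mem), hwell.left]
  · rw [hW b ((hI b).1 hwell.right_mem), hwell.right]
  · intro x hx
    rw [hW x ((hI x).1 (hwell.subset (Set.Ioo_subset_Icc_self hx))), Complex.ofReal_re]
    exact hwell.inside x hx

/-! ### Componentwise derivatives in complex phase space. -/

section Coordinates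

open Metric Set Filter Topology

variable {N : ℕ}

theorem fderiv_fst_apply {f : CPhase N → CPhase N} {z : CPhase N} (hf : DifferentiableAt ℂ f z)
    {j : Fin N} {f' : CPhase N →L[ℂ] ℂ} (h : HasFDerivAt (fun y => (f y).1 j) f' z) (v : CPhase N) :
    (fderiv ℂ f z v).1 j = f' v := by
  set L : CPhase N →L[ℂ] ℂ := (EuclideanSpace.proj j : EuclideanSpace ℂ (Fin N) →L[ℂ] ℂ).comp
    (ContinuousLinearMap.fst ℂ _ _) with hL
  have h1 : HasFDerivAt (fun y => (f y).1 j) (L.comp (fderiv ℂ f z)) z :=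
    (L.hasFDerivAt (x := f z)).comp z hf.hasFDerivAt
  rw [← h1.unique h]
  rfl

theorem fderiv_snd_apply {f : CPhase N → CPhase N} {z : CPhase N} (hf : DifferentiableAt ℂ f z)
    {j : Fin N} {f' : CPhase N →L[ℂ] ℂ} (h : HasFDerivAt (fun y => (f y).2 j) f' z) (v : CPhase N) :
    (fderiv ℂ f z v).2 j = f' v := by
  set L : CPhase N →L[ℂ] ℂ := (EuclideanSpace.proj j : EuclideanSpace ℂ (Fin N) →L[ℂ] ℂ).comp
    (ContinuousLinearMap.snd ℂ _ _) with hL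
  have h1 : HasFDerivAt (fun y => (f y).2 j) (L.comp (fderiv ℂ f z)) z :=
    (L.hasFDerivAt (x := f z)).comp z hf.hasFDerivAt
  rw [← h1.unique h]
  rfl

theorem differentiableOn_cphase {f : CPhase N → CPhase N} {S : Set (CPhase N)}
    (h1 : ∀ j, DifferentiableOn ℂ (fun z => (f z).1 j) S)
    (h2 : ∀ j, DifferentiableOn ℂ (fun z => (f z).2 j) S) : DifferentiableOn ℂ f S :=
  (differentiableOn_euclidean.2 h1).prodMk (differentiableOn_euclidean.2 h2)

theorem norm_apply_le (x : EuclideanSpace ℂ (Fin N)) (j : Fin N) : ‖x j‖ ≤ ‖x‖ :=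
  PiLp.norm_apply_le x j

end Coordinates

/-! ### The angle-action pair on the line. -/

section Line

open Metric Set Filter Topology

variable {E₀ : ℝ}

/-- Angle and energy as coordinates on the line. -/
def lineLift (E₀ : ℝ) (z : CPhase 1) : ℂ × ℂ × ℂ := (z.1 0, E₀ + z.2 0, 0)

/-- The linear part of `lineLift`. -/
def lineLiftLin : CPhase 1 →L[ℂ] ℂ × ℂ × ℂ :=
  ((EuclideanSpace.proj 0 : EuclideanSpace ℂ (Fin 1) →L[ℂ] ℂ).comp
    (ContinuousLinearMap.fst ℂ _ _)).prod
    (((EuclideanSpace.proj 0 : EuclideanSpace ℂ (Fin 1) →L[ℂ] ℂ).comp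
      (ContinuousLinearMap.snd ℂ _ _)).prod 0)

theorem lineLiftLin_apply (v : CPhase 1) : lineLiftLin v = (v.1 0, v.2 0, 0) := rfl

theorem hasFDerivAt_lineLift (z : CPhase 1) : HasFDerivAt (lineLift E₀) lineLiftLin z := by
  have : lineLift E₀ = fun z => ((0 : ℂ), (E₀ : ℂ), (0 : ℂ)) + lineLiftLin z := by
    funext z
    simp [lineLift, lineLiftLin_apply]
  rw [this]
  exact lineLiftLin.hasFDerivAt.const_add _

theorem lineLift_mem {δ : ℝ} {z : CPhase 1} (hz : z ∈ torusBall 1 δ δ) :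
    lineLift E₀ z ∈ strip δ ((E₀ : ℂ), ((0 : ℝ) : ℂ)) := by
  have h2 := (norm_apply_le z.2 0).trans_lt hz.2
  refine ⟨hz.1 0, ?_⟩
  rw [← ball_prod_same]
  refine ⟨by simpa [lineLift, mem_ball_iff_norm] using h2, ?_⟩
  simpa [lineLift] using (norm_nonneg _).trans_lt h2

theorem lineLift_complexify (z : Phase 1) :
    lineLift E₀ (complexifyPhase z) = ((z.1 0 : ℂ), ((E₀ + z.2 0 : ℝ) : ℂ), ((0 : ℝ) : ℂ)) := by
  simp [lineLift, complexifyPhase]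

theorem mechHam_one (V : ℝ → ℝ) (z : Phase 1) :
    mechHam 1 V z = (z.2 0) ^ 2 / 2 + linePot V (z.1 0) := by
  have h : ∀ x : EuclideanSpace ℝ (Fin 1), ‖x‖ = |x 0| := fun x => by
    simp [EuclideanSpace.norm_eq, Real.sqrt_sq_eq_abs]
  rw [mechHam, h, h, sq_abs, linePot]
  ring

variable {U : Set ℂ} {w : ℂ → ℂ} (O : OrbitFamily U (fun _ => 0) w E₀ 0)

/-- Angle-action coordinates on the line. -/
def lineAngleAction (z : CPhase 1) : CPhase 1 :=
  (WithLp.toLp 2 fun _ => O.angle (lineLift E₀ z),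
    WithLp.toLp 2 fun _ => O.actionVar (lineLift E₀ z).2 - O.actionVar (E₀, (0 : ℝ)))

/-- Position and momentum on the line. -/
def lineCartesian (z : CPhase 1) : CPhase 1 :=
  (WithLp.toLp 2 fun _ => O.X (lineLift E₀ z), WithLp.toLp 2 fun _ => O.R (lineLift E₀ z))

variable {O} {δ : ℝ}

/-- This is the orbit family with u = 0 and G frozen at 0; the terms in dG disappear from the
two-form identity. -/
theorem lineAngleAction_isAngleActionPair (hδ : O.IsAngleStrip δ) (hU : IsOpen U)
    (hw : DifferentiableOn ℂ w U) {I : Set ℝ} {V : ℝ → ℝ} {a b : ℝ}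
    (hwell : IsPotentialWell I (linePot V) E₀ a b) (hI : ∀ x : ℝ, x ∈ I ↔ (x : ℂ) ∈ U)
    (hW : ∀ x : ℝ, (x : ℂ) ∈ U → w x = linePot V x) :
    IsAngleActionPair (linePhase I) (lineTorus V I E₀) δ (lineAngleAction O) (lineCartesian O) ∧
    (∀ z ∈ torusBall 1 δ δ, ∀ z' ∈ torusBall 1 δ δ,
      (lineAngleAction O z).2 = (lineAngleAction O z').2 → z.2 = z'.2) ∧
    (∀ z z' : Phase 1, ‖z.2‖ < δ → lineCartesian O (complexifyPhase z) = complexifyPhase z' →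
      mechHam 1 V z' = E₀ + z.2 0) := by
  have hu : DifferentiableOn ℂ (fun _ : ℂ => (0 : ℂ)) U := differentiableOn_const _
  have hW' : ∀ G : ℝ, ∀ x : ℝ, (x : ℂ) ∈ U → (G : ℂ) ^ 2 * (fun _ : ℂ => (0 : ℂ)) x + w x =
      linePot V x := fun G x hx => by simp [hW x hx]
  have hopen := isOpen_torusBall (N := 1) δ δ
  have hmem : ∀ z ∈ torusBall 1 δ δ, lineLift E₀ z ∈ strip δ ((E₀ : ℂ), ((0 : ℝ) : ℂ)) :=
    fun z hz => lineLift_mem hz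
  have hdom : ∀ z ∈ torusBall 1 δ δ, lineLift E₀ z ∈ O.dom := fun z hz => hδ.subset (hmem z hz)
  have hreal : ∀ z : Phase 1, ‖z.2‖ < δ →
      (((E₀ + z.2 0 : ℝ) : ℂ), ((0 : ℝ) : ℂ)) ∈ ball ((E₀ : ℂ), ((0 : ℝ) : ℂ)) δ := fun z hz => by
    have := (hmem _ (complexifyPhase_mem_torusBall hδ.pos hz)).2
    rwa [lineLift_complexify] at this
  have hlift : ∀ {f : ℂ × ℂ × ℂ → ℂ} {z : CPhase 1}, DifferentiableAt ℂ f (lineLift E₀ z) →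
      HasFDerivAt (fun z => f (lineLift E₀ z)) ((fderiv ℂ f (lineLift E₀ z)).comp lineLiftLin) z :=
    fun hf => hf.hasFDerivAt.comp _ (hasFDerivAt_lineLift _)
  have hdX : ∀ z ∈ torusBall 1 δ δ, DifferentiableAt ℂ O.X (lineLift E₀ z) := fun z hz =>
    O.diff_X.differentiableAt (O.isOpen_dom.mem_nhds (hdom z hz))
  have hdR : ∀ z ∈ torusBall 1 δ δ, DifferentiableAt ℂ O.R (lineLift E₀ z) := fun z hz =>
    O.diff_R.differentiableAt (O.isOpen_dom.mem_nhds (hdom z hz))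
  have hda : ∀ z ∈ torusBall 1 δ δ, DifferentiableAt ℂ O.angle (lineLift E₀ z) := fun z hz =>
    (hδ.hasFDerivAt_angle (hmem z hz)).differentiableAt
  have hdL : ∀ z ∈ torusBall 1 δ δ, HasFDerivAt
      (fun z => O.actionVar (lineLift E₀ z).2 - O.actionVar (E₀, (0 : ℝ)))
      ((fderiv ℂ O.actionVar (lineLift E₀ z).2).comp
        ((ContinuousLinearMap.snd ℂ ℂ (ℂ × ℂ)).comp lineLiftLin)) z := fun z hz => by
    have h1 : DifferentiableAt ℂ O.actionVar (lineLift E₀ z).2 :=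
      O.diff_actionVar.differentiableAt (isOpen_ball.mem_nhds (hδ.ball_subset (hmem z hz).2))
    have h2 : HasFDerivAt (fun z => (lineLift E₀ z).2)
        ((ContinuousLinearMap.snd ℂ ℂ (ℂ × ℂ)).comp lineLiftLin) z :=
      (ContinuousLinearMap.snd ℂ ℂ (ℂ × ℂ)).hasFDerivAt.comp z (hasFDerivAt_lineLift z)
    exact (h1.hasFDerivAt.comp z h2).sub_const _
  have hdA : DifferentiableOn ℂ (lineAngleAction O) (torusBall 1 δ δ) :=
    differentiableOn_cphase
      (fun _ z hz => (hlift (hda z hz)).differentiableAt.differentiableWithinAt)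
      (fun _ z hz => (hdL z hz).differentiableAt.differentiableWithinAt)
  have hdB : DifferentiableOn ℂ (lineCartesian O) (torusBall 1 δ δ) :=
    differentiableOn_cphase
      (fun _ z hz => (hlift (hdX z hz)).differentiableAt.differentiableWithinAt)
      (fun _ z hz => (hlift (hdR z hz)).differentiableAt.differentiableWithinAt)
  have hA2 : ∀ z ∈ torusBall 1 δ δ, ∀ z' ∈ torusBall 1 δ δ,
      (lineAngleAction O z).2 = (lineAngleAction O z').2 → z.2 = z'.2 := by
    intro z hz z' hz' h
    have h1 : O.actionVar (lineLift E₀ z).2 = O.actionVar (lineLift E₀ z').2 := by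
      have := congrArg (fun x : EuclideanSpace ℂ (Fin 1) => x 0) h
      simpa [lineAngleAction] using this
    have h2 := hδ.actionVar_injective hU hu hw (hmem z hz).2 (hmem z' hz').2 h1
    ext j
    fin_cases j
    exact add_left_cancel h2
  have hlift_eq : ∀ z z' : CPhase 1, z.2 = z'.2 → (lineLift E₀ z).2 = (lineLift E₀ z').2 :=
    fun z z' h => by simp [lineLift, h]
  have hen : ∀ z z' : Phase 1, ‖z.2‖ < δ → lineCartesian O (complexifyPhase z) = complexifyPhase z' →
      mechHam 1 V z' = E₀ + z.2 0 := by
    intro z z' hz h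
    have hp := hδ.ball_subset (hreal z hz)
    have h1 : O.X (z.1 0, ((E₀ + z.2 0 : ℝ) : ℂ), ((0 : ℝ) : ℂ)) = z'.1 0 := by
      rw [← lineLift_complexify]
      exact congrArg (fun y : CPhase 1 => y.1 0) h
    have h2 : O.R (z.1 0, ((E₀ + z.2 0 : ℝ) : ℂ), ((0 : ℝ) : ℂ)) = z'.2 0 := by
      rw [← lineLift_complexify]
      exact congrArg (fun y : CPhase 1 => y.2 0) h
    have h3 := O.energy_real hp (hW' 0) (z.1 0)
    rw [h1, h2, Complex.ofReal_re, Complex.ofReal_re] at h3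
    rw [mechHam_one, h3]
  have hB0 : ∀ θ : EuclideanSpace ℝ (Fin 1), lineLift E₀ (complexifyPhase (θ, 0)) =
      ((θ 0 : ℂ), (E₀ : ℂ), ((0 : ℝ) : ℂ)) := fun θ => by simp [lineLift_complexify]
  refine ⟨⟨hδ.pos, hdA, hdB, ?_, ?_, ?_, ?_, ?_, ?_, ?_, ?_, ?_, ?_, ?_⟩, hA2, hen⟩
  · intro z hz k
    have h1 := OrbitFamily.add_int_mul_two_pi (fun s p hz => hδ.angle_add_two_pi hz) (k 0) _ _ (hmem z hz)
    refine cphase_ext (fun j => ?_) fun j => rfl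
    fin_cases j
    exact h1
  · intro z hz k
    have h1 := OrbitFamily.add_int_mul_two_pi (f := O.X) (c := 0) (fun s p _ => by rw [O.periodic_X, add_zero])
      (k 0) _ _ (hmem z hz)
    have h2 := OrbitFamily.add_int_mul_two_pi (f := O.R) (c := 0) (fun s p _ => by rw [O.periodic_R, add_zero])
      (k 0) _ _ (hmem z hz)
    rw [zero_mul, add_zero] at h1 h2
    exact cphase_ext (fun j => h1) fun j => h2
  · intro z hz z' hz' h
    have h2 := hA2 z hz z' hz' (congrArg Prod.snd h)
    have h1 : O.angle (lineLift E₀ z) = O.angle (lineLift E₀ z') :=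
      congrArg (fun y : CPhase 1 => y.1 0) h
    have h3 : lineLift E₀ z = ((z.1 0, (lineLift E₀ z').2) : ℂ × ℂ × ℂ) :=
      Prod.ext rfl (hlift_eq z z' h2)
    have hm := hmem z hz
    rw [h3] at h1 hm
    have h4 := hδ.angle_injective hm (hmem z' hz') h1
    refine cphase_ext (fun j => ?_) fun j => by rw [h2]
    fin_cases j
    exact h4
  -- The derivative of `A` is triangular in (s, E), with diagonal entries 2πκ/T and T/2π, both
  -- nonzero.
  · intro z hz v hv
    have hd := hdA.differentiableAt (hopen.mem_nhds hz)
    have h1 := fderiv_fst_apply (j := 0) hd (hlift (hda z hz)) v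
    have h2 := fderiv_snd_apply (j := 0) hd (hdL z hz) v
    rw [hv] at h1 h2
    simp only [ContinuousLinearMap.comp_apply, lineLiftLin_apply, ContinuousLinearMap.coe_snd'] at h1 h2
    rw [O.hasFDerivAt_actionVar hU hu hw (hδ.ball_subset (hmem z hz).2)] at h2
    have hT := hδ.period_ne_zero (hmem z hz).2
    have hκ := hδ.κ_ne_zero (hmem z hz)
    have hv2 : v.2 0 = 0 := by
      have h2' : (0 : ℂ) = O.period (lineLift E₀ z).2 * v.2 0 / (2 * Real.pi) := by
        simpa using h2
      have h3 := (div_eq_zero_iff.1 h2'.symm).resolve_right (by simp)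
      exact (mul_eq_zero.1 h3).resolve_left hT
    have hv1 : v.1 0 = 0 := by
      rw [hv2, show ((v.1 0, (0 : ℂ), (0 : ℂ)) : ℂ × ℂ × ℂ) = v.1 0 • (1, 0) by simp, map_smul,
        hδ.fderiv_angle_fst (hmem z hz), smul_eq_mul] at h1
      have h3 := mul_eq_zero.1 h1.symm
      exact h3.resolve_right (mul_ne_zero (by simp) (div_ne_zero hκ hT))
    refine cphase_ext (fun j => ?_) fun j => ?_ <;> fin_cases j
    exacts [hv1, hv2]
  · intro z hz
    have hp := hreal z hz
    have h1 := hδ.angle_im hp (z.1 0)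
    have h2 := OrbitFamily.actionVar_im hδ hp
    have h3 := OrbitFamily.actionVar_im hδ (mem_ball_self hδ.pos)
    rw [← lineLift_complexify] at h1
    refine ⟨_, (complexifyPhase_rePhase (cphase_ext (fun j => ?_) fun j => ?_)).symm⟩
    · exact Complex.conj_eq_iff_im.2 h1
    · refine Complex.conj_eq_iff_im.2 ?_
      simp only [lineAngleAction, lineLift_complexify, Complex.sub_im, h3, h2, sub_zero]
  · intro z hz
    have hp := hδ.ball_subset (hreal z hz)
    have h1 := O.real_X (z.1 0) _ _ hp
    have h2 := O.real_R (z.1 0) _ _ hp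
    have h3 := O.X_mem_real hp (hW' 0) hI (z.1 0)
    rw [← lineLift_complexify] at h1 h2 h3
    refine ⟨rePhase (lineCartesian O (complexifyPhase z)), h3,
      (complexifyPhase_rePhase (cphase_ext (fun j => ?_) fun j => ?_)).symm⟩
    · exact Complex.conj_eq_iff_im.2 h1
    · exact Complex.conj_eq_iff_im.2 h2
  · intro φ
    obtain ⟨s, hs⟩ := hδ.angle_surjective (mem_ball_self hδ.pos) (φ 0)
    refine ⟨WithLp.toLp 2 fun _ => s, cphase_ext (fun j => ?_) fun j => ?_⟩
    · fin_cases j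
      simp only [lineAngleAction, hB0]
      simpa [complexifyPhase] using hs
    · simp only [lineAngleAction, hB0]
      simp [complexifyPhase]
  · intro θ
    obtain ⟨x, hx⟩ : ∃ x : ℝ, O.angle (θ 0, (E₀ : ℂ), ((0 : ℝ) : ℂ)) = x :=
      ⟨_, Complex.ext rfl (by simpa using hδ.angle_im (mem_ball_self hδ.pos) (θ 0))⟩
    refine ⟨WithLp.toLp 2 fun _ => x, cphase_ext (fun j => ?_) fun j => ?_⟩
    · simp only [lineAngleAction, lineLift_complexify]
      simpa [complexifyPhase] using hx
    · simp only [lineAngleAction, hB0]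
      simp [complexifyPhase]
  · have hp : ((E₀ : ℂ), ((0 : ℝ) : ℂ)) ∈ ball ((E₀ : ℂ), ((0 : ℝ) : ℂ)) O.ε :=
      mem_ball_self O.ε_pos
    ext z
    constructor
    · rintro ⟨hzI, hzE⟩
      rw [mechHam_one] at hzE
      obtain ⟨s, h1, h2⟩ := O.exists_param hp (hW' 0) hI hwell.sublevel hwell.inside hzI hzE
      refine ⟨WithLp.toLp 2 fun _ => s, cphase_ext (fun j => ?_) fun j => ?_⟩ <;> fin_cases j
      · simp only [lineCartesian, hB0]
        exact h1
      · simp only [lineCartesian, hB0]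
        exact h2
    · rintro ⟨θ, hθ⟩
      have h0 : ‖((θ, 0) : Phase 1).2‖ < δ := by simpa using hδ.pos
      have h1 := hen (θ, 0) z h0 hθ
      refine ⟨?_, by simpa using h1⟩
      have h3 := O.X_mem_real hp (hW' 0) hI (θ 0)
      rw [← hB0, show O.X (lineLift E₀ (complexifyPhase (θ, 0))) = z.1 0 from
        congrArg (fun y : CPhase 1 => y.1 0) hθ, Complex.ofReal_re] at h3
      exact h3
  -- Position and momentum determine E through the energy relation; on one orbit they determine s
  -- modulo 2π.
  · intro z hz z' hz' h
    have hX : O.X (lineLift E₀ z) = O.X (lineLift E₀ z') :=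
      congrArg (fun y : CPhase 1 => y.1 0) h
    have hR : O.R (lineLift E₀ z) = O.R (lineLift E₀ z') :=
      congrArg (fun y : CPhase 1 => y.2 0) h
    have h1 := O.energy _ (hdom z hz)
    have h2 := O.energy _ (hdom z' hz')
    rw [hX, hR] at h1
    simp only [mul_zero] at h1 h2
    have h3 : (lineLift E₀ z).2 = (lineLift E₀ z').2 := Prod.ext (h1.symm.trans h2) rfl
    have h4 : z.2 = z'.2 := by
      have := congrArg Prod.fst h3
      ext j
      fin_cases j
      exact add_left_cancel this
    have h5 : lineLift E₀ z = ((z.1 0, (lineLift E₀ z').2) : ℂ × ℂ × ℂ) := Prod.ext rfl h3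
    have hm := hdom z hz
    rw [h5] at hX hR hm
    obtain ⟨k, hk⟩ := O.injective _ _ _ hm (hdom z' hz') hX hR
    rw [eq_translateAngles_iff]
    refine ⟨h4, fun _ => k, fun j => ?_⟩
    fin_cases j
    exact hk
  · intro z hz v v'
    have hA := hdA.differentiableAt (hopen.mem_nhds hz)
    have hB := hdB.differentiableAt (hopen.mem_nhds hz)
    have h := hδ.twoForm_eq hU hu hw (hmem z hz) (lineLiftLin v) (lineLiftLin v')
    simp only [symplForm, Fin.sum_univ_one,
      fderiv_fst_apply (j := 0) hA (hlift (hda z hz)), fderiv_snd_apply (j := 0) hA (hdL z hz),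
      fderiv_fst_apply (j := 0) hB (hlift (hdX z hz)), fderiv_snd_apply (j := 0) hB (hlift (hdR z hz)),
      ContinuousLinearMap.comp_apply, ContinuousLinearMap.coe_snd']
    simp only [lineLiftLin_apply, mul_zero, sub_zero, add_zero] at h ⊢
    linear_combination h

end Line

/-! ### Symplectic polar coordinates, real and complex. -/

section Polar

/-- Symplectic polar coordinates: radius, radial momentum, angle, angular momentum. -/
def polarMap (r R θ G : ℂ) : CPhase 2 :=
  (!₂[r * Complex.cos θ, r * Complex.sin θ],
    !₂[R * Complex.cos θ - G / r * Complex.sin θ, R * Complex.sin θ + G / r * Complex.cos θ])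

/-- Symplectic polar coordinates on real phase space. -/
def polarMapReal (r R θ G : ℝ) : Phase 2 :=
  (!₂[r * Real.cos θ, r * Real.sin θ],
    !₂[R * Real.cos θ - G / r * Real.sin θ, R * Real.sin θ + G / r * Real.cos θ])

theorem polarMap_ofReal (r R θ G : ℝ) :
    polarMap r R θ G = complexifyPhase (polarMapReal r R θ G) := by
  refine cphase_ext (fun j => ?_) fun j => ?_ <;> fin_cases j <;>
    simp [polarMap, polarMapReal, complexifyPhase]

/-- r² is the bilinear square of the position, and Re r > 0 selects the root. Then e^{iθ} is known,
and rotating the momentum back by θ gives R and G/r. -/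
theorem polarMap_inj {r R θ G r' R' θ' G' : ℂ} (hr : 0 < r.re) (hr' : 0 < r'.re)
    (h : polarMap r R θ G = polarMap r' R' θ' G') :
    r = r' ∧ R = R' ∧ G = G' ∧ ∃ k : ℤ, θ = θ' + 2 * Real.pi * k := by
  have h1 : r * Complex.cos θ = r' * Complex.cos θ' := congrArg (fun y : CPhase 2 => y.1 0) h
  have h2 : r * Complex.sin θ = r' * Complex.sin θ' := congrArg (fun y : CPhase 2 => y.1 1) h
  have h3 : R * Complex.cos θ - G / r * Complex.sin θ =
    R' * Complex.cos θ' - G' / r' * Complex.sin θ' := congrArg (fun y : CPhase 2 => y.2 0) h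
  have h4 : R * Complex.sin θ + G / r * Complex.cos θ =
    R' * Complex.sin θ' + G' / r' * Complex.cos θ' := congrArg (fun y : CPhase 2 => y.2 1) h
  have hr0 : r ≠ 0 := by rintro rfl; simp at hr
  have hc := Complex.sin_sq_add_cos_sq θ
  have hc' := Complex.sin_sq_add_cos_sq θ'
  have hrr : r = r' := by
    have hsq : r ^ 2 = r' ^ 2 := by
      linear_combination (-r ^ 2) * hc + r' ^ 2 * hc' +
        (r * Complex.cos θ + r' * Complex.cos θ') * h1 +
        (r * Complex.sin θ + r' * Complex.sin θ') * h2
    refine (sq_eq_sq_iff_eq_or_eq_neg.1 hsq).resolve_right fun h => ?_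
    rw [h, Complex.neg_re] at hr
    linarith
  subst hrr
  have hcos := mul_left_cancel₀ hr0 h1
  have hsin := mul_left_cancel₀ hr0 h2
  rw [← hcos, ← hsin] at h3 h4
  refine ⟨rfl, ?_, ?_, ?_⟩
  · linear_combination (R' - R) * hc + Complex.cos θ * h3 + Complex.sin θ * h4
  · have h5 : G / r = G' / r := by
      linear_combination (G' / r - G / r) * hc + Complex.cos θ * h4 - Complex.sin θ * h3
    exact (div_left_inj' hr0).1 h5
  · have h5 : Complex.exp (θ * Complex.I) = Complex.exp (θ' * Complex.I) := by
      rw [Complex.exp_mul_I, Complex.exp_mul_I, hcos, hsin]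
    obtain ⟨k, hk⟩ := Complex.exp_eq_exp_iff_exists_int.1 h5
    refine ⟨k, mul_right_cancel₀ Complex.I_ne_zero ?_⟩
    linear_combination hk

theorem exists_polarMapReal {z : Phase 2} (hz : z.1 ≠ 0) :
    ∃ r R θ : ℝ, 0 < r ∧ z = polarMapReal r R θ (z.1 0 * z.2 1 - z.1 1 * z.2 0) := by
  set c : ℂ := ⟨z.1 0, z.1 1⟩ with hc
  have hc0 : c ≠ 0 := by
    intro h
    refine hz ?_
    ext j
    fin_cases j
    exacts [congrArg Complex.re h, congrArg Complex.im h]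
  have hr : 0 < ‖c‖ := norm_pos_iff.2 hc0
  have h1 : ‖c‖ * Real.cos c.arg = z.1 0 := Complex.norm_mul_cos_arg c
  have h2 : ‖c‖ * Real.sin c.arg = z.1 1 := Complex.norm_mul_sin_arg c
  have hsc := Real.sin_sq_add_cos_sq c.arg
  set r := ‖c‖
  set θ := c.arg
  refine ⟨r, z.2 0 * Real.cos θ + z.2 1 * Real.sin θ, θ, hr, ?_⟩
  have hG : (z.1 0 * z.2 1 - z.1 1 * z.2 0) / r = Real.cos θ * z.2 1 - Real.sin θ * z.2 0 := by
    rw [← h1, ← h2]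
    field_simp
  refine Prod.ext ?_ ?_ <;> ext j <;> fin_cases j
  · exact h1.symm
  · exact h2.symm
  · simp only [polarMapReal, hG]
    simp
    linear_combination (-z.2 0) * hsc
  · simp only [polarMapReal, hG]
    simp
    linear_combination (-z.2 1) * hsc

variable {r : ℝ}

theorem angularMomentum_polarMapReal (hr : 0 < r) (R θ G : ℝ) :
    (polarMapReal r R θ G).1 0 * (polarMapReal r R θ G).2 1 -
      (polarMapReal r R θ G).1 1 * (polarMapReal r R θ G).2 0 = G := by
  simp only [polarMapReal]
  simp
  field_simp
  linear_combination G * Real.sin_sq_add_cos_sq θ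

theorem polarMapReal_mem_planePhase (hr : 0 < r) (R θ G : ℝ) :
    polarMapReal r R θ G ∈ planePhase := by
  intro h
  have h1 : r * Real.cos θ = 0 := congrArg (fun y : EuclideanSpace ℝ (Fin 2) => y 0) h
  have h2 : r * Real.sin θ = 0 := congrArg (fun y : EuclideanSpace ℝ (Fin 2) => y 1) h
  have h3 : r ^ 2 = 0 := by
    linear_combination (-r ^ 2) * Real.sin_sq_add_cos_sq θ + r * Real.cos θ * h1 +
      r * Real.sin θ * h2
  exact hr.ne' (pow_eq_zero_iff two_ne_zero |>.1 h3)

theorem mechHam_polarMapReal (V : ℝ → ℝ) (hr : 0 < r) (R θ G : ℝ) :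
    mechHam 2 V (polarMapReal r R θ G) = R ^ 2 / 2 + effPot V G r := by
  have hsc := Real.sin_sq_add_cos_sq θ
  have h1 : ‖(polarMapReal r R θ G).1‖ = r := by
    rw [EuclideanSpace.norm_eq, Fin.sum_univ_two, Real.norm_eq_abs, Real.norm_eq_abs, sq_abs, sq_abs,
      Real.sqrt_eq_iff_mul_self_eq (by positivity) hr.le]
    simp only [polarMapReal]
    simp
    linear_combination r ^ 2 * hsc
  have h2 : ‖(polarMapReal r R θ G).2‖ ^ 2 = R ^ 2 + (G / r) ^ 2 := by
    rw [EuclideanSpace.norm_eq, Real.sq_sqrt (by positivity), Fin.sum_univ_two, Real.norm_eq_abs,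
      Real.norm_eq_abs, sq_abs, sq_abs]
    simp only [polarMapReal]
    simp
    linear_combination (R ^ 2 + (G / r) ^ 2) * hsc
  rw [mechHam, h1, h2, effPot]
  field_simp
  ring

end Polar

/-! ### The angle-action pair in the plane. -/

section Plane

open Metric Set Filter Topology

variable {E₀ G₀ : ℝ}

/-- Orbit parameter, energy and angular momentum as coordinates for planar motion. -/
def planeLift (E₀ G₀ : ℝ) (z : CPhase 2) : ℂ × ℂ × ℂ := (z.1 0, E₀ + z.2 0, G₀ + z.2 1)

/-- The linear part of `planeLift`. -/
def planeLiftLin : CPhase 2 →L[ℂ] ℂ × ℂ × ℂ :=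
  ((EuclideanSpace.proj 0 : EuclideanSpace ℂ (Fin 2) →L[ℂ] ℂ).comp
    (ContinuousLinearMap.fst ℂ _ _)).prod
    (((EuclideanSpace.proj 0 : EuclideanSpace ℂ (Fin 2) →L[ℂ] ℂ).comp
      (ContinuousLinearMap.snd ℂ _ _)).prod
      ((EuclideanSpace.proj 1 : EuclideanSpace ℂ (Fin 2) →L[ℂ] ℂ).comp
      (ContinuousLinearMap.snd ℂ _ _)))

/-- The polar angle as a linear functional. -/
def polarAngle : CPhase 2 →L[ℂ] ℂ :=
  (EuclideanSpace.proj 1 : EuclideanSpace ℂ (Fin 2) →L[ℂ] ℂ).comp (ContinuousLinearMap.fst ℂ _ _)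

/-- The increment of angular momentum as a linear functional. -/
def momentumIncrement : CPhase 2 →L[ℂ] ℂ :=
  (EuclideanSpace.proj 1 : EuclideanSpace ℂ (Fin 2) →L[ℂ] ℂ).comp (ContinuousLinearMap.snd ℂ _ _)

theorem planeLiftLin_apply (v : CPhase 2) : planeLiftLin v = (v.1 0, v.2 0, v.2 1) := rfl

theorem polarAngle_apply (v : CPhase 2) : polarAngle v = v.1 1 := rfl

theorem momentumIncrement_apply (v : CPhase 2) : momentumIncrement v = v.2 1 := rfl

theorem hasFDerivAt_planeLift (z : CPhase 2) : HasFDerivAt (planeLift E₀ G₀) planeLiftLin z := by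
  have : planeLift E₀ G₀ = fun z => ((0 : ℂ), (E₀ : ℂ), (G₀ : ℂ)) + planeLiftLin z := by
    funext z
    simp [planeLift, planeLiftLin_apply]
  rw [this]
  exact planeLiftLin.hasFDerivAt.const_add _

theorem planeLift_mem {δ : ℝ} {z : CPhase 2} (hz : z ∈ torusBall 2 δ δ) :
    planeLift E₀ G₀ z ∈ strip δ ((E₀ : ℂ), (G₀ : ℂ)) := by
  have h0 := (norm_apply_le z.2 0).trans_lt hz.2
  have h1 := (norm_apply_le z.2 1).trans_lt hz.2
  refine ⟨hz.1 0, ?_⟩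
  rw [← ball_prod_same]
  exact ⟨by simpa [planeLift, mem_ball_iff_norm] using h0,
    by simpa [planeLift, mem_ball_iff_norm] using h1⟩

theorem planeLift_complexify (z : Phase 2) : planeLift E₀ G₀ (complexifyPhase z) =
    ((z.1 0 : ℂ), ((E₀ + z.2 0 : ℝ) : ℂ), ((G₀ + z.2 1 : ℝ) : ℂ)) := by
  simp [planeLift, complexifyPhase]

variable {U : Set ℂ} {u w : ℂ → ℂ} (O : OrbitFamily U u w E₀ G₀)

/-- Angle-action coordinates for planar motion. -/
def planeAngleAction (z : CPhase 2) : CPhase 2 :=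
  (!₂[O.angle (planeLift E₀ G₀ z), z.1 1 + O.node (planeLift E₀ G₀ z)],
    !₂[O.actionVar (planeLift E₀ G₀ z).2 - O.actionVar (E₀, G₀), z.2 1])

/-- Cartesian positions and momenta for planar motion. -/
def planeCartesian (z : CPhase 2) : CPhase 2 :=
  polarMap (O.X (planeLift E₀ G₀ z)) (O.R (planeLift E₀ G₀ z)) (z.1 1) (G₀ + z.2 1)

variable {O} {δ : ℝ}

/-- Polar coordinates are symplectic: the Cartesian form pulls back to dr ∧ dR + dθ ∧ dG, here with
r = X and R functions of the orbit parameters. -/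
theorem planeCartesian_symplectic {z : CPhase 2} (hUre : ∀ x ∈ U, 0 < x.re)
    (hz : z ∈ torusBall 2 O.ε O.ε) :
    DifferentiableAt ℂ (planeCartesian O) z ∧ ∀ v v',
    symplForm (fderiv ℂ (planeCartesian O) z v) (fderiv ℂ (planeCartesian O) z v') =
      (fderiv ℂ O.X (planeLift E₀ G₀ z) (planeLiftLin v) *
          fderiv ℂ O.R (planeLift E₀ G₀ z) (planeLiftLin v') -
        fderiv ℂ O.X (planeLift E₀ G₀ z) (planeLiftLin v') *
          fderiv ℂ O.R (planeLift E₀ G₀ z) (planeLiftLin v)) +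
      (v.1 1 * v'.2 1 - v'.1 1 * v.2 1) := by
  have hmem : ∀ z ∈ torusBall 2 O.ε O.ε, planeLift E₀ G₀ z ∈ O.dom := fun z hz => planeLift_mem hz
  have hX0 : ∀ z ∈ torusBall 2 O.ε O.ε, O.X (planeLift E₀ G₀ z) ≠ 0 := fun z hz h => by
    have := hUre _ (O.mem_X _ (hmem z hz))
    simp [h] at this
  have hn := O.isOpen_dom.mem_nhds (hmem z hz)
  have hX : HasFDerivAt (fun z => O.X (planeLift E₀ G₀ z))
      ((fderiv ℂ O.X (planeLift E₀ G₀ z)).comp planeLiftLin) z :=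
    (O.diff_X.differentiableAt hn).hasFDerivAt.comp z (hasFDerivAt_planeLift z)
  have hR : HasFDerivAt (fun z => O.R (planeLift E₀ G₀ z))
      ((fderiv ℂ O.R (planeLift E₀ G₀ z)).comp planeLiftLin) z :=
    (O.diff_R.differentiableAt hn).hasFDerivAt.comp z (hasFDerivAt_planeLift z)
  have hG : HasFDerivAt (fun z : CPhase 2 => (G₀ : ℂ) + z.2 1) momentumIncrement z :=
    momentumIncrement.hasFDerivAt.const_add _
  have hθ : HasFDerivAt (fun z : CPhase 2 => z.1 1) polarAngle z := polarAngle.hasFDerivAt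
  obtain ⟨q', hq⟩ : ∃ q' : CPhase 2 →L[ℂ] ℂ, HasFDerivAt
      (fun z : CPhase 2 => ((G₀ : ℂ) + z.2 1) / O.X (planeLift E₀ G₀ z)) q' z := by
    have := hG.mul ((hasDerivAt_inv (hX0 z hz)).comp_hasFDerivAt z hX)
    exact ⟨_, this.congr_of_eventuallyEq (Eventually.of_forall fun y => div_eq_mul_inv _ _)⟩
  -- The derivative of q = G/r enters only through d(rq) = dG, so no explicit formula for it is
  -- needed.
  have hrel : ∀ v, O.X (planeLift E₀ G₀ z) * q' v + ((G₀ : ℂ) + z.2 1) / O.X (planeLift E₀ G₀ z) *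
      fderiv ℂ O.X (planeLift E₀ G₀ z) (planeLiftLin v) = v.2 1 := by
    have h1 := hX.mul hq
    have h2 := h1.unique (hG.congr_of_eventuallyEq (by
      filter_upwards [(isOpen_torusBall O.ε O.ε).mem_nhds hz] with y hy
      exact mul_div_cancel₀ _ (hX0 y hy)))
    intro v
    have h3 := DFunLike.congr_fun h2 v
    simpa [momentumIncrement_apply] using h3
  have hc := hθ.ccos
  have hs := hθ.csin
  have e1 : HasFDerivAt (fun z => (planeCartesian O z).1 0) _ z := hX.mul hc
  have e2 : HasFDerivAt (fun z => (planeCartesian O z).1 1) _ z := hX.mul hs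
  have e3 : HasFDerivAt (fun z => (planeCartesian O z).2 0) _ z := (hR.mul hc).sub (hq.mul hs)
  have e4 : HasFDerivAt (fun z => (planeCartesian O z).2 1) _ z := (hR.mul hs).add (hq.mul hc)
  have hd : DifferentiableAt ℂ (planeCartesian O) z := by
    refine DifferentiableAt.prodMk (differentiableAt_euclidean.2 fun j => ?_)
      (differentiableAt_euclidean.2 fun j => ?_) <;> fin_cases j
    exacts [e1.differentiableAt, e2.differentiableAt, e3.differentiableAt, e4.differentiableAt]
  refine ⟨hd, fun v v' => ?_⟩
  have hsc := Complex.sin_sq_add_cos_sq (z.1 1)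
  have hv := hrel v
  have hv' := hrel v'
  simp only [symplForm, Fin.sum_univ_two, fderiv_fst_apply hd e1, fderiv_fst_apply hd e2,
    fderiv_snd_apply hd e3, fderiv_snd_apply hd e4, add_apply, sub_apply, smul_apply,
    ContinuousLinearMap.comp_apply, smul_eq_mul, polarAngle_apply]
  set r := O.X (planeLift E₀ G₀ z)
  set q := ((G₀ : ℂ) + z.2 1) / r
  set ra := fderiv ℂ O.X (planeLift E₀ G₀ z) (planeLiftLin v)
  set rb := fderiv ℂ O.X (planeLift E₀ G₀ z) (planeLiftLin v')
  set Ra := fderiv ℂ O.R (planeLift E₀ G₀ z) (planeLiftLin v)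
  set Rb := fderiv ℂ O.R (planeLift E₀ G₀ z) (planeLiftLin v')
  linear_combination ((ra * Rb - rb * Ra) + q * (v.1 1 * rb - v'.1 1 * ra) +
    r * (v.1 1 * q' v' - v'.1 1 * q' v)) * hsc + v.1 1 * hv' - v'.1 1 * hv

/-- Adding the node function to the polar angle absorbs the remaining term in dG of the two-form; as
it is 2π-periodic in s, both angles stay well defined on the torus. -/
theorem planeAngleAction_isAngleActionPair (hδ : O.IsAngleStrip δ) (hU : IsOpen U)
    (hu : DifferentiableOn ℂ u U) (hw : DifferentiableOn ℂ w U)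
    (hur : ∀ x : ℝ, (x : ℂ) ∈ U → (u x).im = 0) (hUre : ∀ x ∈ U, 0 < x.re) {V : ℝ → ℝ} {a b : ℝ}
    (hwell : IsPotentialWell (Ioi 0) (effPot V G₀) E₀ a b)
    (hI : ∀ x : ℝ, x ∈ Ioi (0 : ℝ) ↔ (x : ℂ) ∈ U)
    (hW : ∀ G x : ℝ, (x : ℂ) ∈ U → (G : ℂ) ^ 2 * u x + w x = effPot V G x) :
    IsAngleActionPair planePhase (planeTorus V E₀ G₀) δ (planeAngleAction O) (planeCartesian O) ∧
    (∀ z ∈ torusBall 2 δ δ, ∀ z' ∈ torusBall 2 δ δ,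
      (planeAngleAction O z).2 = (planeAngleAction O z').2 → z.2 = z'.2) ∧
    (∀ z z' : Phase 2, ‖z.2‖ < δ → planeCartesian O (complexifyPhase z) = complexifyPhase z' →
      mechHam 2 V z' = E₀ + z.2 0) := by
  have hopen := isOpen_torusBall (N := 2) δ δ
  have hmem : ∀ z ∈ torusBall 2 δ δ, planeLift E₀ G₀ z ∈ strip δ ((E₀ : ℂ), (G₀ : ℂ)) :=
    fun z hz => planeLift_mem hz
  have hdom : ∀ z ∈ torusBall 2 δ δ, planeLift E₀ G₀ z ∈ O.dom := fun z hz => hδ.subset (hmem z hz)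
  have hbig : ∀ z ∈ torusBall 2 δ δ, z ∈ torusBall 2 O.ε O.ε := fun z hz =>
    ⟨fun j => (hz.1 j).trans_le hδ.le, hz.2.trans_le hδ.le⟩
  have hXre : ∀ z ∈ torusBall 2 δ δ, 0 < (O.X (planeLift E₀ G₀ z)).re := fun z hz =>
    hUre _ (O.mem_X _ (hdom z hz))
  have hreal : ∀ z : Phase 2, ‖z.2‖ < δ →
      (((E₀ + z.2 0 : ℝ) : ℂ), ((G₀ + z.2 1 : ℝ) : ℂ)) ∈ ball ((E₀ : ℂ), (G₀ : ℂ)) δ :=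
    fun z hz => by
      have := (hmem _ (complexifyPhase_mem_torusBall hδ.pos hz)).2
      rwa [planeLift_complexify] at this
  have hda : ∀ z ∈ torusBall 2 δ δ, HasFDerivAt (fun z => O.angle (planeLift E₀ G₀ z))
      ((fderiv ℂ O.angle (planeLift E₀ G₀ z)).comp planeLiftLin) z := fun z hz =>
    (hδ.hasFDerivAt_angle (hmem z hz)).differentiableAt.hasFDerivAt.comp z (hasFDerivAt_planeLift z)
  have hdn : ∀ z ∈ torusBall 2 δ δ, HasFDerivAt (fun z => z.1 1 + O.node (planeLift E₀ G₀ z))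
      (polarAngle + (fderiv ℂ O.node (planeLift E₀ G₀ z)).comp planeLiftLin) z := fun z hz =>
    polarAngle.hasFDerivAt.add ((hδ.hasFDerivAt_node hu
      (hmem z hz)).differentiableAt.hasFDerivAt.comp z (hasFDerivAt_planeLift z))
  have hdL : ∀ z ∈ torusBall 2 δ δ, HasFDerivAt
      (fun z => O.actionVar (planeLift E₀ G₀ z).2 - O.actionVar (E₀, G₀))
      ((fderiv ℂ O.actionVar (planeLift E₀ G₀ z).2).comp
        ((ContinuousLinearMap.snd ℂ ℂ (ℂ × ℂ)).comp planeLiftLin)) z := fun z hz => by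
    have h1 : DifferentiableAt ℂ O.actionVar (planeLift E₀ G₀ z).2 :=
      O.diff_actionVar.differentiableAt (isOpen_ball.mem_nhds (hδ.ball_subset (hmem z hz).2))
    have h2 : HasFDerivAt (fun z => (planeLift E₀ G₀ z).2)
        ((ContinuousLinearMap.snd ℂ ℂ (ℂ × ℂ)).comp planeLiftLin) z :=
      (ContinuousLinearMap.snd ℂ ℂ (ℂ × ℂ)).hasFDerivAt.comp z (hasFDerivAt_planeLift z)
    exact (h1.hasFDerivAt.comp z h2).sub_const _
  have e1 : ∀ z ∈ torusBall 2 δ δ, HasFDerivAt (fun z => (planeAngleAction O z).1 0) _ z := hda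
  have e2 : ∀ z ∈ torusBall 2 δ δ, HasFDerivAt (fun z => (planeAngleAction O z).1 1) _ z := hdn
  have e3 : ∀ z ∈ torusBall 2 δ δ, HasFDerivAt (fun z => (planeAngleAction O z).2 0) _ z := hdL
  have e4 : ∀ z ∈ torusBall 2 δ δ, HasFDerivAt (fun z => (planeAngleAction O z).2 1)
      momentumIncrement z := fun z _ => momentumIncrement.hasFDerivAt
  have hdA : DifferentiableOn ℂ (planeAngleAction O) (torusBall 2 δ δ) := by
    refine differentiableOn_cphase (fun j z hz => ?_) fun j z hz => ?_ <;> fin_cases j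
    exacts [(e1 z hz).differentiableAt.differentiableWithinAt,
      (e2 z hz).differentiableAt.differentiableWithinAt,
      (e3 z hz).differentiableAt.differentiableWithinAt,
      (e4 z hz).differentiableAt.differentiableWithinAt]
  have hdB : DifferentiableOn ℂ (planeCartesian O) (torusBall 2 δ δ) := fun z hz =>
    (planeCartesian_symplectic hUre (hbig z hz)).1.differentiableWithinAt
  have hA2 : ∀ z ∈ torusBall 2 δ δ, ∀ z' ∈ torusBall 2 δ δ,
      (planeAngleAction O z).2 = (planeAngleAction O z').2 → z.2 = z'.2 := by
    intro z hz z' hz' h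
    have h0 : (planeAngleAction O z).2 1 = (planeAngleAction O z').2 1 := by rw [h]
    have h1 : z.2 1 = z'.2 1 := h0
    have h2 : O.actionVar (planeLift E₀ G₀ z).2 = O.actionVar (planeLift E₀ G₀ z').2 :=
      sub_left_injective (congrArg (fun x : EuclideanSpace ℂ (Fin 2) => x 0) h)
    have hm := (hmem z hz).2
    simp only [planeLift, h1] at h2 hm
    have h3 := hδ.actionVar_injective hU hu hw hm (hmem z' hz').2 h2
    ext j
    fin_cases j
    exacts [add_left_cancel h3, h1]
  have hlift_eq : ∀ z z' : CPhase 2, z.2 = z'.2 →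
      (planeLift E₀ G₀ z).2 = (planeLift E₀ G₀ z').2 := fun z z' h => by simp [planeLift, h]
  have hBreal : ∀ z : Phase 2, ‖z.2‖ < δ → ∃ r R : ℝ, 0 < r ∧
      R ^ 2 / 2 + effPot V (G₀ + z.2 1) r = E₀ + z.2 0 ∧
      planeCartesian O (complexifyPhase z) =
        complexifyPhase (polarMapReal r R (z.1 1) (G₀ + z.2 1)) := by
    intro z hz
    have hp := hδ.ball_subset (hreal z hz)
    refine ⟨_, _, O.X_mem_real hp (hW _) hI (z.1 0), O.energy_real hp (hW _) (z.1 0), ?_⟩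
    rw [← polarMap_ofReal, ← O.X_ofReal hp, ← O.R_ofReal hp, planeCartesian, planeLift_complexify]
    simp [complexifyPhase]
  have hen : ∀ z z' : Phase 2, ‖z.2‖ < δ →
      planeCartesian O (complexifyPhase z) = complexifyPhase z' → mechHam 2 V z' = E₀ + z.2 0 := by
    intro z z' hz h
    obtain ⟨r, R, hr, hE, hB⟩ := hBreal z hz
    rw [hB] at h
    rw [← complexifyPhase_injective h, mechHam_polarMapReal V hr, hE]
  have hlift0 : ∀ θ : EuclideanSpace ℝ (Fin 2), planeLift E₀ G₀ (complexifyPhase (θ, 0)) =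
      ((θ 0 : ℂ), (E₀ : ℂ), (G₀ : ℂ)) := fun θ => by simp [planeLift_complexify]
  have hp₀ : ((E₀ : ℂ), (G₀ : ℂ)) ∈ ball ((E₀ : ℂ), (G₀ : ℂ)) δ := mem_ball_self hδ.pos
  refine ⟨⟨hδ.pos, hdA, hdB, ?_, ?_, ?_, ?_, ?_, ?_, ?_, ?_, ?_, ?_, ?_⟩, hA2, hen⟩
  · intro z hz k
    have h1 := OrbitFamily.add_int_mul_two_pi (fun s p hz => hδ.angle_add_two_pi hz) (k 0) _ _
      (hmem z hz)
    have h2 := OrbitFamily.add_int_mul_two_pi (f := O.node) (c := 0)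
      (fun s p hz => by rw [hδ.node_add_two_pi hu hz, add_zero]) (k 0) _ _ (hmem z hz)
    rw [zero_mul, add_zero] at h2
    refine cphase_ext (fun j => ?_) fun j => ?_ <;> fin_cases j
    · exact h1
    · exact (congrArg (fun y => z.1 1 + 2 * (Real.pi : ℂ) * (k 1 : ℂ) + y) h2).trans
        (add_right_comm _ _ _)
    · rfl
    · rfl
  · intro z hz k
    have h1 := OrbitFamily.add_int_mul_two_pi (f := O.X) (c := 0)
      (fun s p _ => by rw [O.periodic_X, add_zero]) (k 0) _ _ (hmem z hz)
    have h2 := OrbitFamily.add_int_mul_two_pi (f := O.R) (c := 0)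
      (fun s p _ => by rw [O.periodic_R, add_zero]) (k 0) _ _ (hmem z hz)
    rw [zero_mul, add_zero] at h1 h2
    have h1' : O.X (planeLift E₀ G₀ (translateAngles k z)) = O.X (planeLift E₀ G₀ z) := h1
    have h2' : O.R (planeLift E₀ G₀ (translateAngles k z)) = O.R (planeLift E₀ G₀ z) := h2
    have h4 : (translateAngles k z).1 1 = z.1 1 + (k 1 : ℂ) * (2 * Real.pi) := by
      rw [mul_comm]
      rfl
    simp only [planeCartesian, h1', h2', polarMap, h4, Complex.cos_add_int_mul_two_pi,
      Complex.sin_add_int_mul_two_pi]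
    rfl
  · intro z hz z' hz' h
    have h2 := hA2 z hz z' hz' (congrArg Prod.snd h)
    have h1 : O.angle (planeLift E₀ G₀ z) = O.angle (planeLift E₀ G₀ z') :=
      congrArg (fun y : CPhase 2 => y.1 0) h
    have h3 : planeLift E₀ G₀ z = ((z.1 0, (planeLift E₀ G₀ z').2) : ℂ × ℂ × ℂ) :=
      Prod.ext rfl (hlift_eq z z' h2)
    have hm := hmem z hz
    rw [h3] at h1 hm
    have h4 : z.1 0 = z'.1 0 := hδ.angle_injective hm (hmem z' hz') h1
    have h5 : planeLift E₀ G₀ z = planeLift E₀ G₀ z' := by simp only [planeLift, h4, h2]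
    have h6 : z.1 1 + O.node (planeLift E₀ G₀ z) = z'.1 1 + O.node (planeLift E₀ G₀ z') :=
      congrArg (fun y : CPhase 2 => y.1 1) h
    rw [h5] at h6
    refine cphase_ext (fun j => ?_) fun j => by rw [h2]
    fin_cases j
    exacts [h4, add_right_cancel h6]
  -- Triangular again: the G-component is read off first, then E through T/2π, then s through 2πκ/T,
  -- and the polar angle last.
  · intro z hz v hv
    have hd := hdA.differentiableAt (hopen.mem_nhds hz)
    have h1 := fderiv_fst_apply hd (e1 z hz) v
    have h2 := fderiv_fst_apply hd (e2 z hz) v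
    have h3 := fderiv_snd_apply hd (e3 z hz) v
    have h4 := fderiv_snd_apply hd (e4 z hz) v
    rw [hv] at h1 h2 h3 h4
    simp only [add_apply, ContinuousLinearMap.comp_apply, planeLiftLin_apply, polarAngle_apply,
      momentumIncrement_apply, ContinuousLinearMap.coe_snd'] at h1 h2 h3 h4
    rw [O.hasFDerivAt_actionVar hU hu hw (hδ.ball_subset (hmem z hz).2)] at h3
    have hT := hδ.period_ne_zero (hmem z hz).2
    have hκ := hδ.κ_ne_zero (hmem z hz)
    have hv4 : v.2 1 = 0 := h4.symm
    have hv3 : v.2 0 = 0 := by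
      have h3' : (0 : ℂ) = O.period (planeLift E₀ G₀ z).2 * v.2 0 / (2 * Real.pi) := by
        simpa [hv4] using h3
      have h5 := (div_eq_zero_iff.1 h3'.symm).resolve_right (by simp)
      exact (mul_eq_zero.1 h5).resolve_left hT
    have hv1 : v.1 0 = 0 := by
      rw [hv3, hv4, show ((v.1 0, (0 : ℂ), (0 : ℂ)) : ℂ × ℂ × ℂ) = v.1 0 • (1, 0) by simp, map_smul,
        hδ.fderiv_angle_fst (hmem z hz), smul_eq_mul] at h1
      have h5 := mul_eq_zero.1 h1.symm
      exact h5.resolve_right (mul_ne_zero (by simp) (div_ne_zero hκ hT))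
    have hv2 : v.1 1 = 0 := by
      rw [hv1, hv3, hv4, show (((0 : ℂ), (0 : ℂ), (0 : ℂ)) : ℂ × ℂ × ℂ) = 0 from rfl, map_zero,
        add_zero] at h2
      exact h2.symm
    refine cphase_ext (fun j => ?_) fun j => ?_ <;> fin_cases j
    exacts [hv1, hv2, hv3, hv4]
  · intro z hz
    have hp := hreal z hz
    have h1 := hδ.angle_im hp (z.1 0)
    have h2 := OrbitFamily.actionVar_im hδ hp
    have h3 := OrbitFamily.actionVar_im hδ hp₀
    have h4 := hδ.node_im hp hur (z.1 0)
    rw [← planeLift_complexify] at h1 h4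
    refine ⟨_, (complexifyPhase_rePhase (cphase_ext (fun j => ?_) fun j => ?_)).symm⟩ <;>
      fin_cases j
    · exact Complex.conj_eq_iff_im.2 h1
    · refine Complex.conj_eq_iff_im.2 ?_
      have : ((complexifyPhase z).1 1).im = 0 := Complex.ofReal_im _
      exact (Complex.add_im _ _).trans (by rw [this, h4, add_zero])
    · refine Complex.conj_eq_iff_im.2 ?_
      refine (Complex.sub_im _ _).trans ?_
      rw [planeLift_complexify, h2, h3, sub_zero]
    · exact Complex.conj_eq_iff_im.2 (Complex.ofReal_im _)
  · intro z hz
    obtain ⟨r, R, hr, -, hB⟩ := hBreal z hz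
    exact ⟨_, polarMapReal_mem_planePhase hr _ _ _, hB⟩
  -- Solve the first angle for s, then subtract the real value of the node function at s from the
  -- second.
  · intro φ
    obtain ⟨s, hs⟩ := hδ.angle_surjective hp₀ (φ 0)
    obtain ⟨n, hn⟩ : ∃ n : ℝ, O.node (s, (E₀ : ℂ), (G₀ : ℂ)) = n :=
      ⟨_, Complex.ext rfl (by simpa using hδ.node_im hp₀ hur s)⟩
    refine ⟨!₂[s, φ 1 - n], cphase_ext (fun j => ?_) fun j => ?_⟩ <;> fin_cases j
    · simp only [planeAngleAction, hlift0]
      simpa [complexifyPhase] using hs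
    · simp only [planeAngleAction, hlift0]
      simp [complexifyPhase, hn]
    · simp only [planeAngleAction, hlift0]
      simp [complexifyPhase]
    · simp [planeAngleAction, complexifyPhase]
  · intro θ
    obtain ⟨x, hx⟩ : ∃ x : ℝ, O.angle (θ 0, (E₀ : ℂ), (G₀ : ℂ)) = x :=
      ⟨_, Complex.ext rfl (by simpa using hδ.angle_im hp₀ (θ 0))⟩
    obtain ⟨n, hn⟩ : ∃ n : ℝ, O.node (θ 0, (E₀ : ℂ), (G₀ : ℂ)) = n :=
      ⟨_, Complex.ext rfl (by simpa using hδ.node_im hp₀ hur (θ 0))⟩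
    refine ⟨!₂[x, θ 1 + n], cphase_ext (fun j => ?_) fun j => ?_⟩ <;> fin_cases j
    · simp only [planeAngleAction, hlift0]
      simpa [complexifyPhase] using hx
    · simp only [planeAngleAction, hlift0]
      simp [complexifyPhase, hn]
    · simp only [planeAngleAction, hlift0]
      simp [complexifyPhase]
    · simp [planeAngleAction, complexifyPhase]
  · ext z
    constructor
    -- In polar coordinates the angular momentum is G₀, so (r, R) lies on the radial level, which
    -- the orbit family covers; θ is free.
    · rintro ⟨hz0, hzE, hzG⟩
      obtain ⟨r, R, θ, hr, hzp⟩ := exists_polarMapReal hz0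
      rw [hzG] at hzp
      rw [hzp, mechHam_polarMapReal V hr] at hzE
      obtain ⟨s, h1, h2⟩ := O.exists_param (hδ.ball_subset hp₀) (hW _) hI hwell.sublevel
        hwell.inside hr hzE
      refine ⟨!₂[s, θ], ?_⟩
      have h3 : planeLift E₀ G₀ (complexifyPhase (!₂[s, θ], 0)) = ((s : ℂ), (E₀ : ℂ), (G₀ : ℂ)) := by
        rw [hlift0]
        rfl
      rw [hzp, ← polarMap_ofReal, planeCartesian, h3, h1, h2]
      simp [complexifyPhase]
    · rintro ⟨θ, hθ⟩
      have h0 : ‖((θ, 0) : Phase 2).2‖ < δ := by simpa using hδ.pos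
      obtain ⟨r, R, hr, hE, hB⟩ := hBreal (θ, 0) h0
      rw [hB] at hθ
      rw [← complexifyPhase_injective hθ]
      refine ⟨polarMapReal_mem_planePhase hr _ _ _, ?_, ?_⟩
      · rw [mechHam_polarMapReal V hr, hE]
        simp
      · rw [angularMomentum_polarMapReal hr]
        simp
  -- Undo the polar coordinates, using Re X > 0; recover E from the energy relation and then s
  -- modulo 2π from the orbit.
  · intro z hz z' hz' h
    obtain ⟨hX, hR, hG, k, hk⟩ := polarMap_inj (hXre z hz) (hXre z' hz') h
    have h1 := O.energy _ (hdom z hz)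
    have h2 := O.energy _ (hdom z' hz')
    have hG' : (planeLift E₀ G₀ z).2.2 = (planeLift E₀ G₀ z').2.2 := hG
    rw [hX, hR, hG'] at h1
    have h3 : (planeLift E₀ G₀ z).2 = (planeLift E₀ G₀ z').2 := Prod.ext (h1.symm.trans h2) hG'
    have h4 : z.2 = z'.2 := by
      ext j
      fin_cases j
      exacts [add_left_cancel (congrArg Prod.fst h3), add_left_cancel hG]
    have h5 : planeLift E₀ G₀ z = ((z.1 0, (planeLift E₀ G₀ z').2) : ℂ × ℂ × ℂ) := Prod.ext rfl h3
    have hm := hdom z hz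
    rw [h5] at hX hR hm
    obtain ⟨m, hm'⟩ := O.injective _ _ _ hm (hdom z' hz') hX hR
    rw [eq_translateAngles_iff]
    refine ⟨h4, ![m, k], fun j => ?_⟩
    fin_cases j
    exacts [hm', hk]
  · intro z hz v v'
    have hA := hdA.differentiableAt (hopen.mem_nhds hz)
    have h := hδ.twoForm_eq hU hu hw (hmem z hz) (planeLiftLin v) (planeLiftLin v')
    rw [(planeCartesian_symplectic hUre (hbig z hz)).2]
    simp only [symplForm, Fin.sum_univ_two, fderiv_fst_apply hA (e1 z hz),
      fderiv_fst_apply hA (e2 z hz), fderiv_snd_apply hA (e3 z hz), fderiv_snd_apply hA (e4 z hz),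
      add_apply, ContinuousLinearMap.comp_apply, ContinuousLinearMap.coe_snd', polarAngle_apply,
      momentumIncrement_apply]
    simp only [planeLiftLin_apply] at h ⊢
    linear_combination h

end Plane

/-! ### The two cases of the proposition. -/

section Main

open Metric Set Filter Topology

/-- The coordinate of the one-dimensional Euclidean space. -/
def lineCoord : EuclideanSpace ℝ (Fin 1) ≃L[ℝ] ℝ :=
  (EuclideanSpace.equiv (Fin 1) ℝ).trans (ContinuousLinearEquiv.funUnique (Fin 1) ℝ ℝ)

theorem lineCoord_apply (x : EuclideanSpace ℝ (Fin 1)) : lineCoord x = x 0 := rfl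

theorem lineCoord_symm_apply (x : ℝ) : lineCoord.symm x = !₂[x] := by
  rw [ContinuousLinearEquiv.symm_apply_eq, lineCoord_apply]
  rfl

theorem gradient_comp_lineCoord (g : ℝ → ℝ) :
    gradient (g ∘ lineCoord) = lineCoord.symm ∘ deriv g ∘ lineCoord := by
  funext J
  apply lineCoord.injective
  simp only [Function.comp_apply, ContinuousLinearEquiv.apply_symm_apply]
  rw [lineCoord_apply, gradient_apply_eq_fderiv, ContinuousLinearEquiv.comp_right_fderiv,
    ← fderiv_apply_one_eq_deriv]
  simp [lineCoord_apply]

theorem fderiv_gradient_comp_lineCoord (g : ℝ → ℝ) (x v : EuclideanSpace ℝ (Fin 1)) :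
    lineCoord (fderiv ℝ (gradient (g ∘ lineCoord)) x v) =
      deriv (deriv g) (lineCoord x) * lineCoord v := by
  rw [gradient_comp_lineCoord, ContinuousLinearEquiv.comp_fderiv,
    ContinuousLinearEquiv.comp_right_fderiv]
  simp [mul_comm]

/-- On real points the holomorphic action is the loop action, so by A.1 the energy at action J is
H(L₀ + J); its first two derivatives give the frequency and the torsion. -/
theorem propertyP1_line {V : ℝ → ℝ} {I : Set ℝ} {a b : ℝ} {H : ℝ → ℝ} (hIo : IsOpen I)
    (hV : AnalyticOnNhd ℝ (fun x : ℝ => V |x|) I) (hA : AssumptionA1 V I a b H) {h : ℝ}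
    (hh : h ∈ Ioo a b)
    (hdio : IsDiophantine
      (!₂[deriv H (loopAction I (linePot V) h)] : EuclideanSpace ℝ (Fin 1))) :
    PropertyP1 (linePhase I) (fun _ => mechHam 1 V) (fun _ => lineTorus V I h)
      (fun _ => !₂[deriv H (loopAction I (linePot V) h)]) := by
  have hWa : AnalyticOnNhd ℝ (linePot V) I := hV.neg
  have hwells : ∀ E ∈ Ioo a b, ∃ x₁ x₂, IsPotentialWell I (linePot V) E x₁ x₂ := fun E hE =>
    (hA.compactness E hE).exists_isPotentialWell hIo hWa.continuousOn
  obtain ⟨x₁, x₂, hwell⟩ := hwells h hh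
  have hd1 := deriv_ne_zero_of_isSmoothClosedCurve hWa (hA.compactness h hh) hwell.left_mem
    hwell.left (Or.inl fun x hx hxE => (hwell.left_le hx hxE).1)
  have hd2 := deriv_ne_zero_of_isSmoothClosedCurve hWa (hA.compactness h hh) hwell.right_mem
    hwell.right (Or.inr fun x hx hxE => (hwell.left_le hx hxE).2)
  obtain ⟨U, w, hU, hw, hI, hwW⟩ := hWa.exists_holomorphic_extension hIo
  have hW : ∀ x : ℝ, (x : ℂ) ∈ U → w x = linePot V x := fun x hx => hwW x ((hI x).2 hx)
  have hW' : ∀ x : ℝ, (x : ℂ) ∈ U →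
      (((0 : ℝ) : ℂ)) ^ 2 * (fun _ : ℂ => (0 : ℂ)) x + w x = linePot V x := fun x hx => by
    simp [hW x hx]
  obtain ⟨O⟩ := hwell.exists_orbitFamily (G₀ := 0) hIo hU (differentiableOn_const (0 : ℂ)) hw
    (fun _ _ => rfl) (fun x hx => by rw [hW x hx, Complex.ofReal_im]) hI hW' hd1 hd2
  obtain ⟨δ, hδ⟩ := O.exists_isAngleStrip
  obtain ⟨hAB, hA2, hen⟩ := lineAngleAction_isAngleActionPair hδ hU hw hwell hI hW
  set L₀ := loopAction I (linePot V) h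
  set g : ℝ → ℝ := fun x => H (L₀ + x) with hg
  have hg1 : deriv g = fun x => deriv H (L₀ + x) := funext fun x => deriv_comp_const_add _ _ _
  have hg2 : deriv (deriv g) 0 = deriv (deriv H) L₀ := by
    rw [hg1, deriv_comp_const_add, add_zero]
  have hgrad : gradient (g ∘ lineCoord) 0 = !₂[deriv H L₀] := by
    rw [gradient_comp_lineCoord]
    simp [hg1, lineCoord_symm_apply]
  obtain ⟨η, hη, hηab⟩ := Metric.isOpen_iff.1 isOpen_Ioo h hh
  -- Each nearby energy level is also a well by A.1, so the identification of actions holds on a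
  -- whole neighbourhood of h, as differentiation requires.
  have hact : ∀ E ∈ Ioo a b, ((E : ℂ), ((0 : ℝ) : ℂ)) ∈ ball ((h : ℂ), ((0 : ℝ) : ℂ)) δ →
      O.actionVar (E, (0 : ℝ)) = (loopAction I (linePot V) E : ℂ) := by
    intro E hE hp
    obtain ⟨y₁, y₂, hy⟩ := hwells E hE
    exact O.actionVar_eq_loopAction (hδ.ball_subset hp) hW' hI hy.sublevel hy.inside
      hWa.continuousOn
  rw [← hgrad] at hdio ⊢
  refine hAB.propertyP1 hA2 (𝓔 := fun J => h + J 0) (by fun_prop) (fun z z' hz hB => ?_) hη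
    (fun z z' hz hzδ hzA => ?_) (fun v hv => ?_) hdio
  · rw [hen z z' hz hB]
    simp [complexifyVec_apply]
  · have hE : h + z.2 0 ∈ Ioo a b := hηab (by
      rw [mem_ball_iff_norm, add_sub_cancel_left]
      exact (PiLp.norm_apply_le z.2 0).trans_lt hz)
    have hm := (lineLift_mem (E₀ := h) (complexifyPhase_mem_torusBall hδ.pos hzδ)).2
    rw [lineLift_complexify] at hm
    have h1 : O.actionVar (lineLift h (complexifyPhase z)).2 - O.actionVar (h, (0 : ℝ)) = z'.2 0 :=
      congrArg (fun y : CPhase 1 => y.2 0) hzA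
    rw [lineLift_complexify, hact _ hE hm, hact h hh (mem_ball_self hδ.pos)] at h1
    have h2 : L₀ + z'.2 0 = loopAction I (linePot V) (h + z.2 0) := by
      have : loopAction I (linePot V) (h + z.2 0) - L₀ = z'.2 0 := by exact_mod_cast h1
      linarith
    simp only [Function.comp_apply, lineCoord_apply, hg, h2, hA.inverse _ hE]
    simp [complexifyVec_apply]
  · have h1 := fderiv_gradient_comp_lineCoord g 0 v
    rw [hv, map_zero, hg2, eq_comm] at h1
    have h2 := (mul_eq_zero.1 h1).resolve_left (hA.nondegenerate h hh)
    exact lineCoord.map_eq_zero_iff.1 h2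

/-- The strategy is that of the line, but non-critical turning points have to be derived from the
Diophantine condition and from the wells at nearby (E, G). -/
theorem propertyP1_plane {V : ℝ → ℝ} {a b g₁ g₂ : ℝ} (hV : AnalyticOnNhd ℝ V (Ioi 0))
    (hA : AssumptionA2 V a b g₁ g₂) {h G : ℝ} (hh : h ∈ Ioo a b) (hG : G ∈ Ioo g₁ g₂)
    {Hhat : EuclideanSpace ℝ (Fin 2) → ℝ} (hH : IsLocalEnergyMap V h G Hhat)
    (hdio : IsDiophantine (gradient Hhat !₂[radialAction V h G, G])) :
    PropertyP1 planePhase (fun _ => mechHam 2 V) (fun _ => planeTorus V h G)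
      (fun _ => gradient Hhat !₂[radialAction V h G, G]) := by
  set q₀ : EuclideanSpace ℝ (Fin 2) := !₂[radialAction V h G, G] with hq₀
  obtain ⟨F, hF, hFd, hFl⟩ := hA.nondegenerate h hh G hG
  -- The given local inverse may differ from the one supplied by A.2, but their germs coincide, so
  -- regularity and non-degeneracy transfer.
  have hHF : Hhat =ᶠ[𝓝 q₀] F := hH.eventuallyEq hF hFd.self_of_nhds.continuousAt
  have hgradHF : gradient Hhat =ᶠ[𝓝 q₀] gradient F := by
    filter_upwards [hHF.eventually_nhds] with x hx
    simp only [gradient]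
    rw [EventuallyEq.fderiv_eq hx]
  -- At zero angular momentum the second frequency would vanish, contradicting the Diophantine
  -- condition.
  have hG0 : G ≠ 0 := by
    rintro rfl
    refine hdio.apply_ne_zero 1 ?_
    rw [hgradHF.self_of_nhds]
    exact hF.gradient_eq_zero hFd.self_of_nhds
  have hWa : ∀ G', AnalyticOnNhd ℝ (effPot V G') (Ioi 0) := analyticOnNhd_effPot hV
  have hwells : ∀ E ∈ Ioo a b, ∀ G' ∈ Ioo g₁ g₂,
      ∃ x₁ x₂, IsPotentialWell (Ioi 0) (effPot V G') E x₁ x₂ := fun E hE G' hG' =>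
    (hA.compactness E hE G' hG').exists_isPotentialWell isOpen_Ioi (hWa G').continuousOn
  have hnear : ∀ᶠ p : ℝ × ℝ in 𝓝 (h, G), p.1 ∈ Ioo a b ∧ p.2 ∈ Ioo g₁ g₂ :=
    prod_mem_nhds (isOpen_Ioo.mem_nhds hh) (isOpen_Ioo.mem_nhds hG)
  obtain ⟨x₁, x₂, hwell⟩ := hwells h hh G hG
  obtain ⟨hd1, hd2⟩ := deriv_effPot_ne_zero hV hG0 hwell
    (hnear.mono fun p hp => hwells p.1 hp.1 p.2 hp.2)
  obtain ⟨U₁, w₁, hU₁, hw₁, hI₁, hwV⟩ := hV.exists_holomorphic_extension isOpen_Ioi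
  -- In the right half-plane 1/(2x²) is holomorphic, and a complex radius is determined by its
  -- square.
  set U : Set ℂ := U₁ ∩ {x | 0 < x.re} with hU_def
  have hU : IsOpen U := hU₁.inter (isOpen_lt continuous_const Complex.continuous_re)
  have hUre : ∀ x ∈ U, 0 < x.re := fun x hx => hx.2
  have hne : ∀ x ∈ U, x ≠ 0 := by
    rintro x hx rfl
    simpa using hUre _ hx
  have hI : ∀ x : ℝ, x ∈ Ioi (0 : ℝ) ↔ (x : ℂ) ∈ U := fun x =>
    ⟨fun hx => ⟨(hI₁ x).1 hx, by simpa using hx⟩, fun hx => by simpa using hUre _ hx⟩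
  set u : ℂ → ℂ := fun x => 1 / (2 * x ^ 2) with hu_def
  set w : ℂ → ℂ := fun x => -w₁ x with hw_def
  have hu : DifferentiableOn ℂ u U := by
    refine DifferentiableOn.div (by fun_prop) (by fun_prop) fun x hx => ?_
    simpa using hne x hx
  have hw : DifferentiableOn ℂ w U := (hw₁.mono inter_subset_left).neg
  have hur' : ∀ x : ℝ, u x = ((1 / (2 * x ^ 2) : ℝ) : ℂ) := fun x => by simp [hu_def]
  have hwr' : ∀ x : ℝ, (x : ℂ) ∈ U → w x = ((-V x : ℝ) : ℂ) := fun x hx => by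
    simp [hw_def, hwV x ((hI x).2 hx)]
  have hur : ∀ x : ℝ, (x : ℂ) ∈ U → (u x).im = 0 := fun x _ => by rw [hur', Complex.ofReal_im]
  have hW : ∀ G' x : ℝ, (x : ℂ) ∈ U → (G' : ℂ) ^ 2 * u x + w x = effPot V G' x := by
    intro G' x hx
    rw [hur', hwr' x hx, effPot]
    push_cast
    ring
  obtain ⟨O⟩ := hwell.exists_orbitFamily isOpen_Ioi hU hu hw hur
    (fun x hx => by rw [hwr' x hx, Complex.ofReal_im]) hI (hW G) hd1 hd2
  obtain ⟨δ, hδ⟩ := O.exists_isAngleStrip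
  obtain ⟨hAB, hA2, hen⟩ :=
    planeAngleAction_isAngleActionPair hδ hU hu hw hur hUre hwell hI hW
  have hact : ∀ p : ℝ × ℝ, p.1 ∈ Ioo a b ∧ p.2 ∈ Ioo g₁ g₂ →
      ((p.1 : ℂ), (p.2 : ℂ)) ∈ ball ((h : ℂ), (G : ℂ)) δ →
      O.actionVar (p.1, p.2) = (radialAction V p.1 p.2 : ℂ) := by
    intro p hp hpb
    obtain ⟨y₁, y₂, hy⟩ := hwells p.1 hp.1 p.2 hp.2
    exact O.actionVar_eq_loopAction (hδ.ball_subset hpb) (hW p.2) hI hy.sublevel hy.inside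
      (hWa p.2).continuousOn
  -- η keeps (E, G) in the rectangle of A.2 and where `Hhat` inverts the action map, so that the
  -- energy is Hhat(q₀ + J).
  obtain ⟨η, hη, hηp⟩ := Metric.eventually_nhds_iff.1 (hnear.and hH.left_inv)
  have hgrad : gradient (fun J => Hhat (q₀ + J)) = fun J => gradient Hhat (q₀ + J) := by
    funext J
    simp only [gradient]
    rw [fderiv_comp_add_left]
  have hgrad0 : gradient (fun J => Hhat (q₀ + J)) 0 = gradient Hhat q₀ := by
    simp only [hgrad, add_zero]
  rw [← hgrad0] at hdio ⊢
  refine hAB.propertyP1 hA2 (𝓔 := fun J => h + J 0) (by fun_prop) (fun z z' hz hB => ?_) hη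
    (fun z z' hz hzδ hzA => ?_) (fun v hv => ?_) hdio
  · rw [hen z z' hz hB]
    simp [complexifyVec_apply]
  · have hdist : dist (h + z.2 0, G + z.2 1) (h, G) < η := by
      rw [Prod.dist_eq, max_lt_iff, Real.dist_eq, Real.dist_eq, add_sub_cancel_left,
        add_sub_cancel_left]
      exact ⟨(PiLp.norm_apply_le z.2 0).trans_lt hz, (PiLp.norm_apply_le z.2 1).trans_lt hz⟩
    obtain ⟨hE, hinv⟩ := hηp hdist
    have hm := (planeLift_mem (E₀ := h) (G₀ := G) (complexifyPhase_mem_torusBall hδ.pos hzδ)).2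
    rw [planeLift_complexify] at hm
    have h1 : O.actionVar (planeLift h G (complexifyPhase z)).2 - O.actionVar (h, G) = z'.2 0 :=
      congrArg (fun y : CPhase 2 => y.2 0) hzA
    have h2 : ((z.2 1 : ℝ) : ℂ) = z'.2 1 := congrArg (fun y : CPhase 2 => y.2 1) hzA
    rw [planeLift_complexify, hact (h + z.2 0, G + z.2 1) hE hm,
      hact (h, G) ⟨hh, hG⟩ (mem_ball_self hδ.pos)] at h1
    have h3 : radialAction V (h + z.2 0) (G + z.2 1) - radialAction V h G = z'.2 0 := by
      exact_mod_cast h1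
    have h4 : z.2 1 = z'.2 1 := by exact_mod_cast h2
    have h5 : q₀ + z'.2 = !₂[radialAction V (h + z.2 0) (G + z.2 1), G + z.2 1] := by
      ext j
      fin_cases j
      · simp [hq₀, ← h3]
      · simp [hq₀, h4]
    simp only [h5]
    rw [hinv]
    simp [complexifyVec_apply]
  · rw [hgrad, fderiv_comp_add_left, add_zero, hgradHF.fderiv_eq] at hv
    exact IsLocalDiffeomorphAt.fderiv_eq_zero hFl hv

end Main

end

theorem mainTheorem7 :
    (∀ (V : ℝ → ℝ) (I : Set ℝ) (a b : ℝ) (H : ℝ → ℝ),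
      IsOpen I → I.OrdConnected →
      AnalyticOnNhd ℝ (fun x : ℝ => V |x|) I →
      AssumptionA1 V I a b H →
      ∀ h ∈ Set.Ioo a b, ∀ ξ : EuclideanSpace ℝ (Fin 1),
        ξ = !₂[deriv H (loopAction I (linePot V) h)] →
        IsDiophantine ξ →
        PropertyP1 (linePhase I) (fun _ => mechHam 1 V) (fun _ => lineTorus V I h)
          (fun _ => ξ)) ∧
    (∀ (V : ℝ → ℝ) (a b g₁ g₂ : ℝ),
      AnalyticOnNhd ℝ V (Set.Ioi 0) →
      AssumptionA2 V a b g₁ g₂ →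
      ∀ h ∈ Set.Ioo a b, ∀ G ∈ Set.Ioo g₁ g₂,
        ∀ Hhat : EuclideanSpace ℝ (Fin 2) → ℝ, IsLocalEnergyMap V h G Hhat →
        ∀ ξ : EuclideanSpace ℝ (Fin 2),
          ξ = gradient Hhat !₂[radialAction V h G, G] →
          IsDiophantine ξ →
          PropertyP1 planePhase (fun _ => mechHam 2 V) (fun _ => planeTorus V h G)
            (fun _ => ξ)) := by
  refine ⟨fun V I a b H hIo _ hV hA h hh ξ hξ hdio => ?_,
    fun V a b g₁ g₂ hV hA h hh G hG Hhat hH ξ hξ hdio => ?_⟩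
  · subst hξ
    exact propertyP1_line hIo hV hA hh hdio
  · subst hξ
    exact propertyP1_plane hV hA hh hG hH hdio
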